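/- **Setting.** Let $\Omega\subset\mathbb R^3$ be a bounded open set with $\operatorname{int}\overline\Omega=\Omega$ (for instance a bounded Lipschitz polyhedral domain). Let $k\ge 1$ and $r\ge 0$ be integers and $\sigma, C_I, C_\alpha, C_\delta$ real numbers. Sobolev spaces are defined by weak derivatives, with norms $\|\cdot\|_{s,D}$ and semi-norms $|\cdot|_{s,D}$ of $H^s(D)$, and $\|f\|_{1,\infty,D}=\max_{|a|\le 1}\|\partial^a f\|_{L^\infty(D)}$. Consider the following data. * $\beta\in (W^{1,\infty}(\Omega))^3$, continuous on $\overline\Omega$; $L_\beta w=-\beta\times(\nabla\times w)+\nabla(\beta\cdot w)$ in the weak sense. * $\mathcal T_h$ is a conforming triangulation of $\Omega$ by finitely many closed tetrahedra $T$ with diameters $h_T$, each of which contains a ball of some diameter $\rho_T>0$ with $h_T\le\sigma\rho_T$. $\mathcal F_h$ is the set of its facets (a boundary facet belongs to exactly one element, an interior facet to two), $n$ is a unit normal, and $n_T$ is the unit normal outward to $T$. For a piecewise $H^1$ field $w$, $w^\pm$ are the traces on a facet $F$ from the two elements $T^\pm$ that contain $F$ (there is only one trace if $F$ is a boundary facet).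 On the facets of $T$, put $[\![w]\!]_T=w|_T-w|_{T'}$ on a facet shared with $T'$, and $[\![w]\!]_T=w|_T$ on a boundary facet. * $\alpha$ is a measurable facet weight with one value $\alpha|_{\partial T}$ from each side of a facet. On interior facets the two values sum to $1$ and are bounded by $C_\alpha$ in absolute value. On boundary facets $\alpha=1$ where $\beta\cdot n_T<0$ and $\alpha=0$ where $\beta\cdot n_T\ge 0$. * $V_h\subset H(\mathrm{curl};\Omega)$ is a finite element space, a linear space of piecewise polynomial vector fields of degree at most $r$. The lifting $r_\alpha|_T(g)\in V_h|_T$ of $g\in (L^2(\partial T))^3$ is defined by $\int_T r_\alpha(g)\cdot w_h\,dx=\int_{\partial T}\alpha|_{\partial T}\,g\cdot w_h\,ds$ for all $w_h\in V_h|_T$, and $$\tilde L_{\beta,h}w|_T = L_\beta (w|_T)-r_\alpha|_T\big((\beta\cdot n_T)[\![w]\!]_T\big).$$ * $i_h:(H^{k+1}(\Omega))^3\to V_h$ is an interpolation operator such that $\|v-i_hv\|_{m,T}\le C_I h_T^{k+1-m}|v|_{k+1,T}$ for all $v\in (H^{k+1}(\Omega))^3$, all $T\in\mathcal T_h$ and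 all integers $0\le m\le k+1$. **Lemma 5.2 (approximation inequalities).** There is a nondecreasing function $\Phi:\mathbb R\to(0,\infty)$, depending only on $\Omega,k,r,\sigma,C_I,C_\alpha,C_\delta$, such that for all data as above the following holds with $C_T=\Phi(\|\beta\|_{1,\infty,T})$, a constant that depends on $\beta$ only through its restriction to $T$ and does not depend on the mesh size. For every $v\in (H^{k+1}(\Omega))^3$ the traces of $v-i_hv$ on the boundaries of the elements and the field $\tilde L_{\beta,h}(v-i_hv)$ are defined, and $$\sum_{F\in\mathcal F_h}\big\langle|\beta\cdot n|,\ |(v-i_hv)^+|^2+|(v-i_hv)^-|^2\big\rangle_F\ \le\ \sum_{T\in\mathcal T_h}C_T\,h_T^{2k+1}|v|_{k+1,T}^2,$$ where on a boundary facet the left-hand side has the single trace only. If moreover $\delta_T>0$ $(T\in\mathcal T_h)$ are numbers such that $\delta_{T'}\le C_\delta\,\delta_T$ whenever $T'\cap T\ne\varnothing$ (that is, $\delta_{\omega(T)}\le C_\delta\,\delta_T$ with $\delta_{\omega(T)}=\max_{T'\cap T\neq\varnothing}\delta_{T'}$), then $$\sum_{T\in\mathcal T_h}\delta_T\,\|\tilde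 L_{\beta,h}(v-i_hv)\|_{0,T}^2\ \le\ \sum_{T\in\mathcal T_h}C_T\,\delta_T\,h_T^{2k}|v|_{k+1,T}^2 .$$ -/

import Mathlib

open MeasureTheory Filter Topology
open scoped ENNReal ContDiff InnerProductSpace

noncomputable section

namespace MagneticSUPG

/-- The Euclidean space `ℝ³`. -/
abbrev E : Type := EuclideanSpace ℝ (Fin 3)

/-! ### Weak derivatives and Sobolev norms -/

section Sobolev

variable {F : Type*} [NormedAddCommGroup F] [NormedSpace ℝ F]

/-- The classical partial derivative `∂ᵢ φ`. -/
def pd (i : Fin 3) (φ : E → F) : E → F :=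
  fun x => fderiv ℝ φ x (EuclideanSpace.single i 1)

/-- The classical derivative `∂^a φ` for a multi-index `a` (applied to smooth functions). -/
def pdMulti (a : Fin 3 → ℕ) (φ : E → F) : E → F :=
  (pd 0)^[a 0] ((pd 1)^[a 1] ((pd 2)^[a 2] φ))

/-- `φ ∈ C_c^∞(U)`. -/
def IsTest (U : Set E) (φ : E → F) : Prop :=
  ContDiff ℝ ∞ φ ∧ HasCompactSupport φ ∧ tsupport φ ⊆ U

/-- `g` is the weak derivative `∂^a f` on the open set `U`. -/
def IsWeakDeriv (U : Set E) (a : Fin 3 → ℕ) (f g : E → F) : Prop :=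
  LocallyIntegrableOn f U ∧ LocallyIntegrableOn g U ∧
    ∀ φ : E → ℝ, IsTest U φ →
      ∫ x in U, pdMulti a φ x • f x = (-1 : ℝ) ^ (∑ i, a i) • ∫ x in U, φ x • g x

/-- The multi-indices of order exactly `s`. -/
def multiIdx (s : ℕ) : Finset (Fin 3 → ℕ) := Finset.piAntidiag Finset.univ s

/-- `‖∂^a f‖_{L^p(U)}`. Weak derivatives are unique almost everywhere, so the infimum is over a
single value; it is `∞` if the weak derivative does not exist. -/
def derivNorm (p : ℝ≥0∞) (U : Set E) (a : Fin 3 → ℕ) (f : E → F) : ℝ≥0∞ :=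
  ⨅ (g : E → F) (_ : IsWeakDeriv U a f g), eLpNorm g p (volume.restrict U)

/-- `f ∈ W^{s,p}(U)`. -/
def MemW (s : ℕ) (p : ℝ≥0∞) (U : Set E) (f : E → F) : Prop :=
  ∀ a : Fin 3 → ℕ, ∑ i, a i ≤ s → ∃ g, IsWeakDeriv U a f g ∧ MemLp g p (volume.restrict U)

/-- The semi-norm `|f|_{s,U}` of `H^s(U)`. -/
def hSemi (s : ℕ) (U : Set E) (f : E → F) : ℝ≥0∞ :=
  (∑ a ∈ multiIdx s, derivNorm 2 U a f ^ 2) ^ (1 / 2 : ℝ)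

/-- The norm `‖f‖_{s,U}` of `H^s(U)`. -/
def hNorm (s : ℕ) (U : Set E) (f : E → F) : ℝ≥0∞ :=
  (∑ j ∈ Finset.range (s + 1), hSemi j U f ^ 2) ^ (1 / 2 : ℝ)

/-- The norm `‖f‖_{1,∞,U}` of `W^{1,∞}(U)`: the maximum of the `L^∞` norms of the weak
derivatives of order at most one. -/
def wInfNorm (U : Set E) (f : E → F) : ℝ≥0∞ :=
  (multiIdx 0 ∪ multiIdx 1).sup fun a => derivNorm ∞ U a f

end Sobolev

/-! ### Curl, and the magnetic advection (Lie derivative) -/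

/-- The cross product on `ℝ³`. -/
def cross (a b : E) : E := WithLp.toLp 2 (crossProduct (WithLp.ofLp a) (WithLp.ofLp b))

/-- The classical curl (applied to smooth fields). -/
def curl (φ : E → E) (x : E) : E :=
  !₂[pd 1 φ x 2 - pd 2 φ x 1, pd 2 φ x 0 - pd 0 φ x 2, pd 0 φ x 1 - pd 1 φ x 0]

/-- `g` is the weak curl of `f` on `U`. -/
def IsWeakCurl (U : Set E) (f g : E → E) : Prop :=
  LocallyIntegrableOn f U ∧ LocallyIntegrableOn g U ∧
    ∀ φ : E → E, IsTest U φ → ∫ x in U, ⟪f x, curl φ x⟫_ℝ = ∫ x in U, ⟪g x, φ x⟫_ℝ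

/-- `f ∈ H(curl; U)`. -/
def MemHcurl (U : Set E) (f : E → E) : Prop :=
  MemLp f 2 (volume.restrict U) ∧ ∃ g, IsWeakCurl U f g ∧ MemLp g 2 (volume.restrict U)

/-- `g` is the weak gradient of the scalar function `f` on `U`. -/
def IsWeakGrad (U : Set E) (f : E → ℝ) (g : E → E) : Prop :=
  ∀ i : Fin 3, IsWeakDeriv U (Pi.single i 1) f (fun x => g x i)

/-- `A = L_β w = - β × (∇ × w) + ∇ (β · w)` on `U`, in the weak sense. -/
def IsLie (U : Set E) (β w A : E → E) : Prop :=
  ∃ c g : E → E, IsWeakCurl U w c ∧ IsWeakGrad U (fun x => ⟪β x, w x⟫_ℝ) g ∧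
    ∀ x, A x = -cross (β x) (c x) + g x

/-! ### Simplicial meshes -/

/-- The closed simplex with the given vertices. -/
def simplex (T : Finset E) : Set E := convexHull ℝ (T : Set E)

/-- The open tetrahedron with the given vertices. -/
def cell (T : Finset E) : Set E := interior (simplex T)

/-- The diameter `h_T`. -/
def diamT (T : Finset E) : ℝ := Metric.diam (simplex T)

/-- The four facets of a tetrahedron, as sets of three vertices. -/
def facetsOf (T : Finset E) : Finset (Finset E) := T.powersetCard 3

/-- The surface measure on a facet. -/
def surf (F : Finset E) : Measure E :=
  (Measure.euclideanHausdorffMeasure 2 : Measure E).restrict (simplex F)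

/-- The barycenter of a set of vertices. -/
def bary (S : Finset E) : E := (S.card : ℝ)⁻¹ • ∑ p ∈ S, p

/-- The unit normal to the facet `F` of the tetrahedron `T`, outward to `T`: the normalized
component, normal to the plane of `F`, of the vector from the barycenter of `T` to that of `F`. -/
def normal (T F : Finset E) : E :=
  let d := (vectorSpan ℝ (F : Set E))ᗮ.starProjection (bary F - bary T)
  ‖d‖⁻¹ • d

/-- A (conforming, tetrahedral) triangulation of `Ω`; a tetrahedron is given by its vertices. -/
structure Mesh (Ω : Set E) where
  cells : Finset (Finset E)
  card_eq : ∀ T ∈ cells, T.card = 4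
  indep : ∀ T ∈ cells, AffineIndependent ℝ ((↑) : T → E)
  conforming : ∀ T ∈ cells, ∀ T' ∈ cells,
    simplex T ∩ simplex T' = convexHull ℝ ((T : Set E) ∩ (T' : Set E))
  cover : ⋃ T ∈ cells, simplex T = closure Ω

/-- Shape regularity with constant `σ`: each `T` contains a ball of diameter `ρ` with
`h_T ≤ σ ρ`. -/
def Mesh.ShapeRegular {Ω : Set E} (M : Mesh Ω) (σ : ℝ) : Prop :=
  ∀ T ∈ M.cells, ∃ (c : E) (ρ : ℝ), 0 < ρ ∧ Metric.closedBall c (ρ / 2) ⊆ simplex T ∧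
    diamT T ≤ σ * ρ

open Classical in
/-- The set of all facets. -/
def Mesh.facets {Ω : Set E} (M : Mesh Ω) : Finset (Finset E) := M.cells.biUnion facetsOf

open Classical in
/-- The elements that have `F` as a facet (two for an interior facet, one for a boundary facet). -/
def Mesh.sides {Ω : Set E} (M : Mesh Ω) (F : Finset E) : Finset (Finset E) :=
  M.cells.filter fun T => F ⊆ T

open Classical in
/-- The jump across the facet `F` seen from `T`: `w|_T - w|_{T'}` if `F` is shared with `T'`,
and `w|_T` if `F` is a boundary facet (there the sum is empty). With `T = T⁺`, the product of
`β · n⁺` with this jump does not change when the labels `+` and `-` are exchanged. -/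
def Mesh.jump {Ω : Set E} (M : Mesh Ω) (w : Finset E → E → E) (T F : Finset E) (x : E) : E :=
  w T x - ∑ T' ∈ (M.sides F).erase T, w T' x

/-- The facet weight: `α T F` is the value of `α|_{∂T}` on the facet `F` of `T`. On an interior
facet the two values are of order one and add up to one; on a boundary facet the value is `1`
on the inflow boundary `β · n < 0`, and `0` on the outflow boundary `β · n ≥ 0`. -/
structure Mesh.IsWeight {Ω : Set E} (M : Mesh Ω) (β : E → E) (Cα : ℝ)
    (α : Finset E → Finset E → E → ℝ) : Prop where
  measurable : ∀ T ∈ M.cells, ∀ F ∈ facetsOf T, AEStronglyMeasurable (α T F) (surf F)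
  interior : ∀ T ∈ M.cells, ∀ T' ∈ M.cells, T ≠ T' → ∀ F ∈ facetsOf T, F ∈ facetsOf T' →
    ∀ x ∈ simplex F, α T F x + α T' F x = 1 ∧ |α T F x| ≤ Cα
  inflow : ∀ T ∈ M.cells, ∀ F ∈ facetsOf T, M.sides F = {T} →
    ∀ x ∈ simplex F, ⟪β x, normal T F⟫_ℝ < 0 → α T F x = 1
  outflow : ∀ T ∈ M.cells, ∀ F ∈ facetsOf T, M.sides F = {T} →
    ∀ x ∈ simplex F, 0 ≤ ⟪β x, normal T F⟫_ℝ → α T F x = 0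

/-! ### Finite element spaces -/

/-- A polynomial vector field of degree at most `r`. -/
def IsPolyField (r : ℕ) (u : E → E) : Prop :=
  ∃ p : Fin 3 → MvPolynomial (Fin 3) ℝ,
    ∀ i, (p i).totalDegree ≤ r ∧ ∀ x : E, u x i = MvPolynomial.eval (fun j => x j) (p i)

/-- The function on `Ω` with the restriction `u T` to each open tetrahedron `T`. -/
def Mesh.glue {Ω : Set E} (M : Mesh Ω) (u : Finset E → E → E) (x : E) : E :=
  ∑ T ∈ M.cells, (cell T).indicator (u T) x

/-- An `H(curl)`-conforming finite element space on the mesh, with polynomials of degree at most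
`r` on each element. An element `u` of the space is given by its polynomial pieces `u T`. -/
structure FESpace {Ω : Set E} (M : Mesh Ω) (r : ℕ) where
  space : Submodule ℝ (Finset E → E → E)
  poly : ∀ u ∈ space, ∀ T ∈ M.cells, IsPolyField r (u T)
  conforming : ∀ u ∈ space, MemHcurl Ω (M.glue u)

/-- The local space `V_h|_T`. -/
def FESpace.loc {Ω : Set E} {M : Mesh Ω} {r : ℕ} (V : FESpace M r) (T : Finset E) :
    Submodule ℝ (E → E) :=
  V.space.map (LinearMap.proj T)

/-- `R = r_α|_T(g)`, the lifting into `V_h|_T` of the field on `∂T` that equals `g F` on `F`. -/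
def FESpace.IsLifting {Ω : Set E} {M : Mesh Ω} {r : ℕ} (V : FESpace M r)
    (α : Finset E → Finset E → E → ℝ) (T : Finset E) (g : Finset E → E → E) (R : E → E) : Prop :=
  R ∈ V.loc T ∧ ∀ w ∈ V.loc T,
    ∫ x in cell T, ⟪R x, w x⟫_ℝ = ∑ F ∈ facetsOf T, ∫ x, α T F x * ⟪g F x, w x⟫_ℝ ∂(surf F)

/-! ### Traces and the discrete magnetic advection operator -/

/-- `g` is the trace on `∂T` of `f ∈ H¹(T)`: the limit in `L²(∂T)` of the restrictions of smooth
fields that converge to `f` in `H¹(T)`. -/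
def IsTrace (T : Finset E) (f g : E → E) : Prop :=
  (∀ F ∈ facetsOf T, MemLp g 2 (surf F)) ∧
  ∃ φ : ℕ → E → E, (∀ n, ContDiff ℝ ∞ (φ n)) ∧
    Tendsto (fun n => hNorm 1 (cell T) (fun x => φ n x - f x)) atTop (𝓝 0) ∧
    ∀ F ∈ facetsOf T, Tendsto (fun n => eLpNorm (fun x => φ n x - g x) 2 (surf F)) atTop (𝓝 0)

/-- `z` is the restriction to `T` of `L̃_{β,h} w`, that is, `L_β w|_T - r_α|_T(β · n ⟦w⟧)`, for the
piecewise field `w` whose restriction to each element `T'` is `w T'`, with trace `tr T'`. -/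
def FESpace.IsDiscreteLie {Ω : Set E} {M : Mesh Ω} {r : ℕ} (V : FESpace M r) (β : E → E)
    (α : Finset E → Finset E → E → ℝ) (w tr : Finset E → E → E) (T : Finset E) (z : E → E) :
    Prop :=
  ∃ A R : E → E, IsLie (cell T) β (w T) A ∧
    V.IsLifting α T (fun F x => ⟪β x, normal T F⟫_ℝ • M.jump tr T F x) R ∧
    ∀ x, z x = A x - R x

/-- `iₕ` is an interpolation operator into the finite element space with the approximation
property of order `k` and constant `CI`. -/
def FESpace.IsInterpolation {Ω : Set E} {M : Mesh Ω} {r : ℕ} (V : FESpace M r) (k : ℕ) (CI : ℝ)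
    (ih : (E → E) → Finset E → E → E) : Prop :=
  ∀ v : E → E, MemW (k + 1) 2 Ω v → ih v ∈ V.space ∧
    ∀ T ∈ M.cells, ∀ m ≤ k + 1,
      hNorm m (cell T) (fun x => v x - ih v T x) ≤
        ENNReal.ofReal (CI * diamT T ^ (k + 1 - m)) * hSemi (k + 1) (cell T) v

end MagneticSUPG

end

/-!
Everything rests on one estimate on a single tetrahedron `T` (`lintegral_surf_le`). Cover a facet
by three corners, one for each vertex. From a point of the corner at `a`, the segment in the
direction of the edge that leaves the facet at `a`, of a third of the length of that edge, stays
in `T`. If `G x` is at most the integral of `H` along every such segment that starts at `x`, then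
integrating over the facet gives `∫_F G ≤ C σ³ h_T⁻¹ ∫_T H`. The surface measure only has to be
bounded from above by the parametrization, which is Lipschitz, and the Jacobian of the affine
coordinates is controlled by the volume of the inscribed ball. There are two applications.

* For smooth `φ`, the fundamental theorem of calculus allows `G = |φ|²` and `H = C (|φ|² + h_T²
  |∇φ|²)`, which is the scaled trace inequality. Smooth fields are dense in `H¹` of the convex set
  `T` (`MemH1.exists_smooth_approx`: contract towards an interior point, then mollify), so every
  `H¹` field has a trace (`IsRegularTet.exists_isTrace`), and every trace satisfies the inequality
  (`IsTrace.eLpNorm_sq_le`).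
* For a polynomial field `u` of degree at most `r`, the restriction to a segment is a polynomial
  of one variable, and norms on a finite-dimensional space are equivalent; so `G = |u|²` and `H =
  C_r |u|²` are allowed. This discrete trace inequality, applied to the lifting tested with
  itself, bounds the lifting by `h_T^(-1/2)` times the norm of its data on the boundary
  (`FESpace.IsLifting.eLpNorm_sq_le`).

For the error `v - iₕ v`, the approximation property with `m = 0, 1` turns the trace inequality
into a bound of the squared trace by `h_T^(2k+1) |v|²_{k+1,T}`. The first inequality follows at
once, because the continuous field `β` is bounded on the closed tetrahedron by `‖β‖_{1,∞,T}`. In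
the second one, `L_β (v - iₕ v)` is bounded by the product rule (`MemH1.isWeakDeriv_inner`) and
the `H¹` error. The jump in the argument of the lifting is estimated by the traces from both sides
of the facet, and `β` is bounded on each side by its norm in the element of that side; the term
from a neighbour `T'` thus carries `‖β‖_{1,∞,T'}` and `|v|_{k+1,T'}`, and is reassigned to `T'` in
the sum over the elements. This is possible because elements with a common facet have comparable
diameters (`diamT_le_of_common_facet`) and parameters `δ`, and because a conforming mesh has at
most two elements at each facet (`card_sides_le_two`).
-/

namespace MagneticSUPG

/-! ### Test functions and weak derivatives -/

section WeakDeriv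

variable {F : Type*} [NormedAddCommGroup F] [NormedSpace ℝ F]

theorem contDiff_pd {φ : E → F} (h : ContDiff ℝ ∞ φ) (i : Fin 3) : ContDiff ℝ ∞ (pd i φ) :=
  (h.fderiv_right (m := ∞) (by simp)).clm_apply contDiff_const

theorem tsupport_pd_subset (i : Fin 3) (φ : E → F) : tsupport (pd i φ) ⊆ tsupport φ := by
  refine closure_minimal (fun x hx => support_fderiv_subset ℝ (f := φ) ?_) (isClosed_tsupport φ)
  intro h0
  exact hx (by simp [pd, h0])

theorem IsTest.pd {U : Set E} {φ : E → F} (h : IsTest U φ) (i : Fin 3) : IsTest U (pd i φ) :=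
  ⟨contDiff_pd h.1 i, h.2.1.mono' ((subset_tsupport _).trans (tsupport_pd_subset i φ)),
    (tsupport_pd_subset i φ).trans h.2.2⟩

theorem IsTest.pd_iterate {U : Set E} {φ : E → F} (h : IsTest U φ) (i : Fin 3) (n : ℕ) :
    IsTest U ((MagneticSUPG.pd i)^[n] φ) := by
  induction n with
  | zero => exact h
  | succ n ih => rw [Function.iterate_succ_apply']; exact ih.pd i

theorem IsTest.pdMulti {U : Set E} {φ : E → F} (h : IsTest U φ) (a : Fin 3 → ℕ) :
    IsTest U (pdMulti a φ) :=
  ((h.pd_iterate 2 _).pd_iterate 1 _).pd_iterate 0 _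

theorem IsTest.mono {U V : Set E} {φ : E → F} (h : IsTest U φ) (hUV : U ⊆ V) : IsTest V φ :=
  ⟨h.1, h.2.1, h.2.2.trans hUV⟩

theorem IsTest.eq_zero {U : Set E} {φ : E → F} (h : IsTest U φ) {x : E} (hx : x ∉ U) : φ x = 0 :=
  image_eq_zero_of_notMem_tsupport fun hx' => hx (h.2.2 hx')

theorem IsTest.smul_const {U : Set E} {η : E → ℝ} (h : IsTest U η) (v : F) :
    IsTest U (fun x => η x • v) := by
  refine ⟨h.1.smul contDiff_const, h.2.1.smul_right, ?_⟩
  exact (closure_mono (Function.support_smul_subset_left _ _)).trans h.2.2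

/-- A product with a test function only sees the domain that carries the test function. -/
theorem IsTest.setIntegral_smul {U : Set E} {φ : E → ℝ} (h : IsTest U φ) (f : E → F) :
    ∫ x in U, φ x • f x = ∫ x, φ x • f x :=
  setIntegral_eq_integral_of_forall_compl_eq_zero fun x hx => by simp [h.eq_zero hx]

theorem IsTest.integrable_smul {U : Set E} {φ : E → ℝ} (h : IsTest U φ) {f : E → F}
    (hf : LocallyIntegrableOn f U) : Integrable (fun x => φ x • f x) := by
  have h1 : IntegrableOn f (tsupport φ) :=
    hf.integrableOn_compact_subset h.2.2 h.2.1
  have h2 : IntegrableOn (fun x => φ x • f x) (tsupport φ) :=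
    h1.continuousOn_smul h.1.continuous.continuousOn h.2.1
  refine (integrableOn_iff_integrable_of_support_subset ?_).1 h2
  exact (Function.support_smul_subset_left _ _).trans (subset_tsupport _)

theorem pdMulti_zero (φ : E → F) : pdMulti 0 φ = φ := rfl

theorem pdMulti_single (i : Fin 3) (φ : E → F) : pdMulti (Pi.single i 1) φ = pd i φ := by
  fin_cases i <;> simp [pdMulti]

theorem sum_single_one (i : Fin 3) : ∑ j, (Pi.single i 1 : Fin 3 → ℕ) j = 1 := by
  simp

theorem isWeakDeriv_single_iff {U : Set E} {i : Fin 3} {f g : E → F} :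
    IsWeakDeriv U (Pi.single i 1) f g ↔ LocallyIntegrableOn f U ∧ LocallyIntegrableOn g U ∧
      ∀ φ : E → ℝ, IsTest U φ → ∫ x, pd i φ x • f x = -∫ x, φ x • g x := by
  refine and_congr_right fun _ => and_congr_right fun _ => forall₂_congr fun φ hφ => ?_
  rw [pdMulti_single, sum_single_one, (hφ.pd i).setIntegral_smul, hφ.setIntegral_smul]
  simp

theorem isWeakDeriv_zero {U : Set E} {f : E → F} (hf : LocallyIntegrableOn f U) :
    IsWeakDeriv U 0 f f :=
  ⟨hf, hf, fun φ _ => by simp [pdMulti_zero]⟩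

/-- Two locally integrable functions with the same integrals against test functions agree. -/
theorem ae_eq_of_forall_test [CompleteSpace F] {U : Set E} (hU : IsOpen U) {g g' : E → F}
    (hg : LocallyIntegrableOn g U) (hg' : LocallyIntegrableOn g' U)
    (h : ∀ φ : E → ℝ, IsTest U φ → ∫ x, φ x • g x = ∫ x, φ x • g' x) :
    g =ᵐ[volume.restrict U] g' := by
  have key := hU.ae_eq_zero_of_integral_contDiff_smul_eq_zero (μ := volume) (hg.sub hg')
    (fun φ h1 h2 h3 => by
      have hφ : IsTest U φ := ⟨h1, h2, h3⟩
      simp only [Pi.sub_apply, smul_sub]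
      rw [integral_sub (hφ.integrable_smul hg) (hφ.integrable_smul hg'), h φ hφ, sub_self])
  rw [Filter.EventuallyEq, ae_restrict_iff' hU.measurableSet]
  filter_upwards [key] with x hx hxU using sub_eq_zero.1 (hx hxU)

theorem IsWeakDeriv.ae_eq [CompleteSpace F] {U : Set E} (hU : IsOpen U) {a : Fin 3 → ℕ}
    {f g g' : E → F} (h : IsWeakDeriv U a f g) (h' : IsWeakDeriv U a f g') :
    g =ᵐ[volume.restrict U] g' := by
  refine ae_eq_of_forall_test hU h.2.1 h'.2.1 fun φ hφ => ?_
  have h1 := h.2.2 φ hφ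
  rw [h'.2.2 φ hφ, hφ.setIntegral_smul, hφ.setIntegral_smul] at h1
  have hne : ((-1 : ℝ) ^ (∑ i, a i)) ≠ 0 := pow_ne_zero _ (by norm_num)
  exact (smul_right_injective _ hne h1).symm

theorem IsWeakDeriv.mono {U V : Set E} {a : Fin 3 → ℕ} {f g : E → F} (h : IsWeakDeriv V a f g)
    (hUV : U ⊆ V) : IsWeakDeriv U a f g := by
  refine ⟨h.1.mono_set hUV, h.2.1.mono_set hUV, fun φ hφ => ?_⟩
  have h1 := h.2.2 φ (hφ.mono hUV)
  rwa [((hφ.mono hUV).pdMulti a).setIntegral_smul, (hφ.mono hUV).setIntegral_smul,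
    ← (hφ.pdMulti a).setIntegral_smul, ← hφ.setIntegral_smul] at h1

theorem IsWeakDeriv.sub {U : Set E} {a : Fin 3 → ℕ} {f g f' g' : E → F}
    (h : IsWeakDeriv U a f g) (h' : IsWeakDeriv U a f' g') :
    IsWeakDeriv U a (fun x => f x - f' x) (fun x => g x - g' x) := by
  refine ⟨h.1.sub h'.1, h.2.1.sub h'.2.1, fun φ hφ => ?_⟩
  simp only [smul_sub]
  rw [integral_sub ((hφ.pdMulti a).integrable_smul h.1).integrableOn
      ((hφ.pdMulti a).integrable_smul h'.1).integrableOn,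
    integral_sub (hφ.integrable_smul h.2.1).integrableOn
      (hφ.integrable_smul h'.2.1).integrableOn, h.2.2 φ hφ, h'.2.2 φ hφ, smul_sub]

theorem integral_smul_pd [CompleteSpace F] {U : Set E} {φ : E → ℝ} (hφ : IsTest U φ) {f : E → F}
    (hf : ContDiff ℝ ∞ f) (i : Fin 3) : ∫ x, pd i φ x • f x = -∫ x, φ x • pd i f x := by
  have hfl : ∀ g : E → F, ContDiff ℝ ∞ g → LocallyIntegrableOn g U := fun g hg =>
    hg.continuous.locallyIntegrable.locallyIntegrableOn U
  have := integral_smul_fderiv_eq_neg_fderiv_smul_of_integrable (μ := (volume : Measure E))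
    (f := φ) (g := f) (v := EuclideanSpace.single i 1)
    ((hφ.pd i).integrable_smul (hfl f hf)) (hφ.integrable_smul (hfl _ (contDiff_pd hf i)))
    (hφ.integrable_smul (hfl f hf))
    (fun x _ => hφ.1.differentiable (by simp) x) (fun x _ => hf.differentiable (by simp) x)
  simp only [pd]
  rw [this, neg_neg]

theorem isWeakDeriv_pd [CompleteSpace F] (U : Set E) {f : E → F} (hf : ContDiff ℝ ∞ f)
    (i : Fin 3) : IsWeakDeriv U (Pi.single i 1) f (pd i f) :=
  isWeakDeriv_single_iff.2 ⟨hf.continuous.locallyIntegrable.locallyIntegrableOn U,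
    (contDiff_pd hf i).continuous.locallyIntegrable.locallyIntegrableOn U,
    fun _ hφ => integral_smul_pd hφ hf i⟩

theorem IsWeakDeriv.congr {U : Set E} {a : Fin 3 → ℕ} {f g f' g' : E → F}
    (h : IsWeakDeriv U a f g) (hf : f =ᵐ[volume.restrict U] f') (hg : g =ᵐ[volume.restrict U] g')
    (hU : IsOpen U) : IsWeakDeriv U a f' g' := by
  have loc : ∀ {u u' : E → F}, u =ᵐ[volume.restrict U] u' → LocallyIntegrableOn u U →
      LocallyIntegrableOn u' U := by
    intro u u' huu' hu
    rw [locallyIntegrableOn_iff hU.isLocallyClosed] at hu ⊢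
    exact fun k hk hkc => (hu k hk hkc).congr (ae_restrict_of_ae_restrict_of_subset hk huu')
  refine ⟨loc hf h.1, loc hg h.2.1, fun φ hφ => ?_⟩
  rw [integral_congr_ae (g := fun x => MagneticSUPG.pdMulti a φ x • f x)
      (by filter_upwards [hf] with x hx; rw [hx]), h.2.2 φ hφ,
    integral_congr_ae (g := fun x => φ x • g' x) (by filter_upwards [hg] with x hx; rw [hx])]

/-- By uniqueness of weak derivatives, the infimum in `derivNorm` is the norm of any one of
them. -/
theorem derivNorm_eq [CompleteSpace F] {U : Set E} (hU : IsOpen U) {a : Fin 3 → ℕ} {f g : E → F}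
    (h : IsWeakDeriv U a f g) (p : ℝ≥0∞) : derivNorm p U a f = eLpNorm g p (volume.restrict U) := by
  refine le_antisymm (iInf₂_le g h) (le_iInf₂ fun g' h' => ?_)
  rw [eLpNorm_congr_ae (h.ae_eq hU h')]

theorem exists_of_derivNorm_lt_top {p : ℝ≥0∞} {U : Set E} {a : Fin 3 → ℕ} {f : E → F}
    (h : derivNorm p U a f < ⊤) :
    ∃ g, IsWeakDeriv U a f g ∧ eLpNorm g p (volume.restrict U) < ⊤ := by
  simp only [derivNorm, iInf_lt_iff] at h
  obtain ⟨g, hg, h⟩ := h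
  exact ⟨g, hg, h⟩

theorem multiIdx_zero : multiIdx 0 = {0} := by
  simp [multiIdx]

theorem multiIdx_one : multiIdx 1 = Finset.univ.image fun i : Fin 3 => Pi.single i 1 := by
  decide

theorem sum_multiIdx_one {M : Type*} [AddCommMonoid M] (f : (Fin 3 → ℕ) → M) :
    ∑ a ∈ multiIdx 1, f a = ∑ i : Fin 3, f (Pi.single i 1) := by
  rw [multiIdx_one, Finset.sum_image]
  intro i _ j _ h
  by_contra hij
  have := congrFun h i
  simp [hij] at this

/-- `f` belongs to `H¹(U)`, and `g i` is its weak derivative in the `i`-th direction. -/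
structure MemH1 (U : Set E) (f : E → F) (g : Fin 3 → E → F) : Prop where
  memLp : MemLp f 2 (volume.restrict U)
  memLp_deriv : ∀ i, MemLp (g i) 2 (volume.restrict U)
  deriv : ∀ i, IsWeakDeriv U (Pi.single i 1) f (g i)

theorem hSemi_zero_sq [CompleteSpace F] {U : Set E} (hU : IsOpen U) {f : E → F}
    (hf : LocallyIntegrableOn f U) : hSemi 0 U f ^ 2 = eLpNorm f 2 (volume.restrict U) ^ 2 := by
  rw [hSemi, multiIdx_zero, Finset.sum_singleton, derivNorm_eq hU (isWeakDeriv_zero hf),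
    ← ENNReal.rpow_natCast (_ ^ (1 / 2 : ℝ)), ← ENNReal.rpow_mul]
  norm_num

theorem hSemi_sq (s : ℕ) (U : Set E) (f : E → F) :
    hSemi s U f ^ 2 = ∑ a ∈ multiIdx s, derivNorm 2 U a f ^ 2 := by
  rw [hSemi, ← ENNReal.rpow_natCast (_ ^ (1 / 2 : ℝ)), ← ENNReal.rpow_mul]
  norm_num

theorem hNorm_sq (s : ℕ) (U : Set E) (f : E → F) :
    hNorm s U f ^ 2 = ∑ j ∈ Finset.range (s + 1), hSemi j U f ^ 2 := by
  rw [hNorm, ← ENNReal.rpow_natCast (_ ^ (1 / 2 : ℝ)), ← ENNReal.rpow_mul]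
  norm_num

theorem hNorm_zero_sq [CompleteSpace F] {U : Set E} (hU : IsOpen U) {f : E → F}
    (hf : LocallyIntegrableOn f U) : hNorm 0 U f ^ 2 = eLpNorm f 2 (volume.restrict U) ^ 2 := by
  rw [hNorm_sq]; simp [hSemi_zero_sq hU hf]

theorem hNorm_one_sq [CompleteSpace F] {U : Set E} (hU : IsOpen U) {f : E → F} {g : Fin 3 → E → F}
    (h : ∀ i, IsWeakDeriv U (Pi.single i 1) f (g i)) :
    hNorm 1 U f ^ 2 = eLpNorm f 2 (volume.restrict U) ^ 2 +
      ∑ i, eLpNorm (g i) 2 (volume.restrict U) ^ 2 := by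
  rw [hNorm_sq, Finset.sum_range_succ, Finset.sum_range_one, hSemi_zero_sq hU (h 0).1, hSemi_sq,
    sum_multiIdx_one]
  congr 1
  exact Finset.sum_congr rfl fun i _ => by rw [derivNorm_eq hU (h i)]

/-- A finite `H¹` norm yields the weak derivatives: the infimum in `derivNorm` is `∞` if there is no
weak derivative. -/
theorem exists_memH1_of_hNorm_lt_top [CompleteSpace F] {U : Set E} (hU : IsOpen U) {f : E → F}
    (h : hNorm 1 U f < ⊤) : ∃ g, MemH1 U f g := by
  have h2 : hNorm 1 U f ^ 2 < ⊤ := ENNReal.pow_lt_top h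
  rw [hNorm_sq, Finset.sum_range_succ, Finset.sum_range_one, ENNReal.add_lt_top] at h2
  have h1 := h2.2
  rw [hSemi_sq, sum_multiIdx_one, ENNReal.sum_lt_top] at h1
  have hd : ∀ i : Fin 3, ∃ g, IsWeakDeriv U (Pi.single i 1) f g ∧
      eLpNorm g 2 (volume.restrict U) < ⊤ := fun i =>
    exists_of_derivNorm_lt_top (lt_top_iff_ne_top.2 fun h0 => by
      have := h1 i (Finset.mem_univ i); simp [h0] at this)
  choose g hg hg' using hd
  have h0 := h2.1
  rw [hSemi_zero_sq hU (hg 0).1] at h0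
  exact ⟨g, ⟨(hg 0).1.aestronglyMeasurable,
      lt_top_iff_ne_top.2 fun h0' => by simp [h0'] at h0⟩,
    fun i => ⟨(hg i).2.1.aestronglyMeasurable, hg' i⟩, hg⟩

end WeakDeriv

/-! ### Density of smooth functions in `H¹` of a convex domain -/

theorem eLpNorm_two_sq {α G : Type*} [MeasurableSpace α] [NormedAddCommGroup G] (f : α → G)
    (μ : Measure α) : eLpNorm f 2 μ ^ 2 = ∫⁻ x, ‖f x‖ₑ ^ 2 ∂μ := by
  have := eLpNorm_nnreal_pow_eq_lintegral (f := f) (μ := μ) (p := 2) (by norm_num)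
  simpa using this

theorem eLpNorm_two_le_of_sq {α G : Type*} [MeasurableSpace α] [NormedAddCommGroup G] {f : α → G}
    {μ : Measure α} {c : ℝ≥0∞} (h : ∫⁻ x, ‖f x‖ₑ ^ 2 ∂μ ≤ c ^ 2) : eLpNorm f 2 μ ≤ c := by
  rw [← eLpNorm_two_sq] at h
  exact (ENNReal.pow_le_pow_left_iff two_ne_zero).1 h

/-- The Cauchy–Schwarz inequality against a constant function. -/
theorem sq_lintegral_le {α : Type*} [MeasurableSpace α] (ν : Measure α) {g : α → ℝ≥0∞}
    (hg : AEMeasurable g ν) : (∫⁻ x, g x ∂ν) ^ 2 ≤ ν Set.univ * ∫⁻ x, g x ^ 2 ∂ν := by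
  have h := ENNReal.lintegral_mul_le_Lp_mul_Lq ν Real.HolderConjugate.two_two hg
    (aemeasurable_const (b := (1 : ℝ≥0∞)))
  simp only [Pi.mul_apply, mul_one, ENNReal.one_rpow, lintegral_const, one_mul] at h
  calc (∫⁻ x, g x ∂ν) ^ 2 ≤ _ := pow_le_pow_left' h 2
    _ = ν Set.univ * ∫⁻ x, g x ^ 2 ∂ν := by
      rw [mul_pow, ← ENNReal.rpow_natCast, ← ENNReal.rpow_mul, ← ENNReal.rpow_natCast,
        ← ENNReal.rpow_mul, mul_comm]
      norm_num

/-- The weighted form of the Cauchy–Schwarz inequality. -/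
theorem sq_lintegral_mul_le {α : Type*} [MeasurableSpace α] (ν : Measure α) {r g : α → ℝ≥0∞}
    (hr : Measurable r) (hg : Measurable g) :
    (∫⁻ x, r x * g x ∂ν) ^ 2 ≤ (∫⁻ x, r x ∂ν) * ∫⁻ x, r x * g x ^ 2 ∂ν := by
  have h := sq_lintegral_le (ν.withDensity r) hg.aemeasurable
  rw [lintegral_withDensity_eq_lintegral_mul _ hr hg,
    lintegral_withDensity_eq_lintegral_mul _ hr (hg.pow_const 2),
    withDensity_apply _ MeasurableSet.univ, Measure.restrict_univ] at h
  exact h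

section Approx

variable {F : Type*} [NormedAddCommGroup F] [NormedSpace ℝ F]

theorem lintegral_comp_smul_add (G : E → ℝ≥0∞) {l : ℝ} (hl : 0 < l) (d : E) :
    ∫⁻ x, G (l • x + d) = ENNReal.ofReal (l ^ 3)⁻¹ * ∫⁻ x, G x := by
  have h1 : ∫⁻ x, G (l • x + d) = ∫⁻ x, (fun y => G (y + d)) x ∂(Measure.map (l • ·) volume) := by
    have he : MeasurableEmbedding (fun x : E => l • x) :=
      (Homeomorph.smulOfNeZero l hl.ne').measurableEmbedding
    rw [he.lintegral_map]
  rw [h1, Measure.map_addHaar_smul _ hl.ne', lintegral_smul_measure, lintegral_add_right_eq_self]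
  simp [abs_of_pos hl]

theorem eLpNorm_comp_smul_add_le {F : Type*} [NormedAddCommGroup F] (u : E → F) {l : ℝ}
    (hl : 1 / 2 ≤ l) (d : E) :
    eLpNorm (fun x => u (l • x + d)) 2 volume ≤ 3 * eLpNorm u 2 volume := by
  refine eLpNorm_two_le_of_sq ?_
  rw [lintegral_comp_smul_add (fun y => ‖u y‖ₑ ^ 2) (by linarith) d, mul_pow, eLpNorm_two_sq]
  gcongr
  -- the factor is at most `8 ≤ 3 ^ 2`, as `1 / 2 ≤ l`
  rw [show (3 : ℝ≥0∞) ^ 2 = ENNReal.ofReal 9 by norm_num [ENNReal.ofReal_ofNat]]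
  refine ENNReal.ofReal_le_ofReal ?_
  rw [inv_le_comm₀ (by positivity) (by norm_num)]
  calc (9 : ℝ)⁻¹ ≤ (1 / 2) ^ 3 := by norm_num
    _ ≤ l ^ 3 := by gcongr

/-- Small dilations and translations move a continuous function of compact support little in
`L²`. -/
theorem exists_eLpNorm_comp_sub_le_of_continuous {F : Type*} [NormedAddCommGroup F] {w : E → F}
    (hw : Continuous w) (hwc : HasCompactSupport w) (c : E) {η : ℝ≥0∞} (hη : η ≠ 0) :
    ∃ δ > 0, ∀ l : ℝ, 1 / 2 ≤ l → l ≤ 1 → 1 - l < δ → ∀ z : E, ‖z‖ < δ →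
      eLpNorm (fun x => w (l • x + ((1 - l) • c - z)) - w x) 2 volume ≤ η := by
  obtain ⟨R, hR0, hR⟩ : ∃ R : ℝ, 0 < R ∧ ∀ x, R ≤ ‖x - c‖ → w x = 0 := by
    obtain ⟨R, hR⟩ := hwc.isCompact.isBounded.subset_ball c
    refine ⟨max R 1, by positivity, fun x hx => ?_⟩
    refine image_eq_zero_of_notMem_tsupport fun hx' => ?_
    have := hR hx'
    rw [Metric.mem_ball, dist_eq_norm] at this
    exact absurd (lt_of_lt_of_le this (le_max_left _ _)) (not_lt.2 hx)
  -- outside of `B`, both `w` and its translated dilates vanish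
  set B := Metric.ball c (2 * R + 2)
  have hB : volume B ≠ ⊤ := Metric.isBounded_ball.measure_lt_top.ne
  obtain ⟨τ, hτ0, hτ⟩ : ∃ τ : ℝ, 0 < τ ∧ ENNReal.ofReal τ ^ 2 * volume B ≤ η ^ 2 := by
    have ht : Tendsto (fun t : ℝ => ENNReal.ofReal t ^ 2 * volume B) (𝓝[>] 0) (𝓝 0) := by
      have h1 : Tendsto (fun t : ℝ => ENNReal.ofReal t ^ 2) (𝓝[>] 0) (𝓝 0) := by
        have : Continuous fun t : ℝ => ENNReal.ofReal t ^ 2 :=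
          (ENNReal.continuous_pow 2).comp ENNReal.continuous_ofReal
        simpa using (this.tendsto 0).mono_left nhdsWithin_le_nhds
      simpa using ENNReal.Tendsto.mul_const h1 (Or.inr hB)
    have hη2 : (0 : ℝ≥0∞) < η ^ 2 := pos_iff_ne_zero.2 (pow_ne_zero 2 hη)
    obtain ⟨t, ht1, ht2⟩ := ((ht.eventually_le_const hη2).and self_mem_nhdsWithin).exists
    exact ⟨t, ht2, ht1⟩
  obtain ⟨δ, hδ0, hδ⟩ := Metric.uniformContinuous_iff.1
    (hwc.uniformContinuous_of_continuous hw) τ hτ0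
  refine ⟨min 1 (δ / (2 * R + 3)), by positivity, fun l hl hl1 hlδ z hz => ?_⟩
  have hl' := lt_of_lt_of_le hlδ (min_le_right _ _)
  have hz' := lt_of_lt_of_le hz (min_le_right _ _)
  have hz1 := lt_of_lt_of_le hz (min_le_left _ _)
  have hδR : δ / (2 * R + 3) * (2 * R + 3) = δ := div_mul_cancel₀ _ (by positivity)
  refine eLpNorm_two_le_of_sq ((?_ : _ ≤ ENNReal.ofReal τ ^ 2 * volume B).trans hτ)
  calc ∫⁻ x, ‖w (l • x + ((1 - l) • c - z)) - w x‖ₑ ^ 2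
      ≤ ∫⁻ x, B.indicator (fun _ => ENNReal.ofReal τ ^ 2) x := by
        refine lintegral_mono fun x => ?_
        by_cases hx : x ∈ B
        · rw [Set.indicator_of_mem hx]
          rw [Metric.mem_ball, dist_eq_norm] at hx
          have : dist (w (l • x + ((1 - l) • c - z))) (w x) < τ := by
            apply hδ
            rw [dist_eq_norm, show l • x + ((1 - l) • c - z) - x = -((1 - l) • (x - c)) - z by
              module]
            calc ‖-((1 - l) • (x - c)) - z‖ ≤ ‖-((1 - l) • (x - c))‖ + ‖z‖ := norm_sub_le _ _
              _ = (1 - l) * ‖x - c‖ + ‖z‖ := by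
                rw [norm_neg, norm_smul, Real.norm_of_nonneg (by linarith)]
              _ ≤ (1 - l) * (2 * R + 2) + ‖z‖ := by
                have : 0 ≤ 1 - l := by linarith
                gcongr
              _ < δ := by nlinarith
          rw [dist_eq_norm] at this
          rw [← ofReal_norm]
          gcongr
        · rw [Set.indicator_of_notMem hx]
          rw [Metric.mem_ball, dist_eq_norm, not_lt] at hx
          have h1 : w x = 0 := hR x (by linarith)
          have h2 : w (l • x + ((1 - l) • c - z)) = 0 := by
            apply hR
            rw [show l • x + ((1 - l) • c - z) - c = l • (x - c) - z by module]
            have h3 := norm_sub_norm_le (l • (x - c)) z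
            rw [norm_smul, Real.norm_of_nonneg (by linarith)] at h3
            nlinarith
          simp [h1, h2]
    _ = ENNReal.ofReal τ ^ 2 * volume B := by
        rw [lintegral_indicator measurableSet_ball, setLIntegral_const]

/-- Continuity in `L²` of dilations and translations. -/
theorem exists_eLpNorm_comp_sub_le {u : E → F} (hu : MemLp u 2 volume) (c : E) {η : ℝ≥0∞}
    (hη : η ≠ 0) :
    ∃ δ > 0, ∀ l : ℝ, 1 / 2 ≤ l → l ≤ 1 → 1 - l < δ → ∀ z : E, ‖z‖ < δ →
      eLpNorm (fun x => u (l • x + ((1 - l) • c - z)) - u x) 2 volume ≤ η := by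
  have h5 : η / 5 ≠ 0 := by simp [hη]
  obtain ⟨w, hwc, hw1, hw, hw2⟩ := hu.exists_hasCompactSupport_eLpNorm_sub_le (by norm_num) h5
  obtain ⟨δ, hδ0, hδ⟩ := exists_eLpNorm_comp_sub_le_of_continuous hw hwc c h5
  refine ⟨δ, hδ0, fun l hl hl1 hlδ z hz => ?_⟩
  set d := (1 - l) • c - z
  have hmeas : ∀ {v : E → F}, MemLp v 2 volume →
      AEStronglyMeasurable (fun x => v (l • x + d)) volume := by
    intro v hv
    have hq : Measure.QuasiMeasurePreserving (fun x : E => l • x + d) volume volume :=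
      ⟨by fun_prop, by
        have h0 : Measure.map (fun x : E => l • x + d) volume =
            Measure.map (· + d) (Measure.map (l • ·) volume) := by
          rw [Measure.map_map (by fun_prop) (by fun_prop)]; rfl
        rw [h0, Measure.map_addHaar_smul _ (by linarith : l ≠ 0), Measure.map_smul,
          map_add_right_eq_self]
        exact Measure.smul_absolutelyContinuous⟩
    exact hv.1.comp_quasiMeasurePreserving hq
  calc eLpNorm (fun x => u (l • x + d) - u x) 2 volume
      = eLpNorm (((fun x => (u - w) (l • x + d)) + fun x => w (l • x + d) - w x) +
          (w - u)) 2 volume := by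
        congr 1; ext x; simp
    _ ≤ eLpNorm (fun x => (u - w) (l • x + d)) 2 volume +
          eLpNorm (fun x => w (l • x + d) - w x) 2 volume + eLpNorm (w - u) 2 volume := by
        refine (eLpNorm_add_le ?_ ?_ (by norm_num)).trans (add_le_add_left
          (eLpNorm_add_le ?_ ?_ (by norm_num)) _)
        · exact (hmeas (hu.sub hw2)).add ((hmeas hw2).sub hw2.1)
        · exact hw2.1.sub hu.1
        · exact hmeas (hu.sub hw2)
        · exact (hmeas hw2).sub hw2.1
    _ ≤ 3 * (η / 5) + η / 5 + η / 5 := by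
        gcongr
        · exact (eLpNorm_comp_smul_add_le (u - w) hl d).trans (by gcongr)
        · exact hδ l hl hl1 hlδ z hz
        · rw [eLpNorm_sub_comm]; exact hw1
    _ = η := by
        rw [← add_one_mul, ← add_one_mul, show (3 + 1 + 1 : ℝ≥0∞) = 5 by norm_num]
        exact ENNReal.mul_div_cancel (by norm_num) (by norm_num)

/-- The composition of a mollification with a dilation, as an average of translated dilates: it is
as close to `u` in `L²` as the translated dilates are. -/
theorem eLpNorm_average_sub_le [CompleteSpace F] {u : E → F} (hu : StronglyMeasurable u)
    (hul : LocallyIntegrable u) {ρ : E → ℝ} (hρ : Continuous ρ) (hρc : HasCompactSupport ρ)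
    (hρ0 : ∀ z, 0 ≤ ρ z) (hρ1 : ∫ z, ρ z = 1) {l : ℝ} {d : E} {η : ℝ≥0∞}
    (h : ∀ z, ρ z ≠ 0 → eLpNorm (fun x => u (l • x + (d - z)) - u x) 2 volume ≤ η) :
    eLpNorm (fun x => (∫ z, ρ z • u (l • x + (d - z))) - u x) 2 volume ≤ η := by
  have hρi : Integrable ρ := hρ.integrable_of_hasCompactSupport hρc
  have hρl : ∫⁻ z, ‖ρ z‖ₑ = 1 := by
    have h1 : ∀ z, ‖ρ z‖ₑ = ENNReal.ofReal (ρ z) := fun z => Real.enorm_of_nonneg (hρ0 z)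
    simp_rw [h1]
    rw [← ofReal_integral_eq_lintegral_ofReal hρi (Eventually.of_forall hρ0), hρ1,
      ENNReal.ofReal_one]
  have hint : ∀ x, Integrable fun z => ρ z • u (l • x + (d - z)) := by
    intro x
    have h1 : Integrable fun t => ρ (l • x + d - t) • u t :=
      hul.integrable_smul_left_of_hasCompactSupport (by fun_prop)
        (hρc.comp_homeomorph (Homeomorph.subLeft (l • x + d)))
    have h2 := h1.comp_sub_left (l • x + d)
    simp only [sub_sub_cancel] at h2
    simpa only [add_sub_assoc] using h2
  have hmeas : Measurable fun p : E × E => ‖u (l • p.1 + (d - p.2)) - u p.1‖ₑ :=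
    ((hu.comp_measurable (by fun_prop : Measurable fun p : E × E => l • p.1 + (d - p.2))).sub
      (hu.comp_measurable measurable_fst)).enorm
  have hρm : Measurable fun z => ‖ρ z‖ₑ := hρ.measurable.enorm
  refine eLpNorm_two_le_of_sq ?_
  calc ∫⁻ x, ‖(∫ z, ρ z • u (l • x + (d - z))) - u x‖ₑ ^ 2
      ≤ ∫⁻ x, ∫⁻ z, ‖ρ z‖ₑ * ‖u (l • x + (d - z)) - u x‖ₑ ^ 2 := by
        refine lintegral_mono fun x => ?_
        have h1 : (∫ z, ρ z • u (l • x + (d - z))) - u x =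
            ∫ z, ρ z • (u (l • x + (d - z)) - u x) := by
          simp only [smul_sub]
          rw [integral_sub (hint x) (hρi.smul_const _), integral_smul_const, hρ1, one_smul]
        have h2 : ‖(∫ z, ρ z • u (l • x + (d - z))) - u x‖ₑ ≤
            ∫⁻ z, ‖ρ z‖ₑ * ‖u (l • x + (d - z)) - u x‖ₑ := by
          rw [h1]
          refine (enorm_integral_le_lintegral_enorm _).trans (le_of_eq ?_)
          simp only [enorm_smul]
        refine (pow_le_pow_left' h2 2).trans ?_
        have := sq_lintegral_mul_le volume hρm (hmeas.comp (measurable_prodMk_left (x := x)))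
        rwa [hρl, one_mul] at this
    _ = ∫⁻ z, ∫⁻ x, ‖ρ z‖ₑ * ‖u (l • x + (d - z)) - u x‖ₑ ^ 2 :=
        lintegral_lintegral_swap
          (Measurable.aemeasurable (f := fun p : E × E =>
            ‖ρ p.2‖ₑ * ‖u (l • p.1 + (d - p.2)) - u p.1‖ₑ ^ 2)
            ((hρm.comp measurable_snd).mul (hmeas.pow_const 2)))
    _ ≤ ∫⁻ z, ‖ρ z‖ₑ * η ^ 2 := by
        refine lintegral_mono fun z => ?_
        rw [lintegral_const_mul' _ _ enorm_ne_top, ← eLpNorm_two_sq]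
        by_cases hz : ρ z = 0
        · simp [hz]
        · gcongr
          exact h z hz
    _ = η ^ 2 := by rw [lintegral_mul_const _ hρm, hρl, one_mul]

/-- The partial derivatives of a mollification are mollifications of the weak derivatives, at the
points that are far enough from the complement of the domain. -/
theorem pd_mollify [CompleteSpace F] {U : Set E} {u g : E → F} (hul : LocallyIntegrable u)
    {i : Fin 3} (hg : IsWeakDeriv U (Pi.single i 1) u g) {ρ : E → ℝ} (hρ : ContDiff ℝ ∞ ρ)
    (hρc : HasCompactSupport ρ) {l : ℝ} {d x : E}
    (hx : ∀ z ∈ tsupport ρ, l • x + d - z ∈ U) :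
    pd i (fun x => ∫ z, ρ z • u (l • x + (d - z))) x = l • ∫ z, ρ z • g (l • x + (d - z)) := by
  set L : F →L[ℝ] ℝ →L[ℝ] F := (ContinuousLinearMap.lsmul ℝ ℝ).flip with hL
  -- the substitution that turns averages of translates into convolutions
  have hconv : ∀ (r : E → ℝ) (v : E → F) (y : E),
      ∫ z, r z • v (y - z) = ∫ t, r (y - t) • v t := by
    intro r v y
    have := integral_sub_left_eq_self (fun t => r (y - t) • v t) volume y
    simpa only [sub_sub_cancel] using this
  set y := l • x + d with hy
  have hder := hρc.hasFDerivAt_convolution_right L hul (hρ.of_le (by simp)) y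
  have haff : HasFDerivAt (fun x : E => l • x + d) (l • ContinuousLinearMap.id ℝ E) x :=
    ((hasFDerivAt_id x).const_smul l).add_const d
  have hcomp := hder.comp x haff
  have hfun : (fun x => ∫ z, ρ z • u (l • x + (d - z))) =
      (MeasureTheory.convolution u ρ L volume) ∘ fun x => l • x + d := by
    ext x
    simp only [← add_sub_assoc]
    rw [hconv]
    rfl
  -- reflection turns the mollifier into a test function on the domain
  set φ : E → ℝ := fun t => ρ (y - t) with hφ
  have hφt : IsTest U φ := by
    refine ⟨hρ.comp (contDiff_const.sub contDiff_id),
      hρc.comp_homeomorph (Homeomorph.subLeft y), fun t ht => ?_⟩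
    have h1 : y - t ∈ tsupport ρ := by
      have := (Set.ext_iff.1 (tsupport_comp_eq_preimage ρ (Homeomorph.subLeft y)) t).1 ht
      exact this
    simpa using hx _ h1
  have hpd : ∀ t, pd i φ t = -pd i ρ (y - t) := by
    intro t
    have h1 : HasFDerivAt (fun t : E => y - t) (-ContinuousLinearMap.id ℝ E) t :=
      (hasFDerivAt_id t).const_sub y
    have h2 := (hρ.differentiable (by simp) (y - t)).hasFDerivAt.comp t h1
    have h3 : fderiv ℝ φ t = _ := h2.fderiv
    simp [pd, h3]
  have hweak := (isWeakDeriv_single_iff.1 hg).2.2 φ hφt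
  simp only [hpd, neg_smul, integral_neg, neg_inj] at hweak
  rw [pd, hfun, hcomp.fderiv]
  simp only [← add_sub_assoc]
  rw [← hy, hconv, ← hweak]
  simp only [ContinuousLinearMap.comp_smul, ContinuousLinearMap.comp_id,
    smul_apply]
  congr 1
  rw [convolution_precompR_apply]
  · rfl
  · exact hul
  · exact hρc.fderiv ℝ
  · exact hρ.continuous_fderiv (by simp)

theorem contDiff_mollify [CompleteSpace F] {u : E → F} (hul : LocallyIntegrable u) {ρ : E → ℝ}
    (hρ : ContDiff ℝ ∞ ρ) (hρc : HasCompactSupport ρ) (l : ℝ) (d : E) :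
    ContDiff ℝ ∞ (fun x => ∫ z, ρ z • u (l • x + (d - z))) := by
  have h1 : ContDiff ℝ ∞ (MeasureTheory.convolution ρ u (ContinuousLinearMap.lsmul ℝ ℝ) volume) :=
    hρc.contDiff_convolution_left (n := (⊤ : ℕ∞)) _ hρ hul
  have h2 : ContDiff ℝ ∞ fun x : E => l • x + d := by fun_prop
  convert h1.comp h2 using 2 with x
  simp only [Function.comp, MeasureTheory.convolution, ContinuousLinearMap.lsmul_apply,
    add_sub_assoc]

theorem exists_mollifier {ε : ℝ} (hε : 0 < ε) :
    ∃ ρ : E → ℝ, ContDiff ℝ ∞ ρ ∧ HasCompactSupport ρ ∧ (∀ z, 0 ≤ ρ z) ∧ ∫ z, ρ z = 1 ∧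
      tsupport ρ ⊆ Metric.closedBall 0 ε := by
  let b : ContDiffBump (0 : E) := ⟨ε / 2, ε, by positivity, by linarith⟩
  refine ⟨b.normed volume, b.contDiff_normed, b.hasCompactSupport_normed,
    b.nonneg_normed, b.integral_normed, ?_⟩
  rw [b.tsupport_normed_eq]

/-- Smooth functions on the whole space are dense in `H¹` of a convex domain: contract the domain
towards an interior point, then mollify. -/
theorem MemH1.exists_smooth_approx_le [CompleteSpace F] {U : Set E} (hU : IsOpen U)
    (hUc : Convex ℝ U) (hUn : U.Nonempty) {f : E → F} {g : Fin 3 → E → F} (h : MemH1 U f g)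
    {η : ℝ≥0∞} (hη : η ≠ 0) :
    ∃ φ : E → F, ContDiff ℝ ∞ φ ∧ eLpNorm (fun x => φ x - f x) 2 (volume.restrict U) ≤ η ∧
      ∀ i, eLpNorm (fun x => pd i φ x - g i x) 2 (volume.restrict U) ≤ η := by
  -- strongly measurable extensions by zero
  have hext : ∀ {v : E → F}, MemLp v 2 (volume.restrict U) → ∃ u : E → F, StronglyMeasurable u ∧
      MemLp u 2 volume ∧ v =ᵐ[volume.restrict U] u := by
    intro v hv
    have h1 : MemLp (U.indicator v) 2 volume := (memLp_indicator_iff_restrict hU.measurableSet).2 hv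
    refine ⟨h1.1.mk _, h1.1.stronglyMeasurable_mk, h1.ae_eq h1.1.ae_eq_mk, ?_⟩
    have h2 := ae_restrict_of_ae (s := U) h1.1.ae_eq_mk
    filter_upwards [h2, ae_restrict_mem hU.measurableSet] with x hx hxU
    rw [← hx, Set.indicator_of_mem hxU]
  obtain ⟨u, hum, hu2, hfu⟩ := hext h.memLp
  choose G hGm hG2 hgG using fun i => hext (h.memLp_deriv i)
  have hweak : ∀ i, IsWeakDeriv U (Pi.single i 1) u (G i) := fun i =>
    (h.deriv i).congr hfu (hgG i) hU
  have hul : LocallyIntegrable u := hu2.locallyIntegrable (by norm_num)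
  have hGl : ∀ i, LocallyIntegrable (G i) := fun i => (hG2 i).locallyIntegrable (by norm_num)
  obtain ⟨c, hc⟩ := hUn
  obtain ⟨R, hR0, hR⟩ := Metric.isOpen_iff.1 hU c hc
  have hη2 : η / 2 ≠ 0 := by simp [hη]
  obtain ⟨δ, hδ0, hδ⟩ := exists_eLpNorm_comp_sub_le hu2 c hη
  choose δ' hδ'0 hδ' using fun i => exists_eLpNorm_comp_sub_le (hG2 i) c hη2
  -- the contraction factor is `1 - s`
  obtain ⟨s, hs0, hs2, hsδ, hsδ', hsG⟩ : ∃ s : ℝ, 0 < s ∧ s ≤ 1 / 2 ∧ s < δ ∧ (∀ i, s < δ' i) ∧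
      ∀ i, ENNReal.ofReal s * eLpNorm (G i) 2 volume ≤ η / 2 := by
    have hlt : ∀ {a : ℝ}, 0 < a → ∀ᶠ s : ℝ in 𝓝[>] 0, s < a := fun ha =>
      (eventually_lt_nhds ha).filter_mono nhdsWithin_le_nhds
    have hG : ∀ i, ∀ᶠ s : ℝ in 𝓝[>] 0, ENNReal.ofReal s * eLpNorm (G i) 2 volume ≤ η / 2 := by
      intro i
      have h1 : Tendsto (fun s : ℝ => ENNReal.ofReal s * eLpNorm (G i) 2 volume) (𝓝[>] 0)
          (𝓝 (0 * eLpNorm (G i) 2 volume)) := by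
        refine ENNReal.Tendsto.mul_const ?_ (Or.inr (hG2 i).2.ne)
        have := (ENNReal.continuous_ofReal.tendsto 0).mono_left
          (nhdsWithin_le_nhds (s := Set.Ioi (0 : ℝ)))
        simpa using this
      rw [zero_mul] at h1
      exact h1.eventually_le_const (pos_iff_ne_zero.2 hη2)
    obtain ⟨s, h1, h2, h3, h4, h5⟩ :=
      ((eventually_mem_nhdsWithin (a := (0 : ℝ)) (s := Set.Ioi 0)).and
      ((hlt (a := 1 / 2) (by norm_num)).and ((hlt hδ0).and ((eventually_all.2 fun i =>
        hlt (hδ'0 i)).and (eventually_all.2 hG))))).exists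
    exact ⟨s, h1, h2.le, h3, h4, h5⟩
  -- the radius of the mollifier: below `s * R`, so that the contracted domain stays away from the
  -- complement, and within the range where dilations and translations are close to the identity
  set ε := min (s * R / 2) (min (δ / 2) (Finset.univ.inf' Finset.univ_nonempty δ' / 2)) with hε
  have hinf : 0 < Finset.univ.inf' Finset.univ_nonempty δ' := by
    rw [Finset.lt_inf'_iff]; exact fun i _ => hδ'0 i
  have hε0 : 0 < ε := by positivity
  have hεR : ε < s * R := lt_of_le_of_lt (min_le_left _ _) (by nlinarith [mul_pos hs0 hR0])
  have hεδ : ε < δ :=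
    lt_of_le_of_lt ((min_le_right _ _).trans (min_le_left _ _)) (by linarith)
  have hεδ' : ∀ i, ε < δ' i := fun i =>
    lt_of_le_of_lt ((min_le_right _ _).trans (min_le_right _ _))
      (lt_of_lt_of_le (by linarith) (Finset.inf'_le δ' (Finset.mem_univ i)))
  obtain ⟨ρ, hρ, hρc, hρ0, hρ1, hρs⟩ := exists_mollifier hε0
  have hρz : ∀ z, ρ z ≠ 0 → ‖z‖ ≤ ε := fun z hz => by
    simpa using hρs (subset_tsupport ρ hz)
  have hs1 : 1 - (1 - s) = s := by ring
  have hGi : ∀ i, eLpNorm (fun x => (∫ z, ρ z • G i ((1 - s) • x + ((1 - (1 - s)) • c - z))) -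
      G i x) 2 volume ≤ η / 2 := fun i =>
    eLpNorm_average_sub_le (hGm i) (hGl i) hρ.continuous hρc hρ0 hρ1 fun z hz =>
      hδ' i _ (by linarith) (by linarith) (by linarith [hsδ' i]) z ((hρz z hz).trans_lt (hεδ' i))
  refine ⟨fun x => ∫ z, ρ z • u ((1 - s) • x + ((1 - (1 - s)) • c - z)),
    contDiff_mollify hul hρ hρc _ _, ?_, fun i => ?_⟩
  · rw [eLpNorm_congr_ae (g := fun x => (∫ z, ρ z • u ((1 - s) • x + ((1 - (1 - s)) • c - z))) -
      u x) (by filter_upwards [hfu] with x hx; rw [hx])]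
    refine (eLpNorm_mono_measure _ Measure.restrict_le_self).trans ?_
    exact eLpNorm_average_sub_le hum hul hρ.continuous hρc hρ0 hρ1 fun z hz =>
      hδ _ (by linarith) (by linarith) (by linarith) z ((hρz z hz).trans_lt hεδ)
  · set A : E → F := fun x => ∫ z, ρ z • G i ((1 - s) • x + ((1 - (1 - s)) • c - z)) with hA
    have hAc : Continuous A := (contDiff_mollify (hGl i) hρ hρc _ _).continuous
    have hpd : ∀ x ∈ U, pd i (fun x => ∫ z, ρ z • u ((1 - s) • x + ((1 - (1 - s)) • c - z))) x =
        (1 - s) • A x := by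
      intro x hx
      refine pd_mollify hul (hweak i) hρ hρc fun z hz => ?_
      have hz' : ‖z‖ ≤ ε := by simpa using hρs hz
      have hw : c - s⁻¹ • z ∈ U := by
        apply hR
        rw [Metric.mem_ball, dist_eq_norm, show c - s⁻¹ • z - c = -(s⁻¹ • z) by abel, norm_neg,
          norm_smul, Real.norm_of_nonneg (by positivity), inv_mul_lt_iff₀ hs0]
        exact hz'.trans_lt hεR
      -- the point `(1 - s) x + s c - z` is a convex combination of `x` and `c - z / s`
      have := hUc hx hw (by linarith : 0 ≤ 1 - s) hs0.le (by ring)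
      convert this using 1
      rw [smul_sub, smul_smul, mul_inv_cancel₀ hs0.ne', hs1, one_smul]
      abel
    have hcongr : (fun x => pd i (fun x => ∫ z, ρ z • u ((1 - s) • x +
        ((1 - (1 - s)) • c - z))) x - g i x) =ᵐ[volume.restrict U]
        (fun x => ((1 - s) • fun x => A x - G i x) x + (-s • G i) x) := by
      filter_upwards [hgG i, ae_restrict_mem hU.measurableSet] with x hx hxU
      rw [hpd x hxU, hx]
      simp only [Pi.smul_apply]
      module
    rw [eLpNorm_congr_ae hcongr]
    refine (eLpNorm_mono_measure _ Measure.restrict_le_self).trans ?_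
    have hAm : AEStronglyMeasurable (fun x => A x - G i x) volume :=
      hAc.aestronglyMeasurable.sub (hG2 i).1
    refine (eLpNorm_add_le (hAm.const_smul _) ((hG2 i).1.const_smul _) (by norm_num)).trans ?_
    rw [eLpNorm_const_smul, eLpNorm_const_smul]
    calc _ ≤ 1 * (η / 2) + η / 2 := by
          refine add_le_add (mul_le_mul' ?_ (hGi i)) ?_
          · rw [Real.enorm_of_nonneg (by linarith)]
            exact ENNReal.ofReal_le_one.2 (by linarith)
          · rw [enorm_neg, Real.enorm_of_nonneg hs0.le]
            exact hsG i
      _ = η := by rw [one_mul, ENNReal.add_halves]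

theorem MemH1.exists_smooth_approx [CompleteSpace F] {U : Set E} (hU : IsOpen U)
    (hUc : Convex ℝ U) (hUn : U.Nonempty) {f : E → F} {g : Fin 3 → E → F} (h : MemH1 U f g) :
    ∃ φ : ℕ → E → F, (∀ n, ContDiff ℝ ∞ (φ n)) ∧
      Tendsto (fun n => eLpNorm (fun x => φ n x - f x) 2 (volume.restrict U)) atTop (𝓝 0) ∧
      ∀ i, Tendsto (fun n => eLpNorm (fun x => pd i (φ n) x - g i x) 2 (volume.restrict U))
        atTop (𝓝 0) := by
  have hη : ∀ n : ℕ, ((n : ℝ≥0∞))⁻¹ ≠ 0 := fun n => by simp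
  choose φ h1 h2 h3 using fun n => h.exists_smooth_approx_le hU hUc hUn (hη n)
  exact ⟨φ, h1, tendsto_of_tendsto_of_tendsto_of_le_of_le tendsto_const_nhds
    ENNReal.tendsto_inv_nat_nhds_zero (fun _ => zero_le) h2, fun i =>
    tendsto_of_tendsto_of_tendsto_of_le_of_le tendsto_const_nhds
      ENNReal.tendsto_inv_nat_nhds_zero (fun _ => zero_le) fun n => h3 n i⟩

end Approx

/-! ### Affine coordinates on a tetrahedron -/

/-- `T` is the tetrahedron with vertices `a`, `b`, `c`, `p`; the edges at `a` are independent. -/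
structure IsTet (T : Finset E) (a b c p : E) : Prop where
  eq : (T : Set E) = {a, b, c, p}
  indep : ∀ x y z : ℝ, x • (b - a) + y • (c - a) + z • (p - a) = 0 → x = 0 ∧ y = 0 ∧ z = 0

theorem isTet_of_affineIndependent {T : Finset E} (hc : T.card = 4)
    (hi : AffineIndependent ℝ ((↑) : T → E)) {a b c p : E} (h : (T : Set E) = {a, b, c, p}) :
    IsTet T a b c p := by
  classical
  refine ⟨h, fun x y z hxyz => ?_⟩
  have hT : T = {a, b, c, p} := by rw [← Finset.coe_inj, h]; simp
  have hinj : Function.Injective ![a, b, c, p] := by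
    have himg : Finset.univ.image ![a, b, c, p] = T := by
      rw [hT]; ext x; simp [Fin.exists_fin_succ, eq_comm]
    have hcard : (Finset.univ.image ![a, b, c, p]).card = (Finset.univ : Finset (Fin 4)).card := by
      rw [himg, hc]; rfl
    have := Finset.card_image_iff.1 hcard
    rwa [Finset.coe_univ, Set.injOn_univ] at this
  have hmem : ∀ i, ![a, b, c, p] i ∈ T := by
    intro i; rw [hT]; fin_cases i <;> simp
  have h4 : AffineIndependent ℝ ![a, b, c, p] := by
    have := hi.comp_embedding ⟨fun i => (⟨![a, b, c, p] i, hmem i⟩ : T), fun i j hij =>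
      hinj (congrArg Subtype.val hij)⟩
    exact this
  rw [affineIndependent_iff] at h4
  have := h4 Finset.univ ![-(x + y + z), x, y, z] (by simp [Fin.sum_univ_four]; ring) (by
    simp only [Fin.sum_univ_four, Matrix.cons_val]
    rw [← hxyz]; module)
  exact ⟨by simpa using this 1, by simpa using this 2, by simpa using this 3⟩

theorem exists_isTet {T F : Finset E} (hc : T.card = 4) (hi : AffineIndependent ℝ ((↑) : T → E))
    (hF : F ∈ facetsOf T) :
    ∃ a b c p, (F : Set E) = {a, b, c} ∧ p ∉ F ∧ IsTet T a b c p ∧ IsTet T b c a p ∧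
      IsTet T c a b p := by
  classical
  obtain ⟨hFT, hF3⟩ := Finset.mem_powersetCard.1 hF
  obtain ⟨a, b, c, -, -, -, rfl⟩ := Finset.card_eq_three.1 hF3
  have h1 : (T \ {a, b, c}).card = 1 := by
    rw [Finset.card_sdiff_of_subset hFT, hc, hF3]
  obtain ⟨p, hp⟩ := Finset.card_eq_one.1 h1
  have hT : (T : Set E) = {a, b, c, p} := by
    rw [← Finset.union_sdiff_of_subset hFT, hp]
    ext x; simp
  have hpF : p ∉ ({a, b, c} : Finset E) := by
    have : p ∈ T \ {a, b, c} := by rw [hp]; simp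
    exact (Finset.mem_sdiff.1 this).2
  refine ⟨a, b, c, p, by simp, hpF, isTet_of_affineIndependent hc hi hT,
    isTet_of_affineIndependent hc hi (hT.trans ?_), isTet_of_affineIndependent hc hi (hT.trans ?_)⟩
  all_goals ext x; simp only [Set.mem_insert_iff, Set.mem_singleton_iff]; tauto

/-- The Euclidean plane, in which facets are parametrized. -/
abbrev Q : Type := EuclideanSpace ℝ (Fin 2)

/-- The linear map that sends the coordinate vectors to `u`, `v`, `w`. -/
def frame (u v w : E) : Q × ℝ →ₗ[ℝ] E where
  toFun q := q.1 0 • u + q.1 1 • v + q.2 • w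
  map_add' q q' := by simp only [Prod.fst_add, Prod.snd_add, PiLp.add_apply]; module
  map_smul' r q := by
    simp only [Prod.smul_fst, Prod.smul_snd, PiLp.smul_apply, smul_eq_mul, RingHom.id_apply]
    module

theorem frame_apply (u v w : E) (q : Q × ℝ) :
    frame u v w q = q.1 0 • u + q.1 1 • v + q.2 • w := rfl

theorem IsTet.exists_equiv {T : Finset E} {a b c p : E} (h : IsTet T a b c p) :
    ∃ Λ : (Q × ℝ) ≃L[ℝ] E, ∀ q, Λ q = frame (b - a) (c - a) (p - a) q := by
  have hinj : Function.Injective (frame (b - a) (c - a) (p - a)) := by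
    rw [injective_iff_map_eq_zero]
    rintro ⟨y, t⟩ hq
    obtain ⟨h0, h1, h2⟩ := h.indep _ _ _ hq
    simp only at h0 h1 h2
    ext i
    · fin_cases i
      · exact h0
      · exact h1
    · exact h2
  have hdim : Module.finrank ℝ (Q × ℝ) = Module.finrank ℝ E := by simp
  exact ⟨(LinearEquiv.ofInjectiveOfFinrankEq _ hinj hdim).toContinuousLinearEquiv, fun q => rfl⟩

/-- The unit tetrahedron. -/
def refTet : Set (Q × ℝ) := {q | 0 ≤ q.1 0 ∧ 0 ≤ q.1 1 ∧ 0 ≤ q.2 ∧ q.1 0 + q.1 1 + q.2 ≤ 1}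

theorem convex_refTet : Convex ℝ refTet := by
  rintro ⟨x, s⟩ ⟨h1, h2, h3, h4⟩ ⟨y, t⟩ ⟨h1', h2', h3', h4'⟩ α β hα hβ hαβ
  simp only at h1 h2 h3 h4 h1' h2' h3' h4'
  refine ⟨?_, ?_, ?_, ?_⟩ <;>
    simp only [Prod.smul_mk, Prod.mk_add_mk, PiLp.add_apply, PiLp.smul_apply, smul_eq_mul]
  · positivity
  · positivity
  · positivity
  · nlinarith

theorem add_frame_mem_simplex {T : Finset E} {a b c p : E} (h : (T : Set E) = {a, b, c, p})
    {q : Q × ℝ} (hq : q ∈ refTet) : a + frame (b - a) (c - a) (p - a) q ∈ simplex T := by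
  obtain ⟨h0, h1, h2, h3⟩ := hq
  have hm : ∀ x ∈ ({a, b, c, p} : Set E), x ∈ simplex T := fun x hx =>
    subset_convexHull ℝ _ (h ▸ hx)
  have := (convex_convexHull ℝ (T : Set E)).sum_mem (t := Finset.univ)
    (w := ![1 - (q.1 0 + q.1 1 + q.2), q.1 0, q.1 1, q.2]) (z := ![a, b, c, p])
    (by intro i _; fin_cases i <;> simp <;> linarith) (by simp [Fin.sum_univ_four]; ring)
    (by intro i _; fin_cases i <;> exact hm _ (by simp))
  simp only [Fin.sum_univ_four, Matrix.cons_val] at this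
  rw [simplex]
  convert this using 1
  rw [frame_apply]; module

theorem exists_of_mem_simplex {T : Finset E} {a b c p : E} (h : (T : Set E) = {a, b, c, p})
    {x : E} (hx : x ∈ simplex T) :
    ∃ q ∈ refTet, x = a + frame (b - a) (c - a) (p - a) q := by
  have hconv : Convex ℝ ((fun z => a + z) '' (frame (b - a) (c - a) (p - a) '' refTet)) :=
    (convex_refTet.linear_image _).translate a
  have hsub : (T : Set E) ⊆ (fun z => a + z) '' (frame (b - a) (c - a) (p - a) '' refTet) := by
    rw [h]
    rintro x (rfl | rfl | rfl | rfl)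
    · exact ⟨_, ⟨0, by simp [refTet], rfl⟩, by simp⟩
    · exact ⟨_, ⟨(!₂[1, 0], 0), by simp [refTet], rfl⟩, by simp [frame_apply]⟩
    · exact ⟨_, ⟨(!₂[0, 1], 0), by simp [refTet], rfl⟩, by simp [frame_apply]⟩
    · exact ⟨_, ⟨(0, 1), by simp [refTet], rfl⟩, by simp [frame_apply]⟩
  obtain ⟨_, ⟨q, hq, rfl⟩, rfl⟩ := convexHull_min hsub hconv hx
  exact ⟨q, hq, rfl⟩

/-- The part of the unit triangle on which the barycentric coordinate of the origin is at least
`1/3`. Its product with `[0, 1/3]` lies in the unit tetrahedron. -/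
def cornerTri : Set Q := {y | 0 ≤ y 0 ∧ 0 ≤ y 1 ∧ y 0 + y 1 ≤ 2 / 3}

theorem exists_of_mem_simplex_three {F : Finset E} {a b c : E} (h : (F : Set E) = {a, b, c})
    {x : E} (hx : x ∈ simplex F) :
    ∃ α β γ : ℝ, 0 ≤ α ∧ 0 ≤ β ∧ 0 ≤ γ ∧ α + β + γ = 1 ∧ x = α • a + β • b + γ • c := by
  obtain ⟨q, ⟨h0, h1, h2, h3⟩, rfl⟩ :=
    exists_of_mem_simplex (b := b) (c := c) (p := a) (h.trans (by ext x; simp; tauto)) hx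
  refine ⟨1 - q.1 0 - q.1 1, q.1 0, q.1 1, by linarith, h0, h1, by ring, ?_⟩
  rw [frame_apply]; module

/-- Each point of a triangle lies in the corner at one of the three vertices. -/
theorem simplex_subset_corners {F : Finset E} {a b c p : E} (h : (F : Set E) = {a, b, c}) :
    simplex F ⊆ (fun y : Q => a + frame (b - a) (c - a) (p - a) (y, 0)) '' cornerTri ∪
      (fun y : Q => b + frame (c - b) (a - b) (p - b) (y, 0)) '' cornerTri ∪
      (fun y : Q => c + frame (a - c) (b - c) (p - c) (y, 0)) '' cornerTri := by
  intro x hx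
  obtain ⟨α, β, γ, hα, hβ, hγ, hs, rfl⟩ := exists_of_mem_simplex_three h hx
  have hα' : α = 1 - β - γ := by linarith
  rcases le_or_gt (1 / 3) α with h1 | h1
  · refine Or.inl (Or.inl ⟨!₂[β, γ], ?_, ?_⟩)
    · simp [cornerTri]; exact ⟨hβ, hγ, by linarith⟩
    · simp [frame_apply, hα']; module
  rcases le_or_gt (1 / 3) β with h2 | h2
  · refine Or.inl (Or.inr ⟨!₂[γ, α], ?_, ?_⟩)
    · simp [cornerTri]; exact ⟨hγ, hα, by linarith⟩
    · simp [frame_apply, hα']; module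
  · refine Or.inr ⟨!₂[α, β], ?_, ?_⟩
    · simp [cornerTri]; exact ⟨hα, hβ, by linarith⟩
    · simp [frame_apply, hα']; module

/-! ### Integrals over facets and over tetrahedra -/

theorem isClosed_refTet : IsClosed refTet := by
  have h0 : Continuous fun q : Q × ℝ => q.1 0 := by fun_prop
  have h1 : Continuous fun q : Q × ℝ => q.1 1 := by fun_prop
  exact (isClosed_le continuous_const h0).inter ((isClosed_le continuous_const h1).inter
    ((isClosed_le continuous_const continuous_snd).inter
      (isClosed_le ((h0.add h1).add continuous_snd) continuous_const)))

theorem refTet_subset_closedBall : refTet ⊆ Metric.closedBall 0 2 := by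
  rintro ⟨y, t⟩ ⟨h0, h1, h2, h3⟩
  simp only at h0 h1 h2 h3
  rw [mem_closedBall_zero_iff, Prod.norm_mk, max_le_iff, EuclideanSpace.norm_eq]
  constructor
  · rw [Real.sqrt_le_left (by norm_num), Fin.sum_univ_two, Real.norm_of_nonneg h0,
      Real.norm_of_nonneg h1]
    nlinarith
  · rw [Real.norm_of_nonneg h2]; linarith

/-- The ratio between the volume of a ball in the coordinate space and that of a ball of unit
diameter. -/
noncomputable def volRatio : ℝ≥0∞ :=
  volume (Metric.closedBall (0 : Q × ℝ) 2) / volume (Metric.closedBall (0 : E) (1 / 2))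

theorem volRatio_ne_top : volRatio ≠ ⊤ := by
  have h1 : volume (Metric.closedBall (0 : Q × ℝ) 2) < ⊤ := measure_closedBall_lt_top
  have h2 : 0 < volume (Metric.closedBall (0 : E) (1 / 2)) :=
    Metric.measure_closedBall_pos _ _ (by norm_num)
  exact ENNReal.div_ne_top h1.ne h2.ne'

/-- Integrals in affine coordinates are bounded by integrals over the tetrahedron; the Jacobian is
controlled by the volume of an inscribed ball. -/
theorem IsTet.lintegral_refTet_le {T : Finset E} {a b c p : E} (h : IsTet T a b c p) {z : E}
    {ρ : ℝ} (hρ : 0 < ρ) (hb : Metric.closedBall z (ρ / 2) ⊆ simplex T) (H : E → ℝ≥0∞) :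
    ∫⁻ q in refTet, H (a + frame (b - a) (c - a) (p - a) q) ≤
      volRatio / ENNReal.ofReal (ρ ^ 3) * ∫⁻ x in simplex T, H x := by
  obtain ⟨Λ, hΛ⟩ := h.exists_equiv
  have hS : MeasurableSet (simplex T) :=
    (T.finite_toSet.isCompact_convexHull (𝕜 := ℝ)).isClosed.measurableSet
  -- the pull-back of Lebesgue measure is a multiple of Lebesgue measure
  obtain ⟨κ, hκ⟩ : ∃ κ : ℝ≥0∞, Measure.map Λ (volume : Measure (Q × ℝ)) = κ • volume := by
    have : (Measure.map Λ (volume : Measure (Q × ℝ))).IsAddHaarMeasure :=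
      have : (volume : Measure (Q × ℝ)).IsAddHaarMeasure := by
        rw [Measure.volume_eq_prod]; infer_instance
      Λ.isAddHaarMeasure_map volume
    exact ⟨_, Measure.isAddLeftInvariant_eq_smul _ _⟩
  have hint : ∀ G : E → ℝ≥0∞, ∫⁻ q, G (a + Λ q) = κ * ∫⁻ x, G x := by
    intro G
    have he : MeasurableEmbedding Λ := Λ.toHomeomorph.measurableEmbedding
    have h1 : ∫⁻ x, (fun y => G (a + y)) x ∂(Measure.map Λ volume) = ∫⁻ q, G (a + Λ q) :=
      he.lintegral_map _
    rw [← h1, hκ, lintegral_smul_measure, lintegral_add_left_eq_self, smul_eq_mul]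
  have hmem : ∀ q, a + Λ q ∈ simplex T ↔ q ∈ refTet := by
    intro q
    constructor
    · intro hq
      obtain ⟨q', hq', he⟩ := exists_of_mem_simplex h.eq hq
      rw [← hΛ, add_right_inj, Λ.injective.eq_iff] at he
      rwa [he]
    · intro hq
      rw [hΛ]; exact add_frame_mem_simplex h.eq hq
  have hset : ∀ G : E → ℝ≥0∞, ∫⁻ q in refTet, G (a + Λ q) = κ * ∫⁻ x in simplex T, G x := by
    intro G
    rw [← lintegral_indicator isClosed_refTet.measurableSet, ← lintegral_indicator hS, ← hint]
    refine lintegral_congr fun q => ?_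
    by_cases hq : q ∈ refTet
    · rw [Set.indicator_of_mem hq, Set.indicator_of_mem ((hmem q).2 hq)]
    · rw [Set.indicator_of_notMem hq, Set.indicator_of_notMem (mt (hmem q).1 hq)]
  have hκle : κ ≤ volRatio / ENNReal.ofReal (ρ ^ 3) := by
    have h1 := hset fun _ => 1
    simp only [lintegral_const, Measure.restrict_apply_univ, one_mul] at h1
    have h2 : volume refTet ≤ volume (Metric.closedBall (0 : Q × ℝ) 2) :=
      measure_mono refTet_subset_closedBall
    have h3 : volume (Metric.closedBall z (ρ / 2)) =
        ENNReal.ofReal (ρ ^ 3) * volume (Metric.closedBall (0 : E) (1 / 2)) := by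
      have := Measure.addHaar_closedBall_mul (volume : Measure E) z hρ.le
        (by norm_num : (0 : ℝ) ≤ 1 / 2)
      rw [mul_one_div] at this
      simpa using this
    have h4 : volume (Metric.closedBall (0 : E) (1 / 2)) ≠ 0 :=
      (Metric.measure_closedBall_pos _ _ (by norm_num)).ne'
    have h5 : volume (Metric.closedBall (0 : E) (1 / 2)) ≠ ⊤ := measure_closedBall_lt_top.ne
    have h6 : ENNReal.ofReal (ρ ^ 3) ≠ 0 := by
      rw [Ne, ENNReal.ofReal_eq_zero, not_le]; positivity
    rw [volRatio, ENNReal.le_div_iff_mul_le (Or.inl h6) (Or.inl ENNReal.ofReal_ne_top),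
      ENNReal.le_div_iff_mul_le (Or.inl h4) (Or.inl h5), mul_assoc, ← h3]
    calc κ * volume (Metric.closedBall z (ρ / 2)) ≤ κ * volume (simplex T) := by gcongr
      _ = volume refTet := h1.symm
      _ ≤ _ := h2
  simp only [← hΛ]
  rw [hset]
  gcongr

/-- An upper bound for the surface measure of a parametrized piece of a plane, from the Lipschitz
constant `2 * r` of the parametrization. -/
theorem setLIntegral_image_frame_le {u v w a : E} {r : ℝ} (hu : ‖u‖ ≤ r) (hv : ‖v‖ ≤ r)
    {D : Set Q} {G : E → ℝ≥0∞} (hG : Measurable G) :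
    ∫⁻ x in (fun y : Q => a + frame u v w (y, 0)) '' D, G x ∂(Measure.euclideanHausdorffMeasure 2)
      ≤ ENNReal.ofReal (4 * r ^ 2) * ∫⁻ y in D, G (a + frame u v w (y, 0)) := by
  have hr : 0 ≤ r := (norm_nonneg u).trans hu
  set f : Q → E := fun y => a + frame u v w (y, 0) with hf
  have hfc : Continuous f := by simp only [hf, frame_apply]; fun_prop
  have hlip : LipschitzWith (2 * r).toNNReal f := by
    refine LipschitzWith.of_dist_le_mul fun y y' => ?_
    rw [Real.coe_toNNReal _ (by positivity), dist_eq_norm, dist_eq_norm]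
    have h0 : ∀ i, |y i - y' i| ≤ ‖y - y'‖ := fun i => by
      simpa using PiLp.norm_apply_le (y - y') i
    have h1 : f y - f y' = (y 0 - y' 0) • u + (y 1 - y' 1) • v := by
      simp only [hf, frame_apply]; module
    rw [h1]
    calc ‖(y 0 - y' 0) • u + (y 1 - y' 1) • v‖ ≤ |y 0 - y' 0| * ‖u‖ + |y 1 - y' 1| * ‖v‖ := by
          refine (norm_add_le _ _).trans_eq ?_
          rw [norm_smul, norm_smul, Real.norm_eq_abs, Real.norm_eq_abs]
      _ ≤ ‖y - y'‖ * r + ‖y - y'‖ * r := by gcongr <;> apply h0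
      _ = 2 * r * ‖y - y'‖ := by ring
  have hvol : ∀ s : Set Q, (Measure.euclideanHausdorffMeasure 2 : Measure E) (f '' s) ≤
      ENNReal.ofReal (4 * r ^ 2) * volume s := by
    intro s
    rw [← EuclideanSpace.euclideanHausdorffMeasure_eq_volume 2,
      Measure.euclideanHausdorffMeasure_def, Measure.euclideanHausdorffMeasure_def,
      Measure.smul_apply, Measure.smul_apply, mul_smul_comm]
    refine smul_le_smul_of_nonneg_left ?_ (by positivity)
    have := hlip.hausdorffMeasure_image_le (d := 2) (by norm_num) s
    refine this.trans_eq ?_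
    congr 1
    rw [show (4 * r ^ 2) = (2 * r) ^ 2 by ring, ENNReal.ofReal_pow (by positivity)]
    norm_num [ENNReal.ofReal]
  have hle : (Measure.euclideanHausdorffMeasure 2 : Measure E).restrict (f '' D) ≤
      ENNReal.ofReal (4 * r ^ 2) • Measure.map f (volume.restrict D) := by
    refine Measure.le_iff.2 fun s hs => ?_
    rw [Measure.restrict_apply hs, Measure.smul_apply, Measure.map_apply hfc.measurable hs,
      Measure.restrict_apply (hfc.measurable hs), smul_eq_mul]
    refine le_trans (le_of_eq ?_) (hvol (f ⁻¹' s ∩ D))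
    rw [Set.image_preimage_inter]
  refine (lintegral_mono' hle le_rfl).trans ?_
  rw [lintegral_smul_measure, lintegral_map hG hfc.measurable, smul_eq_mul]

theorem isCompact_simplex (T : Finset E) : IsCompact (simplex T) :=
  T.finite_toSet.isCompact_convexHull (𝕜 := ℝ)

theorem convex_simplex (T : Finset E) : Convex ℝ (simplex T) := convex_convexHull ℝ _

theorem restrict_cell (T : Finset E) :
    (volume : Measure E).restrict (cell T) = volume.restrict (simplex T) := by
  refine Measure.restrict_congr_set ?_
  have h := (convex_simplex T).addHaar_frontier volume
  exact interior_ae_eq_of_null_frontier h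

theorem norm_sub_le_diamT {T : Finset E} {x y : E} (hx : x ∈ T) (hy : y ∈ T) :
    ‖x - y‖ ≤ diamT T := by
  rw [← dist_eq_norm]
  exact Metric.dist_le_diam_of_mem (isCompact_simplex T).isBounded (subset_convexHull ℝ _ hx)
    (subset_convexHull ℝ _ hy)

/-- One corner of a facet: if `G` at a point is bounded by the integral of `H` along a segment in
the direction of the edges that leave the facet, then the integral of `G` over the corner is
bounded by the integral of `H` over the tetrahedron. -/
theorem IsTet.setLIntegral_corner_le {T : Finset E} {a b c p : E} (h : IsTet T a b c p) {z : E}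
    {ρ : ℝ} (hρ : 0 < ρ) (hb : Metric.closedBall z (ρ / 2) ⊆ simplex T) {G H : E → ℝ≥0∞}
    (hG : Measurable G) (hH : Measurable H)
    (hGH : ∀ x d : E, ‖d‖ ≤ diamT T → G x ≤ ∫⁻ t in Set.Icc (0 : ℝ) (1 / 3), H (x + t • d)) :
    ∫⁻ x in (fun y : Q => a + frame (b - a) (c - a) (p - a) (y, 0)) '' cornerTri, G x
        ∂(Measure.euclideanHausdorffMeasure 2) ≤
      ENNReal.ofReal (4 * diamT T ^ 2) * (volRatio / ENNReal.ofReal (ρ ^ 3) *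
        ∫⁻ x in cell T, H x) := by
  have hmem : ∀ x ∈ ({a, b, c, p} : Set E), x ∈ T := fun x hx => by
    rw [← Finset.mem_coe, h.eq]; exact hx
  have hba : ‖b - a‖ ≤ diamT T := norm_sub_le_diamT (hmem _ (by simp)) (hmem _ (by simp))
  have hca : ‖c - a‖ ≤ diamT T := norm_sub_le_diamT (hmem _ (by simp)) (hmem _ (by simp))
  have hpa : ‖p - a‖ ≤ diamT T := norm_sub_le_diamT (hmem _ (by simp)) (hmem _ (by simp))
  refine (setLIntegral_image_frame_le hba hca hG).trans ?_
  gcongr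
  rw [restrict_cell]
  refine le_trans ?_ (h.lintegral_refTet_le hρ hb H)
  set L := frame (b - a) (c - a) (p - a) with hL
  have hLc : Continuous fun q : Q × ℝ => a + L q := by simp only [hL, frame_apply]; fun_prop
  have hsplit : ∀ (y : Q) (t : ℝ), a + L (y, t) = a + L (y, 0) + t • (p - a) := by
    intro y t; simp only [hL, frame_apply]; module
  calc ∫⁻ y in cornerTri, G (a + L (y, 0))
      ≤ ∫⁻ y in cornerTri, ∫⁻ t in Set.Icc (0 : ℝ) (1 / 3), H (a + L (y, t)) := by
        refine lintegral_mono fun y => (hGH _ (p - a) hpa).trans_eq ?_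
        exact lintegral_congr fun t => by rw [← hsplit]
    _ = ∫⁻ q in cornerTri ×ˢ Set.Icc (0 : ℝ) (1 / 3), H (a + L q) := by
        rw [Measure.volume_eq_prod, ← Measure.prod_restrict]
        exact (lintegral_prod (fun q : Q × ℝ => H (a + L q))
          (hH.comp hLc.measurable).aemeasurable).symm
    _ ≤ ∫⁻ q in refTet, H (a + L q) := by
        refine lintegral_mono_set ?_
        rintro ⟨y, t⟩ ⟨⟨h0, h1, h2⟩, h3, h4⟩
        exact ⟨h0, h1, h3, by show y 0 + y 1 + t ≤ 1; linarith⟩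

/-- The constant in the comparison of integrals over a facet and over the tetrahedron. -/
noncomputable def facetConst : ℝ≥0∞ := 12 * volRatio

theorem facetConst_ne_top : facetConst ≠ ⊤ := ENNReal.mul_ne_top (by norm_num) volRatio_ne_top

/-- If `G` at a point is bounded by the integral of `H` along each segment that starts there, then
the integral of `G` over a facet is bounded by `h⁻¹` times the integral of `H` over the
tetrahedron. -/
theorem lintegral_surf_le {T F : Finset E} (hc : T.card = 4)
    (hi : AffineIndependent ℝ ((↑) : T → E)) (hF : F ∈ facetsOf T) {z : E} {ρ σ : ℝ} (hρ : 0 < ρ)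
    (hb : Metric.closedBall z (ρ / 2) ⊆ simplex T) (hσ : diamT T ≤ σ * ρ) (hd : 0 < diamT T)
    {G H : E → ℝ≥0∞} (hG : Measurable G) (hH : Measurable H)
    (hGH : ∀ x d : E, ‖d‖ ≤ diamT T → G x ≤ ∫⁻ t in Set.Icc (0 : ℝ) (1 / 3), H (x + t • d)) :
    ∫⁻ x, G x ∂(surf F) ≤
      facetConst * ENNReal.ofReal (σ ^ 3 / diamT T) * ∫⁻ x in cell T, H x := by
  obtain ⟨a, b, c, p, hFe, -, h1, h2, h3⟩ := exists_isTet hc hi hF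
  have hκ : ENNReal.ofReal (4 * diamT T ^ 2) * (volRatio / ENNReal.ofReal (ρ ^ 3)) ≤
      4 * volRatio * ENNReal.ofReal (σ ^ 3 / diamT T) := by
    have h4 : 4 * volRatio * ENNReal.ofReal (σ ^ 3 / diamT T) =
        volRatio * ENNReal.ofReal (4 * (σ ^ 3 / diamT T)) := by
      rw [ENNReal.ofReal_mul (by norm_num), ENNReal.ofReal_ofNat]; ring
    rw [h4, div_eq_mul_inv, ← ENNReal.ofReal_inv_of_pos (by positivity), mul_left_comm,
      ← ENNReal.ofReal_mul (by positivity)]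
    refine mul_le_mul_right ?_ volRatio
    refine ENNReal.ofReal_le_ofReal ?_
    rw [mul_assoc, ← div_eq_mul_inv]
    gcongr 4 * ?_
    rw [div_le_div_iff₀ (by positivity) hd]
    calc diamT T ^ 2 * diamT T = diamT T ^ 3 := by ring
      _ ≤ (σ * ρ) ^ 3 := by gcongr
      _ = σ ^ 3 * ρ ^ 3 := by ring
  have hA := h1.setLIntegral_corner_le hρ hb hG hH hGH
  have hB := h2.setLIntegral_corner_le hρ hb hG hH hGH
  have hC := h3.setLIntegral_corner_le hρ hb hG hH hGH
  rw [← mul_assoc] at hA hB hC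
  calc ∫⁻ x, G x ∂(surf F) ≤ _ := lintegral_mono_set (simplex_subset_corners (p := p) hFe)
    _ ≤ _ := (lintegral_union_le _ _ _).trans (add_le_add_left (lintegral_union_le _ _ _) _)
    _ ≤ 4 * volRatio * ENNReal.ofReal (σ ^ 3 / diamT T) * (∫⁻ x in cell T, H x) +
        4 * volRatio * ENNReal.ofReal (σ ^ 3 / diamT T) * (∫⁻ x in cell T, H x) +
        4 * volRatio * ENNReal.ofReal (σ ^ 3 / diamT T) * (∫⁻ x in cell T, H x) :=
      add_le_add (add_le_add (hA.trans (by gcongr)) (hB.trans (by gcongr))) (hC.trans (by gcongr))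
    _ = facetConst * ENNReal.ofReal (σ ^ 3 / diamT T) * ∫⁻ x in cell T, H x := by
      rw [facetConst, ← add_mul, ← add_mul, ← add_mul, ← add_mul, ← add_mul, ← add_mul]
      norm_num

/-! ### Two tetrahedra with a common facet -/

/-- The barycentric coordinate of the vertex `p` is `x ↦ ℓ (x - a)` for a linear form `ℓ`. -/
theorem IsTet.exists_coord {T : Finset E} {a b c p : E} (h : IsTet T a b c p) :
    ∃ ℓ : E →ₗ[ℝ] ℝ, ℓ (b - a) = 0 ∧ ℓ (c - a) = 0 ∧ ℓ (p - a) = 1 ∧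
      ∀ x ∈ simplex T, 0 ≤ ℓ (x - a) ∧ ℓ (x - a) ≤ 1 := by
  obtain ⟨Λ, hΛ⟩ := h.exists_equiv
  have hℓ : ∀ q, Λ.symm (frame (b - a) (c - a) (p - a) q) = q := fun q => by
    rw [← hΛ, Λ.symm_apply_apply]
  refine ⟨LinearMap.snd ℝ Q ℝ ∘ₗ Λ.symm.toLinearEquiv.toLinearMap, ?_, ?_, ?_, ?_⟩
  · have := hℓ (!₂[1, 0], 0)
    simp [frame_apply] at this
    simp [this]
  · have := hℓ (!₂[0, 1], 0)
    simp [frame_apply] at this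
    simp [this]
  · have := hℓ (0, 1)
    simp [frame_apply] at this
    simp [this]
  · intro x hx
    obtain ⟨q, ⟨h0, h1, h2, h3⟩, rfl⟩ := exists_of_mem_simplex h.eq hx
    simp only [add_sub_cancel_left, LinearMap.comp_apply, LinearMap.snd_apply]
    have : Λ.symm.toLinearEquiv.toLinearMap (frame (b - a) (c - a) (p - a) q) = q := hℓ q
    rw [this]
    exact ⟨h2, by linarith⟩

/-- The edges of a tetrahedron are at least as long as the diameter of an inscribed ball: moving
through the ball in the direction of the edge changes a barycentric coordinate by at most one. -/
theorem IsTet.le_norm_sub {T : Finset E} {a b c p : E} (h : IsTet T a b c p) {z : E} {ρ : ℝ}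
    (hρ : 0 < ρ) (hb : Metric.closedBall z (ρ / 2) ⊆ simplex T) : ρ ≤ ‖p - a‖ := by
  obtain ⟨ℓ, -, -, h1, h2⟩ := h.exists_coord
  have hne : 0 < ‖p - a‖ := by
    rw [norm_pos_iff]; intro h0; rw [h0, map_zero] at h1; exact zero_ne_one h1
  set e : E := (ρ / 2 * ‖p - a‖⁻¹) • (p - a) with he
  have hen : ‖e‖ = ρ / 2 := by
    rw [he, norm_smul, Real.norm_of_nonneg (by positivity), mul_assoc, inv_mul_cancel₀ hne.ne',
      mul_one]
  have hp := (h2 (z + e) (hb (by simp [hen]))).2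
  have hm := (h2 (z - e) (hb (by simp [hen]))).1
  have hle : ℓ e = ρ / 2 * ‖p - a‖⁻¹ := by rw [he, map_smul, h1, smul_eq_mul, mul_one]
  rw [show z + e - a = (z - a) + e by abel, map_add] at hp
  rw [show z - e - a = (z - a) - e by abel, map_sub] at hm
  have : ρ * ‖p - a‖⁻¹ ≤ 1 := by linarith
  rwa [← div_eq_mul_inv, div_le_one hne] at this

/-- Two different tetrahedra of a conforming mesh that share a facet lie on opposite sides of its
plane, which is the zero set of `x ↦ ℓ (x - a)`: otherwise their intersection would not be contained
in that plane, as the hull of the common vertices is. -/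
theorem not_same_side {T T' : Finset E} {a b c p p' : E} (h : IsTet T a b c p)
    (h' : IsTet T' a b c p')
    (hconf : simplex T ∩ simplex T' = convexHull ℝ ((T : Set E) ∩ (T' : Set E))) (hne : T ≠ T')
    (hp : p ∉ ({a, b, c} : Set E)) (ℓ : E →ₗ[ℝ] ℝ) (hb : ℓ (b - a) = 0) (hc : ℓ (c - a) = 0)
    (hs : 0 < ℓ (p - a) * ℓ (p' - a)) : False := by
  obtain ⟨Λ, hΛ⟩ := h'.exists_equiv
  obtain ⟨⟨y, t⟩, hq⟩ : ∃ q, frame (b - a) (c - a) (p' - a) q = p - a :=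
    ⟨Λ.symm (p - a), by rw [← hΛ, Λ.apply_symm_apply]⟩
  rw [frame_apply] at hq
  simp only at hq
  have ht : t * ℓ (p' - a) = ℓ (p - a) := by
    rw [← hq]; simp [hb, hc]
  have ht0 : 0 < t := by
    rw [← ht] at hs
    have : 0 < t * (ℓ (p' - a) * ℓ (p' - a)) := by linarith
    exact pos_of_mul_pos_left this (mul_self_nonneg _)
  -- a point near the barycenter of the common facet lies in both tetrahedra
  set ε : ℝ := 1 / (3 * (1 + |y 0| + |y 1| + t)) with hε
  have hden : 0 < 1 + |y 0| + |y 1| + t := by positivity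
  have hε0 : 0 < ε := by positivity
  have hε1 : ε * (1 + |y 0| + |y 1| + t) = 1 / 3 := by rw [hε]; field_simp
  have e0 : 0 ≤ ε * |y 0| := by positivity
  have e1 : 0 ≤ ε * |y 1| := by positivity
  have et : 0 ≤ ε * t := by positivity
  have a0 : |ε * y 0| = ε * |y 0| := by rw [abs_mul, abs_of_pos hε0]
  have a1 : |ε * y 1| = ε * |y 1| := by rw [abs_mul, abs_of_pos hε0]
  have b0 := abs_le.1 a0.le
  have b1 := abs_le.1 a1.le
  set x : E := a + frame (b - a) (c - a) (p - a) (!₂[1 / 3, 1 / 3], ε) with hx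
  have hxT : x ∈ simplex T := by
    refine add_frame_mem_simplex h.eq ⟨?_, ?_, ?_, ?_⟩ <;> simp
    · exact hε0.le
    · nlinarith
  have hxT' : x ∈ simplex T' := by
    have hxe : x = a + frame (b - a) (c - a) (p' - a)
        (!₂[1 / 3 + ε * y 0, 1 / 3 + ε * y 1], ε * t) := by
      simp only [hx, frame_apply, ← hq, Matrix.cons_val]
      module
    rw [hxe]
    refine add_frame_mem_simplex h'.eq ⟨?_, ?_, ?_, ?_⟩ <;> simp
    · nlinarith
    · nlinarith
    · exact et
    · nlinarith
  have hxF : x ∈ convexHull ℝ ((T : Set E) ∩ (T' : Set E)) := hconf ▸ ⟨hxT, hxT'⟩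
  have hsub : (T : Set E) ∩ (T' : Set E) ⊆ {w | ℓ (w - a) = 0} := by
    rintro w ⟨hw, hw'⟩
    rw [h.eq] at hw
    rcases hw with rfl | rfl | rfl | rfl
    · simp
    · exact hb
    · exact hc
    · rw [h'.eq] at hw'
      have : w = p' := by
        by_contra hwp
        exact hp (by simpa [hwp] using hw')
      exact absurd (by rw [← Finset.coe_inj, h.eq, h'.eq, this]) hne
  have hcv : Convex ℝ {w | ℓ (w - a) = 0} := by
    intro u hu v hv α β _ _ hαβ
    simp only [Set.mem_ofPred_eq] at hu hv ⊢
    have : α • u + β • v - a = α • (u - a) + β • (v - a) := by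
      rw [show α = 1 - β by linarith]; module
    rw [this, map_add, map_smul, map_smul, hu, hv]; simp
  have h0 : ℓ (x - a) = 0 := convexHull_min hsub hcv hxF
  have h1 : ℓ (x - a) = ε * ℓ (p - a) := by
    simp [hx, frame_apply, hb, hc]
  rw [h1] at h0
  rcases mul_eq_zero.1 h0 with h2 | h2
  · exact hε0.ne' h2
  · rw [h2, zero_mul] at hs; exact lt_irrefl _ hs

/-! ### Shape-regular tetrahedra -/

/-- A non-degenerate tetrahedron that contains a ball of diameter at least `diamT T / σ`. -/
structure IsRegularTet (σ : ℝ) (T : Finset E) : Prop where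
  card_eq : T.card = 4
  indep : AffineIndependent ℝ ((↑) : T → E)
  ball : ∃ (c : E) (ρ : ℝ), 0 < ρ ∧ Metric.closedBall c (ρ / 2) ⊆ simplex T ∧ diamT T ≤ σ * ρ

theorem Mesh.ShapeRegular.isRegularTet {Ω : Set E} {M : Mesh Ω} {σ : ℝ} (h : M.ShapeRegular σ)
    {T : Finset E} (hT : T ∈ M.cells) : IsRegularTet σ T :=
  ⟨M.card_eq T hT, M.indep T hT, h T hT⟩

theorem isOpen_cell (T : Finset E) : IsOpen (cell T) := isOpen_interior

theorem convex_cell (T : Finset E) : Convex ℝ (cell T) := (convex_simplex T).interior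

theorem volume_cell_lt_top (T : Finset E) : volume (cell T) < ⊤ :=
  (measure_mono interior_subset).trans_lt (isCompact_simplex T).measure_lt_top

instance isFiniteMeasure_restrict_cell (T : Finset E) :
    IsFiniteMeasure ((volume : Measure E).restrict (cell T)) :=
  ⟨by simpa using volume_cell_lt_top T⟩

theorem IsRegularTet.cell_nonempty {σ : ℝ} {T : Finset E} (h : IsRegularTet σ T) :
    (cell T).Nonempty := by
  obtain ⟨c, ρ, hρ, hb, -⟩ := h.ball
  exact ⟨c, interior_mono hb (Metric.ball_subset_interior_closedBall
    (Metric.mem_ball_self (by positivity)))⟩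

theorem IsRegularTet.closure_cell {σ : ℝ} {T : Finset E} (h : IsRegularTet σ T) :
    closure (cell T) = simplex T := by
  rw [cell, (convex_simplex T).closure_interior_eq_closure_of_nonempty_interior h.cell_nonempty]
  exact (isCompact_simplex T).isClosed.closure_eq

theorem IsRegularTet.diamT_pos {σ : ℝ} {T : Finset E} (h : IsRegularTet σ T) : 0 < diamT T := by
  obtain ⟨c, ρ, hρ, hb, -⟩ := h.ball
  obtain ⟨F, hF⟩ : (facetsOf T).Nonempty := by
    rw [facetsOf, Finset.powersetCard_nonempty, h.card_eq]; norm_num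
  obtain ⟨a, b, c, p, -, -, h1, -⟩ := exists_isTet h.card_eq h.indep hF
  have hmem : ∀ x ∈ ({a, b, c, p} : Set E), x ∈ T := fun x hx => by
    rw [← Finset.mem_coe, h1.eq]; exact hx
  exact hρ.trans_le ((h1.le_norm_sub hρ hb).trans
    (norm_sub_le_diamT (hmem _ (by simp)) (hmem _ (by simp))))

theorem IsRegularTet.sigma_pos {σ : ℝ} {T : Finset E} (h : IsRegularTet σ T) : 0 < σ := by
  have hd := h.diamT_pos
  obtain ⟨c, ρ, hρ, -, h1⟩ := h.ball
  exact pos_of_mul_pos_left (hd.trans_le h1) hρ.le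

/-- The comparison of integrals over a facet and over the tetrahedron, under shape regularity. -/
theorem IsRegularTet.lintegral_surf_le {σ : ℝ} {T F : Finset E} (h : IsRegularTet σ T)
    (hF : F ∈ facetsOf T) {G H : E → ℝ≥0∞} (hG : Measurable G) (hH : Measurable H)
    (hGH : ∀ x d : E, ‖d‖ ≤ diamT T → G x ≤ ∫⁻ t in Set.Icc (0 : ℝ) (1 / 3), H (x + t • d)) :
    ∫⁻ x, G x ∂(surf F) ≤
      facetConst * ENNReal.ofReal (σ ^ 3 / diamT T) * ∫⁻ x in cell T, H x := by
  obtain ⟨c, ρ, hρ, hb, h1⟩ := h.ball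
  exact MagneticSUPG.lintegral_surf_le h.card_eq h.indep hF hρ hb h1 h.diamT_pos hG hH hGH

theorem IsRegularTet.isFiniteMeasure_surf {σ : ℝ} {T F : Finset E} (h : IsRegularTet σ T)
    (hF : F ∈ facetsOf T) : IsFiniteMeasure (surf F) := by
  constructor
  -- a constant is three times its integral over an interval of length `1 / 3`
  have := h.lintegral_surf_le hF (G := fun _ => 1) (H := fun _ => 3) measurable_const
    measurable_const (fun x d _ => by
      simp only [lintegral_const, Measure.restrict_apply_univ, Real.volume_Icc, sub_zero]
      rw [← ENNReal.ofReal_ofNat 3, ← ENNReal.ofReal_mul (by norm_num)]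
      norm_num)
  simp only [lintegral_const, one_mul, Measure.restrict_apply_univ] at this
  exact this.trans_lt (ENNReal.mul_lt_top (ENNReal.mul_lt_top facetConst_ne_top.lt_top
    ENNReal.ofReal_lt_top) (ENNReal.mul_lt_top (by simp) (volume_cell_lt_top T)))

/-! ### Traces of `H¹` fields -/

theorem ennreal_add_sq_le (a b : ℝ≥0∞) : (a + b) ^ 2 ≤ 2 * a ^ 2 + 2 * b ^ 2 := by
  have := ENNReal.rpow_add_le_mul_rpow_add_rpow a b (p := 2) (by norm_num)
  norm_num at this
  rw [← mul_add]
  exact this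

theorem ennreal_sum_sq_le {ι : Type*} (s : Finset ι) (f : ι → ℝ≥0∞) :
    (∑ i ∈ s, f i) ^ 2 ≤ s.card * ∑ i ∈ s, f i ^ 2 := by
  have := ENNReal.inner_le_Lp_mul_Lq s f (fun _ => 1) Real.HolderConjugate.two_two
  simp only [mul_one, ENNReal.one_rpow, Finset.sum_const, nsmul_eq_mul] at this
  calc (∑ i ∈ s, f i) ^ 2 ≤ _ := pow_le_pow_left' this 2
    _ = s.card * ∑ i ∈ s, f i ^ 2 := by
      rw [mul_pow, ← ENNReal.rpow_natCast, ← ENNReal.rpow_mul, ← ENNReal.rpow_natCast,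
        ← ENNReal.rpow_mul, mul_comm]
      norm_num

/-- The value at an endpoint in terms of the `L²` norms of the function and its derivative on an
interval. -/
theorem enorm_sq_zero_le {G : Type*} [NormedAddCommGroup G] [NormedSpace ℝ G] [CompleteSpace G]
    {f f' : ℝ → G} (hf : ∀ t, HasDerivAt f (f' t) t) (hf' : Continuous f') :
    ‖f 0‖ₑ ^ 2 ≤ ∫⁻ t in Set.Icc (0 : ℝ) (1 / 3), (6 * ‖f t‖ₑ ^ 2 + 6 * ‖f' t‖ₑ ^ 2) := by
  have hfc : Continuous f := continuous_iff_continuousAt.2 fun t => (hf t).continuousAt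
  have hm : Measurable fun t => ‖f t‖ₑ ^ 2 := (continuous_enorm.comp hfc).measurable.pow_const 2
  have hm' : Measurable fun t => ‖f' t‖ₑ := (continuous_enorm.comp hf').measurable
  set I := Set.Icc (0 : ℝ) (1 / 3)
  set A := ∫⁻ t in I, ‖f' t‖ₑ with hA
  set B := ∫⁻ t in I, ‖f' t‖ₑ ^ 2 with hB
  have hvol : volume I = 3⁻¹ := by
    rw [Real.volume_Icc, sub_zero, one_div, ENNReal.ofReal_inv_of_pos (by norm_num)]; norm_num
  have hAB : A ^ 2 ≤ 3⁻¹ * B := by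
    have := sq_lintegral_le (volume.restrict I) (g := fun t => ‖f' t‖ₑ)
      hm'.aemeasurable
    rwa [Measure.restrict_apply_univ, hvol] at this
  have h1 : ∀ t ∈ I, ‖f 0‖ₑ ^ 2 ≤ 2 * ‖f t‖ₑ ^ 2 + 2 * A ^ 2 := by
    intro t ht
    have h2 : f 0 = f t - ∫ s in (0 : ℝ)..t, f' s := by
      rw [intervalIntegral.integral_eq_sub_of_hasDerivAt (fun s _ => hf s)
        (hf'.intervalIntegrable _ _)]
      abel
    have h3 : ‖∫ s in (0 : ℝ)..t, f' s‖ₑ ≤ A := by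
      rw [intervalIntegral.integral_of_le ht.1]
      refine (enorm_integral_le_lintegral_enorm _).trans (lintegral_mono_set ?_)
      exact fun s hs => ⟨hs.1.le, hs.2.trans ht.2⟩
    have h4 : ‖f 0‖ₑ ≤ ‖f t‖ₑ + A := by
      rw [h2]; exact (enorm_sub_le).trans (by gcongr)
    exact (pow_le_pow_left' h4 2).trans (ennreal_add_sq_le _ _)
  have h5 : 3⁻¹ * ‖f 0‖ₑ ^ 2 ≤ 2 * (∫⁻ t in I, ‖f t‖ₑ ^ 2) + 3⁻¹ * (2 * A ^ 2) := by
    calc 3⁻¹ * ‖f 0‖ₑ ^ 2 = ∫⁻ _ in I, ‖f 0‖ₑ ^ 2 := by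
          rw [setLIntegral_const, hvol, mul_comm]
      _ ≤ ∫⁻ t in I, (2 * ‖f t‖ₑ ^ 2 + 2 * A ^ 2) := setLIntegral_mono
          ((hm.const_mul 2).add measurable_const) h1
      _ = 2 * (∫⁻ t in I, ‖f t‖ₑ ^ 2) + 3⁻¹ * (2 * A ^ 2) := by
          rw [lintegral_add_right _ measurable_const, lintegral_const_mul _ hm,
            setLIntegral_const, hvol, mul_comm (2 * A ^ 2)]
  have h33 : (3 : ℝ≥0∞) * 3⁻¹ = 1 := ENNReal.mul_inv_cancel (by norm_num) (by norm_num)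
  have h6 : ‖f 0‖ₑ ^ 2 ≤ 6 * (∫⁻ t in I, ‖f t‖ₑ ^ 2) + 2 * A ^ 2 := by
    calc ‖f 0‖ₑ ^ 2 = 3 * (3⁻¹ * ‖f 0‖ₑ ^ 2) := by rw [← mul_assoc, h33, one_mul]
      _ ≤ 3 * (2 * (∫⁻ t in I, ‖f t‖ₑ ^ 2) + 3⁻¹ * (2 * A ^ 2)) := by gcongr
      _ = 3 * 2 * (∫⁻ t in I, ‖f t‖ₑ ^ 2) + (3 * 3⁻¹) * (2 * A ^ 2) := by ring
      _ = _ := by rw [h33, one_mul]; norm_num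
  have h7 : 2 * A ^ 2 ≤ 6 * B := by
    calc 2 * A ^ 2 ≤ 2 * (3⁻¹ * B) := by gcongr
      _ ≤ 6 * (1 * B) := by
        gcongr
        · norm_num
        · exact ENNReal.inv_le_one.2 (by norm_num)
      _ = 6 * B := by rw [one_mul]
  rw [lintegral_add_left (hm.const_mul 6), lintegral_const_mul _ hm,
    lintegral_const_mul _ (hm'.pow_const 2)]
  exact h6.trans (by gcongr)

theorem enorm_fderiv_apply_sq_le {φ : E → E} (x d : E) :
    ‖fderiv ℝ φ x d‖ₑ ^ 2 ≤ 3 * ‖d‖ₑ ^ 2 * ∑ i, ‖pd i φ x‖ₑ ^ 2 := by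
  have hd : d = ∑ i, d i • (EuclideanSpace.single i (1 : ℝ) : E) := by
    ext j; simp [Finset.sum_apply, Pi.single_apply]
  have h1 : ‖fderiv ℝ φ x d‖ₑ ≤ ∑ i, ‖d‖ₑ * ‖pd i φ x‖ₑ := by
    conv_lhs => rw [hd, map_sum]
    refine (enorm_sum_le _ _).trans (Finset.sum_le_sum fun i _ => ?_)
    rw [map_smul, enorm_smul]
    refine mul_le_mul_left ?_ _
    rw [enorm_le_iff_norm_le]
    exact PiLp.norm_apply_le d i
  refine (pow_le_pow_left' h1 2).trans ((ennreal_sum_sq_le _ _).trans_eq ?_)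
  simp only [mul_pow, ← Finset.mul_sum, Finset.card_univ, Fintype.card_fin, Nat.cast_ofNat,
    mul_assoc]

/-- The constant of the trace inequality on a tetrahedron of diameter `h`. -/
noncomputable def traceConst (σ h : ℝ) : ℝ≥0∞ := 18 * facetConst * ENNReal.ofReal (σ ^ 3 / h)

theorem traceConst_ne_top (σ h : ℝ) : traceConst σ h ≠ ⊤ :=
  ENNReal.mul_ne_top (ENNReal.mul_ne_top (by norm_num) facetConst_ne_top) ENNReal.ofReal_ne_top

/-- The square of the `H¹` norm on `T` of a field `f` with derivatives `g`, scaled with the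
diameter: `‖f‖² + h_T² ∑ᵢ ‖gᵢ‖²`. -/
noncomputable def scaledSq (T : Finset E) (f : E → E) (g : Fin 3 → E → E) : ℝ≥0∞ :=
  eLpNorm f 2 (volume.restrict (cell T)) ^ 2 +
    ENNReal.ofReal (diamT T) ^ 2 * ∑ i, eLpNorm (g i) 2 (volume.restrict (cell T)) ^ 2

/-- The scaled trace inequality for smooth fields. -/
theorem IsRegularTet.trace_le_of_contDiff {σ : ℝ} {T F : Finset E} (h : IsRegularTet σ T)
    (hF : F ∈ facetsOf T) {φ : E → E} (hφ : ContDiff ℝ ∞ φ) :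
    eLpNorm φ 2 (surf F) ^ 2 ≤ traceConst σ (diamT T) * scaledSq T φ (fun i => pd i φ) := by
  have hc : Continuous φ := hφ.continuous
  have hpc : ∀ i, Continuous (pd i φ) := fun i => (contDiff_pd hφ i).continuous
  have hm : ∀ i, Measurable fun x => ‖pd i φ x‖ₑ ^ 2 := fun i =>
    (hpc i).measurable.enorm.pow_const 2
  have hm0 : Measurable fun x => ‖φ x‖ₑ ^ 2 := hc.measurable.enorm.pow_const 2
  set η := ENNReal.ofReal (diamT T) with hη
  have hms : Measurable fun x => η ^ 2 * ∑ i, ‖pd i φ x‖ₑ ^ 2 :=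
    (Finset.measurable_sum _ fun i _ => hm i).const_mul _
  have key := h.lintegral_surf_le hF (G := fun x => ‖φ x‖ₑ ^ 2)
    (H := fun x => 18 * (‖φ x‖ₑ ^ 2 + η ^ 2 * ∑ i, ‖pd i φ x‖ₑ ^ 2)) hm0
    ((hm0.add hms).const_mul _) (fun x d hd => by
      have hder : ∀ t : ℝ, HasDerivAt (fun t : ℝ => φ (x + t • d))
          (fderiv ℝ φ (x + t • d) d) t := by
        intro t
        have h1 : HasDerivAt (fun t : ℝ => x + t • d) d t := by
          simpa using ((hasDerivAt_id t).smul_const d).const_add x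
        exact (hφ.differentiable (by simp) _).hasFDerivAt.comp_hasDerivAt t h1
      have hdc : Continuous fun t : ℝ => fderiv ℝ φ (x + t • d) d :=
        ((hφ.continuous_fderiv (by simp)).comp (by fun_prop)).clm_apply continuous_const
      have h2 := enorm_sq_zero_le hder hdc
      simp only [zero_smul, add_zero] at h2
      refine h2.trans (lintegral_mono fun t => ?_)
      have hdη : ‖d‖ₑ ≤ η := by
        rw [hη, ← ofReal_norm]; exact ENNReal.ofReal_le_ofReal hd
      have h3 : ‖fderiv ℝ φ (x + t • d) d‖ₑ ^ 2 ≤ 3 * η ^ 2 * ∑ i, ‖pd i φ (x + t • d)‖ₑ ^ 2 :=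
        (enorm_fderiv_apply_sq_le _ _).trans (by gcongr)
      calc 6 * ‖φ (x + t • d)‖ₑ ^ 2 + 6 * ‖fderiv ℝ φ (x + t • d) d‖ₑ ^ 2
          ≤ 18 * ‖φ (x + t • d)‖ₑ ^ 2 + 6 * (3 * η ^ 2 * ∑ i, ‖pd i φ (x + t • d)‖ₑ ^ 2) := by
            gcongr; norm_num
        _ = 18 * (‖φ (x + t • d)‖ₑ ^ 2 + η ^ 2 * ∑ i, ‖pd i φ (x + t • d)‖ₑ ^ 2) := by ring)
  rw [eLpNorm_two_sq]
  refine key.trans_eq ?_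
  have hms' : Measurable fun x => ∑ i, ‖pd i φ x‖ₑ ^ 2 := Finset.measurable_sum _ fun i _ => hm i
  have hmt : Measurable fun x => ‖φ x‖ₑ ^ 2 + η ^ 2 * ∑ i, ‖pd i φ x‖ₑ ^ 2 := hm0.add hms
  rw [lintegral_const_mul _ hmt, lintegral_add_left hm0, lintegral_const_mul _ hms',
    lintegral_finsetSum _ fun i _ => hm i, scaledSq, traceConst]
  simp only [eLpNorm_two_sq]
  ring

theorem tendsto_eLpNorm_of_sub {α G : Type*} [MeasurableSpace α] [NormedAddCommGroup G]
    {μ : Measure α} {φ : ℕ → α → G} {g : α → G} (hφ : ∀ n, AEStronglyMeasurable (φ n) μ)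
    (hg : MemLp g 2 μ) (h : Tendsto (fun n => eLpNorm (fun x => φ n x - g x) 2 μ) atTop (𝓝 0)) :
    Tendsto (fun n => eLpNorm (φ n) 2 μ) atTop (𝓝 (eLpNorm g 2 μ)) := by
  have h1 : Tendsto (fun n => eLpNorm g 2 μ - eLpNorm (fun x => φ n x - g x) 2 μ) atTop
      (𝓝 (eLpNorm g 2 μ)) := by
    simpa using ENNReal.Tendsto.sub tendsto_const_nhds h (Or.inl hg.2.ne)
  have h2 : Tendsto (fun n => eLpNorm g 2 μ + eLpNorm (fun x => φ n x - g x) 2 μ) atTop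
      (𝓝 (eLpNorm g 2 μ)) := by
    simpa using tendsto_const_nhds.add h
  refine tendsto_of_tendsto_of_tendsto_of_le_of_le h1 h2 (fun n => ?_) (fun n => ?_)
  · refine tsub_le_iff_right.2 ?_
    have := eLpNorm_sub_le (μ := μ) (p := 2) (hφ n) ((hφ n).sub hg.1) (by norm_num)
    simpa [Pi.sub_def] using this
  · have := eLpNorm_add_le (μ := μ) (p := 2) hg.1 ((hφ n).sub hg.1) (by norm_num)
    simpa [Pi.sub_def, Pi.add_def] using this

theorem hNorm_one_sub_sq {U : Set E} (hU : IsOpen U) {f : E → E} {g : Fin 3 → E → E}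
    (h : MemH1 U f g) {φ : E → E} (hφ : ContDiff ℝ ∞ φ) :
    hNorm 1 U (fun x => φ x - f x) ^ 2 =
      eLpNorm (fun x => φ x - f x) 2 (volume.restrict U) ^ 2 +
        ∑ i, eLpNorm (fun x => pd i φ x - g i x) 2 (volume.restrict U) ^ 2 :=
  hNorm_one_sq hU fun i => (isWeakDeriv_pd U hφ i).sub (h.deriv i)

/-- The trace inequality, from smooth fields by density. -/
theorem IsTrace.eLpNorm_sq_le {σ : ℝ} {T F : Finset E} (hT : IsRegularTet σ T)
    (hF : F ∈ facetsOf T) {f tr : E → E} {g : Fin 3 → E → E} (h : MemH1 (cell T) f g)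
    (htr : IsTrace T f tr) :
    eLpNorm tr 2 (surf F) ^ 2 ≤ traceConst σ (diamT T) * scaledSq T f g := by
  obtain ⟨hmem, φ, hφ, hconv, hsurf⟩ := htr
  have hle : ∀ n, eLpNorm (fun x => φ n x - f x) 2 (volume.restrict (cell T)) ≤
      hNorm 1 (cell T) (fun x => φ n x - f x) := fun n => by
    refine (ENNReal.pow_le_pow_left_iff two_ne_zero).1 ?_
    rw [hNorm_one_sub_sq (isOpen_cell T) h (hφ n)]
    exact le_self_add
  have hle' : ∀ i n, eLpNorm (fun x => pd i (φ n) x - g i x) 2 (volume.restrict (cell T)) ≤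
      hNorm 1 (cell T) (fun x => φ n x - f x) := fun i n => by
    refine (ENNReal.pow_le_pow_left_iff two_ne_zero).1 ?_
    rw [hNorm_one_sub_sq (isOpen_cell T) h (hφ n)]
    refine le_add_left (Finset.single_le_sum (f := fun i =>
      eLpNorm (fun x => pd i (φ n) x - g i x) 2 (volume.restrict (cell T)) ^ 2)
      (fun _ _ => zero_le) (Finset.mem_univ i))
  have hsq : ∀ {u : ℕ → ℝ≥0∞} {a : ℝ≥0∞}, Tendsto u atTop (𝓝 a) →
      Tendsto (fun n => u n ^ 2) atTop (𝓝 (a ^ 2)) := fun hu =>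
    ((ENNReal.continuous_pow 2).tendsto _).comp hu
  have t0 := hsq (tendsto_eLpNorm_of_sub (fun n => (hφ n).continuous.aestronglyMeasurable) h.memLp
    (tendsto_of_tendsto_of_tendsto_of_le_of_le tendsto_const_nhds hconv (fun _ => zero_le) hle))
  have t1 := fun i => hsq (tendsto_eLpNorm_of_sub
    (fun n => (contDiff_pd (hφ n) i).continuous.aestronglyMeasurable) (h.memLp_deriv i)
    (tendsto_of_tendsto_of_tendsto_of_le_of_le tendsto_const_nhds hconv (fun _ => zero_le)
      (hle' i)))
  have t2 := hsq (tendsto_eLpNorm_of_sub (fun n => (hφ n).continuous.aestronglyMeasurable)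
    (hmem F hF) (hsurf F hF))
  have t3 : Tendsto (fun n => scaledSq T (φ n) fun i => pd i (φ n)) atTop (𝓝 (scaledSq T f g)) :=
    t0.add (ENNReal.Tendsto.const_mul (tendsto_finsetSum _ fun i _ => t1 i)
      (Or.inr (by simp)))
  exact le_of_tendsto_of_tendsto' t2
    (ENNReal.Tendsto.const_mul t3 (Or.inr (traceConst_ne_top _ _)))
    fun n => hT.trace_le_of_contDiff hF (hφ n)

/-- Fields in `H¹` of a tetrahedron have a trace: along a smooth approximating sequence the
restrictions to the boundary form a Cauchy sequence. -/
theorem IsRegularTet.exists_isTrace {σ : ℝ} {T : Finset E} (hT : IsRegularTet σ T) {f : E → E}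
    {g : Fin 3 → E → E} (h : MemH1 (cell T) f g) : ∃ tr, IsTrace T f tr := by
  obtain ⟨φ, hφ, h0, h1⟩ := h.exists_smooth_approx (isOpen_cell T) (convex_cell T) hT.cell_nonempty
  -- the surface measure on the whole boundary
  set ν : Measure E := ∑ F ∈ facetsOf T, surf F with hν
  have hνle : ∀ F ∈ facetsOf T, surf F ≤ ν := fun F hF => by
    refine Measure.le_iff.2 fun s _ => ?_
    rw [hν, Measure.finsetSum_apply]
    exact Finset.single_le_sum (f := fun F => surf F s) (fun _ _ => zero_le) hF
  have hsq : ∀ u : E → E, eLpNorm u 2 ν ^ 2 = ∑ F ∈ facetsOf T, eLpNorm u 2 (surf F) ^ 2 := by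
    intro u
    simp only [eLpNorm_two_sq]
    rw [hν, lintegral_finsetSum_measure]
  have hbd : ∀ u : E → E, ContDiff ℝ ∞ u → eLpNorm u 2 ν ^ 2 ≤
      (facetsOf T).card * (traceConst σ (diamT T) * scaledSq T u fun i => pd i u) := by
    intro u hu
    rw [hsq, ← nsmul_eq_mul]
    exact Finset.sum_le_card_nsmul _ _ _ fun F hF => hT.trace_le_of_contDiff hF hu
  have hLp : ∀ u : E → E, ContDiff ℝ ∞ u → MemLp u 2 ν := by
    intro u hu
    refine ⟨hu.continuous.aestronglyMeasurable, ?_⟩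
    have hb : ∀ w : E → E, Continuous w → eLpNorm w 2 (volume.restrict (cell T)) ≠ ⊤ := by
      intro w hw
      obtain ⟨C, hC⟩ := (isCompact_simplex T).exists_bound_of_continuousOn hw.continuousOn
      exact (MemLp.of_bound hw.aestronglyMeasurable C
        ((ae_restrict_iff' (isOpen_cell T).measurableSet).2 (Eventually.of_forall fun x hx =>
          hC x (interior_subset hx)))).2.ne
    have hfin : scaledSq T u (fun i => pd i u) ≠ ⊤ := by
      refine ENNReal.add_ne_top.2 ⟨ENNReal.pow_ne_top (hb u hu.continuous), ENNReal.mul_ne_top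
        (by simp) (ENNReal.sum_ne_top.2 fun i _ =>
          ENNReal.pow_ne_top (hb _ (contDiff_pd hu i).continuous))⟩
    have h2 : eLpNorm u 2 ν ^ 2 < ⊤ := (hbd u hu).trans_lt (ENNReal.mul_lt_top (by simp)
      (ENNReal.mul_lt_top (traceConst_ne_top _ _).lt_top hfin.lt_top))
    exact lt_top_iff_ne_top.2 fun h3 => by simp [h3] at h2
  -- distance of the approximations to the limit
  set K : ℝ≥0∞ := (facetsOf T).card * traceConst σ (diamT T) + 1 with hK
  have hKt : K ≠ ⊤ := ENNReal.add_ne_top.2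
    ⟨ENNReal.mul_ne_top (by simp) (traceConst_ne_top _ _), by simp⟩
  set η := ENNReal.ofReal (diamT T) with hη
  set e : ℕ → ℝ≥0∞ := fun n => K * (eLpNorm (fun x => φ n x - f x) 2 (volume.restrict (cell T)) +
    η * ∑ i, eLpNorm (fun x => pd i (φ n) x - g i x) 2 (volume.restrict (cell T))) with he
  have hetend : Tendsto e atTop (𝓝 0) := by
    have h2 : Tendsto (fun n => eLpNorm (fun x => φ n x - f x) 2 (volume.restrict (cell T)) +
        η * ∑ i, eLpNorm (fun x => pd i (φ n) x - g i x) 2 (volume.restrict (cell T))) atTop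
        (𝓝 (0 + η * ∑ i : Fin 3, 0)) :=
      h0.add (ENNReal.Tendsto.const_mul (tendsto_finsetSum _ fun i _ => h1 i)
        (Or.inr (by simp [hη])))
    simpa using ENNReal.Tendsto.const_mul h2 (Or.inr hKt)
  have htri : ∀ {u v w : E → E}, AEStronglyMeasurable u (volume.restrict (cell T)) →
      AEStronglyMeasurable v (volume.restrict (cell T)) →
      AEStronglyMeasurable w (volume.restrict (cell T)) →
      eLpNorm (fun x => u x - v x) 2 (volume.restrict (cell T)) ≤
        eLpNorm (fun x => u x - w x) 2 (volume.restrict (cell T)) +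
        eLpNorm (fun x => v x - w x) 2 (volume.restrict (cell T)) := by
    intro u v w hu hv hw
    have := eLpNorm_sub_le (p := 2) (hu.sub hw) (hv.sub hw) (by norm_num)
    simpa [Pi.sub_def] using this
  have hdiff : ∀ n m, eLpNorm (φ n - φ m) 2 ν ≤ e n + e m := by
    intro n m
    have hpd : ∀ i, pd i (φ n - φ m) = fun x => pd i (φ n) x - pd i (φ m) x := by
      intro i; ext1 x
      simp only [pd]
      rw [fderiv_sub ((hφ n).differentiable (by simp) x) ((hφ m).differentiable (by simp) x)]
      rfl
    have h2 : scaledSq T (φ n - φ m) (fun i => pd i (φ n - φ m)) ≤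
        (eLpNorm (fun x => φ n x - φ m x) 2 (volume.restrict (cell T)) +
        η * ∑ i, eLpNorm (fun x => pd i (φ n) x - pd i (φ m) x) 2
          (volume.restrict (cell T))) ^ 2 := by
      rw [scaledSq]
      simp only [hpd]
      have hsum : ∀ a : Fin 3 → ℝ≥0∞, ∑ i, a i ^ 2 ≤ (∑ i, a i) ^ 2 := fun a => by
        rw [sq (∑ i, a i), Finset.sum_mul]
        refine Finset.sum_le_sum fun i hi => ?_
        rw [sq]
        exact mul_le_mul_right (Finset.single_le_sum (fun _ _ => zero_le) hi) _
      calc _ ≤ eLpNorm (fun x => φ n x - φ m x) 2 (volume.restrict (cell T)) ^ 2 +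
            (η * ∑ i, eLpNorm (fun x => pd i (φ n) x - pd i (φ m) x) 2
              (volume.restrict (cell T))) ^ 2 := by
            rw [mul_pow]
            exact add_le_add le_rfl (mul_le_mul_right (hsum _) _)
        _ ≤ _ := by
            rw [add_sq, add_right_comm]
            exact le_self_add
    have h3 : eLpNorm (φ n - φ m) 2 ν ≤
        K * (eLpNorm (fun x => φ n x - φ m x) 2 (volume.restrict (cell T)) +
        η * ∑ i, eLpNorm (fun x => pd i (φ n) x - pd i (φ m) x) 2 (volume.restrict (cell T))) := by
      refine (ENNReal.pow_le_pow_left_iff two_ne_zero).1 ((hbd _ ((hφ n).sub (hφ m))).trans ?_)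
      rw [mul_pow, ← mul_assoc]
      refine mul_le_mul' ?_ h2
      calc _ ≤ K := le_self_add
        _ = K * 1 := (mul_one K).symm
        _ ≤ K ^ 2 := by rw [sq]; exact mul_le_mul_right (le_add_self) K
    refine h3.trans ?_
    simp only [he]
    rw [← mul_add]
    refine mul_le_mul_right ?_ K
    have hA := htri (hφ n).continuous.aestronglyMeasurable (hφ m).continuous.aestronglyMeasurable
      h.memLp.1
    have hB := Finset.sum_le_sum fun (i : Fin 3) (_ : i ∈ Finset.univ) =>
      htri (contDiff_pd (hφ n) i).continuous.aestronglyMeasurable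
        (contDiff_pd (hφ m) i).continuous.aestronglyMeasurable (h.memLp_deriv i).1
    rw [Finset.sum_add_distrib] at hB
    refine (add_le_add hA (mul_le_mul_right hB η)).trans_eq ?_
    ring
  let u : ℕ → Lp E 2 ν := fun n => (hLp (φ n) (hφ n)).toLp
  have hcau : CauchySeq u := by
    refine EMetric.cauchySeq_iff.2 fun ε hε => ?_
    obtain ⟨N, hN⟩ := eventually_atTop.1 (hetend.eventually_lt_const (ENNReal.half_pos hε.ne'))
    refine ⟨N, fun m hm n hn => ?_⟩
    simp only [u, Lp.edist_toLp_toLp]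
    exact (hdiff m n).trans_lt ((ENNReal.add_lt_add (hN m hm) (hN n hn)).trans_eq
      (ENNReal.add_halves ε))
  obtain ⟨L, hL⟩ := cauchySeq_tendsto_of_complete hcau
  have hLν : Tendsto (fun n => eLpNorm (fun x => φ n x - L x) 2 ν) atTop (𝓝 0) := by
    have h2 := (tendsto_iff_edist_tendsto_0.1 hL)
    refine h2.congr fun n => ?_
    rw [Lp.edist_def]
    refine eLpNorm_congr_ae ?_
    filter_upwards [(hLp (φ n) (hφ n)).coeFn_toLp] with x hx
    simp [u, hx]
  refine ⟨L, fun F hF => (Lp.memLp L).mono_measure (hνle F hF), φ, hφ, ?_, fun F hF =>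
    tendsto_of_tendsto_of_tendsto_of_le_of_le tendsto_const_nhds hLν (fun _ => zero_le)
      fun n => eLpNorm_mono_measure _ (hνle F hF)⟩
  have hsq0 : Tendsto (fun n => hNorm 1 (cell T) (fun x => φ n x - f x) ^ 2) atTop (𝓝 0) := by
    have hp : ∀ {v : ℕ → ℝ≥0∞}, Tendsto v atTop (𝓝 0) → Tendsto (fun n => v n ^ 2) atTop (𝓝 0) :=
      fun hv => by simpa [Function.comp_def] using ((ENNReal.continuous_pow 2).tendsto 0).comp hv
    have h2 := (hp h0).add (tendsto_finsetSum Finset.univ fun i _ => hp (h1 i))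
    simp only [Finset.sum_const_zero, add_zero] at h2
    exact h2.congr fun n => (hNorm_one_sub_sq (isOpen_cell T) h (hφ n)).symm
  have h3 := (ENNReal.continuous_rpow_const (y := 1 / 2)).tendsto 0 |>.comp hsq0
  rw [ENNReal.zero_rpow_of_pos (by norm_num)] at h3
  refine h3.congr fun n => ?_
  simp only [Function.comp]
  rw [← ENNReal.rpow_natCast, ← ENNReal.rpow_mul]
  norm_num

/-! ### Neighbouring elements of a mesh -/

section Neighbours

variable {Ω : Set E} {M : Mesh Ω}

theorem mem_sides {T F : Finset E} : T ∈ M.sides F ↔ T ∈ M.cells ∧ F ⊆ T := by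
  simp [Mesh.sides]

theorem mem_facetsOf_of_mem_sides {T T' F : Finset E} (hF : F ∈ facetsOf T)
    (hT' : T' ∈ M.sides F) : F ∈ facetsOf T' :=
  Finset.mem_powersetCard.2 ⟨(mem_sides.1 hT').2, (Finset.mem_powersetCard.1 hF).2⟩

theorem mem_sides_of_mem_facetsOf {T F : Finset E} (hT : T ∈ M.cells) (hF : F ∈ facetsOf T) :
    T ∈ M.sides F :=
  mem_sides.2 ⟨hT, (Finset.mem_powersetCard.1 hF).1⟩

/-- A facet belongs to at most two elements: of three, two would lie on the same side. -/
theorem card_sides_le_two {F : Finset E} (hF : F.card = 3) : (M.sides F).card ≤ 2 := by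
  classical
  by_contra hcard
  rw [not_le, Finset.two_lt_card] at hcard
  obtain ⟨T₁, h₁, T₂, h₂, T₃, h₃, h12, h13, h23⟩ := hcard
  obtain ⟨a, b, c, -, -, -, rfl⟩ := Finset.card_eq_three.1 hF
  have hex : ∀ T ∈ M.sides ({a, b, c} : Finset E), T ∈ M.cells ∧
      ∃ p, p ∉ ({a, b, c} : Set E) ∧ IsTet T a b c p := by
    intro T hT
    obtain ⟨hTc, hFT⟩ := mem_sides.1 hT
    have h1 : (T \ {a, b, c}).card = 1 := by
      rw [Finset.card_sdiff_of_subset hFT, M.card_eq T hTc, hF]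
    obtain ⟨p, hp⟩ := Finset.card_eq_one.1 h1
    have hTe : (T : Set E) = {a, b, c, p} := by
      rw [← Finset.union_sdiff_of_subset hFT, hp]
      ext x; simp
    have hpF : p ∉ ({a, b, c} : Finset E) := by
      have : p ∈ T \ {a, b, c} := by rw [hp]; simp
      exact (Finset.mem_sdiff.1 this).2
    exact ⟨hTc, p, by simpa using hpF,
      isTet_of_affineIndependent (M.card_eq T hTc) (M.indep T hTc) hTe⟩
  obtain ⟨c₁, p₁, n₁, t₁⟩ := hex T₁ h₁
  obtain ⟨c₂, p₂, n₂, t₂⟩ := hex T₂ h₂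
  obtain ⟨c₃, p₃, n₃, t₃⟩ := hex T₃ h₃
  obtain ⟨ℓ, hb, hc, h1, -⟩ := t₁.exists_coord
  have hne : ∀ {T : Finset E} {p : E}, IsTet T a b c p → ℓ (p - a) ≠ 0 := by
    intro T p ht h0
    obtain ⟨Λ, hΛ⟩ := ht.exists_equiv
    obtain ⟨q, hq⟩ : ∃ q, frame (b - a) (c - a) (p - a) q = p₁ - a :=
      ⟨Λ.symm (p₁ - a), by rw [← hΛ, Λ.apply_symm_apply]⟩
    rw [← hq, frame_apply] at h1
    simp [hb, hc, h0] at h1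
  have hn2 := hne t₂
  have hn3 := hne t₃
  rcases lt_or_gt_of_ne hn2 with h2 | h2
  · rcases lt_or_gt_of_ne hn3 with h3 | h3
    · exact not_same_side t₂ t₃ (M.conforming _ c₂ _ c₃) h23 n₂ ℓ hb hc
        (mul_pos_of_neg_of_neg h2 h3)
    · exact not_same_side t₁ t₃ (M.conforming _ c₁ _ c₃) h13 n₁ ℓ hb hc
        (by rw [h1, one_mul]; exact h3)
  · exact not_same_side t₁ t₂ (M.conforming _ c₁ _ c₂) h12 n₁ ℓ hb hc
      (by rw [h1, one_mul]; exact h2)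

/-- Elements with a common facet have comparable diameters, as they share an edge. -/
theorem diamT_le_of_common_facet {σ : ℝ} {T T' F : Finset E} (hT : IsRegularTet σ T)
    (hF : F ∈ facetsOf T) (hFT' : F ⊆ T') : diamT T ≤ σ * diamT T' := by
  have hσ := hT.sigma_pos
  obtain ⟨z, ρ, hρ, hb, h1⟩ := hT.ball
  obtain ⟨a, b, c, p, hFe, -, ht, -, -⟩ := exists_isTet hT.card_eq hT.indep hF
  -- the same tetrahedron, seen from the edge from `a` to `b` of the common facet
  have ht' : IsTet T a p c b := isTet_of_affineIndependent hT.card_eq hT.indep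
    (ht.eq.trans (by ext x; simp only [Set.mem_insert_iff, Set.mem_singleton_iff]; tauto))
  have ha : a ∈ T' := hFT' (by rw [← Finset.mem_coe, hFe]; simp)
  have hb' : b ∈ T' := hFT' (by rw [← Finset.mem_coe, hFe]; simp)
  calc diamT T ≤ σ * ρ := h1
    _ ≤ σ * diamT T' := by
      gcongr
      exact (ht'.le_norm_sub hρ hb).trans (norm_sub_le_diamT hb' ha)

theorem cell_subset {T : Finset E} (hΩ : interior (closure Ω) = Ω) (hT : T ∈ M.cells) :
    cell T ⊆ Ω := by
  rw [← hΩ, ← M.cover]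
  exact interior_mono (Set.subset_biUnion_of_mem (u := fun T => simplex T) hT)

theorem simplex_subset {T : Finset E} (hT : T ∈ M.cells) : simplex T ⊆ closure Ω := by
  rw [← M.cover]
  exact Set.subset_biUnion_of_mem (u := fun T => simplex T) hT

theorem simplex_facet_subset {T F : Finset E} (hF : F ∈ facetsOf T) : simplex F ⊆ simplex T :=
  convexHull_mono (Finset.coe_subset.2 (Finset.mem_powersetCard.1 hF).1)

end Neighbours

/-! ### Polynomial fields -/

/-- On polynomials of one variable of bounded degree, the value at `0` is controlled by the `L²`
norm on an interval. -/
theorem exists_polynomial_const (r : ℕ) :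
    ∃ C : ℝ, 0 < C ∧ ∀ q : Polynomial ℝ, q.natDegree ≤ r →
      q.eval 0 ^ 2 ≤ C * ∫ t in (0 : ℝ)..(1 / 3), q.eval t ^ 2 := by
  let P : (Fin (r + 1) → ℝ) → ℝ → ℝ := fun c t => ∑ i : Fin (r + 1), c i * t ^ (i : ℕ)
  let N : (Fin (r + 1) → ℝ) → ℝ := fun c => ∫ t in (0 : ℝ)..(1 / 3), P c t ^ 2
  have hPc : Continuous (Function.uncurry P) := by
    simp only [P, Function.uncurry_def]; fun_prop
  have hNc : Continuous N :=
    intervalIntegral.continuous_parametric_intervalIntegral_of_continuous'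
      (f := fun c t => P c t ^ 2) (by simp only [Function.uncurry_def]; exact hPc.pow 2) 0 (1 / 3)
  have hNpos : ∀ c, c ≠ 0 → 0 < N c := by
    intro c hc
    have hPt : Continuous fun t => P c t ^ 2 :=
      (hPc.comp (continuous_const.prodMk continuous_id)).pow 2
    by_contra hN
    have h0 : N c = 0 := le_antisymm (not_lt.1 hN)
      (intervalIntegral.integral_nonneg (by norm_num) fun t _ => sq_nonneg _)
    have hz : ∀ t ∈ Set.Icc (0 : ℝ) (1 / 3), P c t = 0 := by
      by_contra hcon
      push Not at hcon
      obtain ⟨t, ht, hne⟩ := hcon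
      have : 0 < N c := intervalIntegral.integral_pos (by norm_num) hPt.continuousOn
        (fun t _ => sq_nonneg _) ⟨t, ht, by positivity⟩
      linarith
    apply hc
    let q : Polynomial ℝ := ∑ i : Fin (r + 1), Polynomial.monomial (i : ℕ) (c i)
    have hq : ∀ t, q.eval t = P c t := by
      intro t; simp [q, P, Polynomial.eval_finsetSum]
    have hq0 : q = 0 := Polynomial.eq_zero_of_infinite_isRoot q
      ((Set.Icc_infinite (by norm_num : (0 : ℝ) < 1 / 3)).mono fun t ht => by
        simp [Polynomial.IsRoot, hq, hz t ht])
    ext i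
    have h2 : q.coeff i = c i := by
      simp only [q, Polynomial.finsetSum_coeff, Polynomial.coeff_monomial]
      rw [Finset.sum_eq_single i]
      · simp
      · intro j _ hj; rw [if_neg]; exact fun h => hj (Fin.ext h)
      · simp
    rw [← h2, hq0]; simp
  have hNhom : ∀ (s : ℝ) c, N (s • c) = s ^ 2 * N c := by
    intro s c
    simp only [N]
    rw [← intervalIntegral.integral_const_mul]
    congr 1; ext t
    simp only [P, Pi.smul_apply, smul_eq_mul, mul_assoc, ← Finset.mul_sum]
    ring
  -- the minimum over the unit sphere of the coefficient space, extended by homogeneity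
  obtain ⟨m, hm0, hm⟩ : ∃ m : ℝ, 0 < m ∧
      ∀ c ∈ Metric.sphere (0 : Fin (r + 1) → ℝ) 1, m ≤ N c := by
    obtain ⟨c, hc, hmin⟩ := (isCompact_sphere (0 : Fin (r + 1) → ℝ) 1).exists_isMinOn
      (NormedSpace.sphere_nonempty.2 zero_le_one) hNc.continuousOn
    exact ⟨N c, hNpos c (ne_zero_of_mem_unit_sphere ⟨c, hc⟩), fun c' hc' => hmin hc'⟩
  have hall : ∀ c, m * ‖c‖ ^ 2 ≤ N c := by
    intro c
    rcases eq_or_ne c 0 with rfl | hc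
    · simp only [norm_zero]
      have : 0 ≤ N 0 := intervalIntegral.integral_nonneg (by norm_num) fun t _ => sq_nonneg _
      simpa using this
    · have hn : ‖c‖ ≠ 0 := norm_ne_zero_iff.2 hc
      have h1 := hm (‖c‖⁻¹ • c) (by simp [norm_smul, hn])
      rw [hNhom, inv_pow, ← div_eq_inv_mul, le_div_iff₀ (by positivity)] at h1
      exact h1
  refine ⟨m⁻¹, inv_pos.2 hm0, fun q hq => ?_⟩
  let c : Fin (r + 1) → ℝ := fun i => q.coeff i
  have hqP : ∀ t, q.eval t = P c t := by
    intro t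
    rw [Polynomial.eval_eq_sum_range' (Nat.lt_succ_of_le hq), ← Fin.sum_univ_eq_sum_range
      (fun i => q.coeff i * t ^ i)]
  have h0 : q.eval 0 ^ 2 ≤ ‖c‖ ^ 2 := by
    rw [← Polynomial.coeff_zero_eq_eval_zero, sq_le_sq, abs_norm]
    exact norm_le_pi_norm c 0
  rw [← div_eq_inv_mul, le_div_iff₀ hm0]
  simp only [hqP] at h0 ⊢
  calc _ ≤ ‖c‖ ^ 2 * m := by gcongr
    _ = m * ‖c‖ ^ 2 := mul_comm _ _
    _ ≤ N c := hall c

/-- A constant for the comparison of values and integrals of polynomials of degree at most `r`. -/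
noncomputable def polyConst (r : ℕ) : ℝ := (exists_polynomial_const r).choose

theorem polyConst_pos (r : ℕ) : 0 < polyConst r := (exists_polynomial_const r).choose_spec.1

theorem enorm_eval_zero_sq_le {r : ℕ} {q : Polynomial ℝ} (hq : q.natDegree ≤ r) :
    ‖q.eval 0‖ₑ ^ 2 ≤ ENNReal.ofReal (polyConst r) *
      ∫⁻ t in Set.Icc (0 : ℝ) (1 / 3), ‖q.eval t‖ₑ ^ 2 := by
  have h := (exists_polynomial_const r).choose_spec.2 q hq
  have hsq : ∀ s : ℝ, ‖s‖ₑ ^ 2 = ENNReal.ofReal (s ^ 2) := fun s => by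
    rw [← ofReal_norm, ← ENNReal.ofReal_pow (norm_nonneg s), Real.norm_eq_abs, sq_abs]
  have hc : Continuous fun t => q.eval t ^ 2 := q.continuous.pow 2
  simp only [hsq]
  rw [← ofReal_integral_eq_lintegral_ofReal
      (hc.continuousOn.integrableOn_compact isCompact_Icc)
      (Eventually.of_forall fun t => sq_nonneg _),
    ← ENNReal.ofReal_mul (polyConst_pos r).le]
  refine ENNReal.ofReal_le_ofReal (h.trans_eq ?_)
  rw [intervalIntegral.integral_of_le (by norm_num), integral_Icc_eq_integral_Ioc]
  rfl

theorem enorm_sq_eq_sum (x : E) : ‖x‖ₑ ^ 2 = ∑ i, ‖x i‖ₑ ^ 2 := by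
  simp only [← ofReal_norm]
  simp only [← ENNReal.ofReal_pow (norm_nonneg _)]
  rw [← ENNReal.ofReal_sum_of_nonneg fun i _ => by positivity, EuclideanSpace.norm_sq_eq]

/-- The restriction of a polynomial field to a line is polynomial in the parameter. -/
theorem IsPolyField.exists_polynomial {r : ℕ} {u : E → E} (h : IsPolyField r u) (x d : E)
    (i : Fin 3) : ∃ q : Polynomial ℝ, q.natDegree ≤ r ∧ ∀ t : ℝ, u (x + t • d) i = q.eval t := by
  obtain ⟨p, hp⟩ := h
  let q : Polynomial ℝ := MvPolynomial.aeval
    (fun j => Polynomial.C (x j) + Polynomial.C (d j) * Polynomial.X) (p i)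
  refine ⟨q, ?_, fun t => ?_⟩
  · refine (MvPolynomial.aeval_natDegree_le (n := 1) (p i) (hp i).1 _ fun j => ?_).trans (by simp)
    rw [add_comm]
    exact Polynomial.natDegree_linear_le
  · have h1 := MvPolynomial.comp_aeval_apply (R := ℝ)
      (fun j => Polynomial.C (x j) + Polynomial.C (d j) * Polynomial.X) (Polynomial.aeval t) (p i)
    rw [Polynomial.coe_aeval_eq_eval] at h1
    rw [(hp i).2, h1, ← MvPolynomial.coe_aeval_eq_eval]
    have h2 : (fun j => (x + t • d) j) = fun j =>
        Polynomial.eval t (Polynomial.C (x j) + Polynomial.C (d j) * Polynomial.X) := by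
      funext j
      simp only [PiLp.add_apply, PiLp.smul_apply, smul_eq_mul, Polynomial.eval_add,
        Polynomial.eval_mul, Polynomial.eval_C, Polynomial.eval_X]
      ring
    rw [h2]
    rfl

theorem IsPolyField.continuous {r : ℕ} {u : E → E} (h : IsPolyField r u) : Continuous u := by
  obtain ⟨p, hp⟩ := h
  have h1 : u = fun x => WithLp.toLp 2 fun i => MvPolynomial.eval (fun j => x j) (p i) := by
    ext x i; exact (hp i).2 x
  rw [h1]
  refine (PiLp.continuous_toLp 2 _).comp (continuous_pi fun i => ?_)
  exact (MvPolynomial.continuous_eval (p i)).comp (PiLp.continuous_ofLp 2 _)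

/-- On a segment, the value of a polynomial field at an endpoint is controlled by its `L²` norm. -/
theorem IsPolyField.enorm_sq_le {r : ℕ} {u : E → E} (h : IsPolyField r u) (x d : E) :
    ‖u x‖ₑ ^ 2 ≤ ∫⁻ t in Set.Icc (0 : ℝ) (1 / 3),
      ENNReal.ofReal (polyConst r) * ‖u (x + t • d)‖ₑ ^ 2 := by
  choose q hq hqe using h.exists_polynomial x d
  have hm : ∀ i, Measurable fun t => ‖(q i).eval t‖ₑ ^ 2 := fun i =>
    (q i).continuous.measurable.enorm.pow_const 2
  have h0 : ∀ i, u x i = (q i).eval 0 := fun i => by rw [← hqe i 0]; simp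
  simp only [enorm_sq_eq_sum, hqe, h0]
  rw [lintegral_const_mul _ (Finset.measurable_sum _ fun i _ => hm i),
    lintegral_finsetSum _ fun i _ => hm i, Finset.mul_sum]
  exact Finset.sum_le_sum fun i _ => enorm_eval_zero_sq_le (hq i)

/-- The constant in the comparison of the norms of polynomial fields on a facet and on the
tetrahedron of diameter `h`. -/
noncomputable def polyTraceConst (r : ℕ) (σ h : ℝ) : ℝ≥0∞ :=
  facetConst * ENNReal.ofReal (σ ^ 3 / h) * ENNReal.ofReal (polyConst r)

/-- The discrete trace inequality: on polynomial fields, no derivatives are needed to bound the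
values on a facet. -/
theorem IsRegularTet.eLpNorm_surf_polyField_sq_le {σ : ℝ} {T F : Finset E} (hT : IsRegularTet σ T)
    (hF : F ∈ facetsOf T) {r : ℕ} {u : E → E} (hu : IsPolyField r u) :
    eLpNorm u 2 (surf F) ^ 2 ≤
      polyTraceConst r σ (diamT T) * eLpNorm u 2 (volume.restrict (cell T)) ^ 2 := by
  have hm : Measurable fun x => ‖u x‖ₑ ^ 2 := hu.continuous.measurable.enorm.pow_const 2
  have := hT.lintegral_surf_le hF hm (hm.const_mul _) fun x d _ => hu.enorm_sq_le x d
  rw [lintegral_const_mul _ hm, ← eLpNorm_two_sq, ← eLpNorm_two_sq, ← mul_assoc] at this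
  exact this

/-- A polynomial field that vanishes on an open set vanishes everywhere. -/
theorem IsPolyField.eq_zero {r : ℕ} {u : E → E} (hu : IsPolyField r u) {U : Set E} (hU : IsOpen U)
    (hne : U.Nonempty) (h0 : ∀ x ∈ U, u x = 0) : u = 0 := by
  obtain ⟨y, hy⟩ := hne
  funext x
  ext i
  obtain ⟨q, -, hq⟩ := hu.exists_polynomial y (x - y) i
  have hcont : Continuous fun t : ℝ => y + t • (x - y) := by fun_prop
  have hnhds : (fun t : ℝ => y + t • (x - y)) ⁻¹' U ∈ 𝓝 (0 : ℝ) :=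
    hcont.continuousAt.preimage_mem_nhds (hU.mem_nhds (by simpa using hy))
  have hq0 : q = 0 := by
    refine Polynomial.eq_zero_of_infinite_isRoot q ((infinite_of_mem_nhds 0 hnhds).mono ?_)
    intro t ht
    simp only [Set.mem_ofPred_eq, Polynomial.IsRoot, ← hq]
    rw [h0 _ ht]; rfl
  have := hq 1
  rw [hq0] at this
  simpa using this

/-- The polynomial fields of degree at most `r`, as the range of a linear map from a
finite-dimensional space. -/
noncomputable def polyFieldMap (r : ℕ) :
    (Fin 3 → MvPolynomial.restrictTotalDegree (Fin 3) ℝ r) →ₗ[ℝ] (E → E) where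
  toFun p x := WithLp.toLp 2 fun i =>
    MvPolynomial.eval (fun j => x j) (p i : MvPolynomial (Fin 3) ℝ)
  map_add' p q := by ext x i; simp
  map_smul' s p := by ext x i; simp [MvPolynomial.smul_eval]

theorem IsPolyField.mem_range {r : ℕ} {u : E → E} (hu : IsPolyField r u) :
    u ∈ LinearMap.range (polyFieldMap r) := by
  obtain ⟨p, hp⟩ := hu
  refine ⟨fun i => ⟨p i, (MvPolynomial.mem_restrictTotalDegree _ _ _).2 (hp i).1⟩, ?_⟩
  ext x i
  simp [polyFieldMap, (hp i).2 x]

/-! ### The magnetic advection of an `H¹` field -/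

theorem locallyIntegrableOn_clm {F G : Type*} [NormedAddCommGroup F] [NormedSpace ℝ F]
    [NormedAddCommGroup G] [NormedSpace ℝ G] {U : Set E} {u : E → F} (hu : LocallyIntegrableOn u U)
    (L : F →L[ℝ] G) : LocallyIntegrableOn (fun x => L (u x)) U := by
  intro x hx
  obtain ⟨s, hs, hs'⟩ := hu x hx
  exact ⟨s, hs, L.integrable_comp hs'⟩

theorem IsTest.integrable_mul {U : Set E} {φ : E → ℝ} (h : IsTest U φ) {f : E → ℝ}
    (hf : LocallyIntegrableOn f U) : Integrable (fun x => φ x * f x) :=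
  h.integrable_smul hf

theorem integral_three_sub {a a' b b' c c' : E → ℝ} (ha : Integrable a) (ha' : Integrable a')
    (hb : Integrable b) (hb' : Integrable b') (hc : Integrable c) (hc' : Integrable c') :
    ∫ x, ((a x - a' x) + (b x - b' x) + (c x - c' x)) =
      (∫ x, a x) - (∫ x, a' x) + ((∫ x, b x) - ∫ x, b' x) + ((∫ x, c x) - ∫ x, c' x) := by
  have h1 : ∫ x, ((a x - a' x) + (b x - b' x) + (c x - c' x)) =
      (∫ x, ((a x - a' x) + (b x - b' x))) + ∫ x, (c x - c' x) :=
    integral_add ((ha.sub ha').add (hb.sub hb')) (hc.sub hc')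
  have h2 : ∫ x, ((a x - a' x) + (b x - b' x)) = (∫ x, (a x - a' x)) + ∫ x, (b x - b' x) :=
    integral_add (ha.sub ha') (hb.sub hb')
  rw [h1, h2, integral_sub ha ha', integral_sub hb hb', integral_sub hc hc']

theorem IsWeakDeriv.clm {F G : Type*} [NormedAddCommGroup F] [NormedSpace ℝ F] [CompleteSpace F]
    [NormedAddCommGroup G] [NormedSpace ℝ G] [CompleteSpace G] {U : Set E} {a : Fin 3 → ℕ}
    {f g : E → F} (h : IsWeakDeriv U a f g) (L : F →L[ℝ] G) :
    IsWeakDeriv U a (fun x => L (f x)) (fun x => L (g x)) := by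
  refine ⟨locallyIntegrableOn_clm h.1 L, locallyIntegrableOn_clm h.2.1 L, fun φ hφ => ?_⟩
  have h1 := congrArg L (h.2.2 φ hφ)
  rw [map_smul, ← L.integral_comp_comm ((hφ.pdMulti a).integrable_smul h.1).integrableOn,
    ← L.integral_comp_comm (hφ.integrable_smul h.2.1).integrableOn] at h1
  simpa only [map_smul] using h1

theorem IsWeakDeriv.component {U : Set E} {a : Fin 3 → ℕ} {f g : E → E} (h : IsWeakDeriv U a f g)
    (k : Fin 3) : IsWeakDeriv U a (fun x => f x k) (fun x => g x k) :=
  h.clm (EuclideanSpace.proj k)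

theorem pd_component {φ : E → E} (hφ : ContDiff ℝ ∞ φ) (j k : Fin 3) (x : E) :
    pd j (fun x => φ x k) x = pd j φ x k := by
  have h := ((EuclideanSpace.proj k : E →L[ℝ] ℝ).hasFDerivAt.comp x
    (hφ.differentiable (by simp) x).hasFDerivAt).fderiv
  have h2 : fderiv ℝ (fun x => φ x k) x = (EuclideanSpace.proj k : E →L[ℝ] ℝ).comp (fderiv ℝ φ x) :=
    h
  rw [pd, h2]; rfl

theorem IsTest.component {U : Set E} {φ : E → E} (h : IsTest U φ) (k : Fin 3) :
    IsTest U (fun x => φ x k) := by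
  refine ⟨(EuclideanSpace.proj k : E →L[ℝ] ℝ).contDiff.comp h.1,
    h.2.1.comp_left (g := fun v : E => v k) rfl, ?_⟩
  refine (closure_mono fun x hx => ?_).trans h.2.2
  intro h0
  exact hx (by simp [h0])

/-- The curl of a field with partial derivatives `g`, classical or weak. -/
noncomputable def curlOf (g : Fin 3 → E → E) (x : E) : E :=
  !₂[g 1 x 2 - g 2 x 1, g 2 x 0 - g 0 x 2, g 0 x 1 - g 1 x 0]

theorem locallyIntegrableOn_of_component {U : Set E} {f : E → E}
    (h : ∀ k, LocallyIntegrableOn (fun x => f x k) U) : LocallyIntegrableOn f U := by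
  have h1 := fun k => locallyIntegrableOn_clm (h k)
    (ContinuousLinearMap.toSpanSingleton ℝ (EuclideanSpace.single k (1 : ℝ) : E))
  have h2 := ((h1 0).add (h1 1)).add (h1 2)
  have h3 : f = fun x => f x 0 • (EuclideanSpace.single 0 (1 : ℝ) : E) +
      f x 1 • (EuclideanSpace.single 1 (1 : ℝ) : E) +
      f x 2 • (EuclideanSpace.single 2 (1 : ℝ) : E) := by
    funext x
    ext j
    fin_cases j <;> simp
  rw [h3]
  exact h2

theorem MemH1.isWeakCurl {U : Set E} {w : E → E} {g : Fin 3 → E → E} (h : MemH1 U w g) :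
    IsWeakCurl U w (curlOf g) := by
  have hint : ∀ (i k : Fin 3) {ψ : E → ℝ}, IsTest U ψ → Integrable fun x => ψ x * g i x k :=
    fun i k ψ hψ => hψ.integrable_smul ((h.deriv i).component k).2.1
  have hint' : ∀ (k : Fin 3) {ψ : E → ℝ}, IsTest U ψ → Integrable fun x => ψ x * w x k :=
    fun k ψ hψ => hψ.integrable_smul ((h.deriv 0).component k).1
  have hparts : ∀ (i k : Fin 3) {ψ : E → ℝ}, IsTest U ψ →
      ∫ x, pd i ψ x * w x k = -∫ x, ψ x * g i x k := fun i k ψ hψ =>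
    (isWeakDeriv_single_iff.1 ((h.deriv i).component k)).2.2 ψ hψ
  refine ⟨(h.deriv 0).1, ?_, fun φ hφ => ?_⟩
  · have hc : ∀ i k : Fin 3, LocallyIntegrableOn (fun x => g i x k) U := fun i k =>
      ((h.deriv i).component k).2.1
    refine locallyIntegrableOn_of_component fun k => ?_
    fin_cases k
    · exact (hc 1 2).sub (hc 2 1)
    · exact (hc 2 0).sub (hc 0 2)
    · exact (hc 0 1).sub (hc 1 0)
  · have hz : ∀ x ∉ U, φ x = 0 := fun x hx => hφ.eq_zero hx
    have hz' : ∀ x ∉ U, curl φ x = 0 := fun x hx => by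
      have : ∀ i, pd i φ x = 0 := fun i => (hφ.pd i).eq_zero hx
      ext k; fin_cases k <;> simp [curl, this]
    rw [setIntegral_eq_integral_of_forall_compl_eq_zero fun x hx => by
        rw [hz' x hx, inner_zero_right],
      setIntegral_eq_integral_of_forall_compl_eq_zero fun x hx => by
        rw [hz x hx, inner_zero_right]]
    have ht := fun k => hφ.component k
    have e1 : ∀ x, ⟪w x, curl φ x⟫_ℝ =
        (pd 1 (fun x => φ x 2) x * w x 0 - pd 2 (fun x => φ x 1) x * w x 0) +
        (pd 2 (fun x => φ x 0) x * w x 1 - pd 0 (fun x => φ x 2) x * w x 1) +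
        (pd 0 (fun x => φ x 1) x * w x 2 - pd 1 (fun x => φ x 0) x * w x 2) := by
      intro x
      simp only [pd_component hφ.1]
      simp [curl, PiLp.inner_apply, Fin.sum_univ_three]
      ring
    have e2 : ∀ x, ⟪curlOf g x, φ x⟫_ℝ =
        (φ x 0 * g 1 x 2 - φ x 0 * g 2 x 1) + (φ x 1 * g 2 x 0 - φ x 1 * g 0 x 2) +
        (φ x 2 * g 0 x 1 - φ x 2 * g 1 x 0) := by
      intro x
      simp [curlOf, PiLp.inner_apply, Fin.sum_univ_three]
      ring
    simp only [e1, e2]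
    have i1 := fun i k m => hint' k ((ht m).pd i)
    have i2 := fun i k m => hint i k (ht m)
    rw [integral_three_sub (i1 1 0 2) (i1 2 0 1) (i1 2 1 0) (i1 0 1 2) (i1 0 2 1) (i1 1 2 0),
      integral_three_sub (i2 1 2 0) (i2 2 1 0) (i2 2 0 1) (i2 0 2 1) (i2 0 1 2) (i2 1 0 2),
      hparts 1 0 (ht 2), hparts 2 0 (ht 1), hparts 2 1 (ht 0),
      hparts 0 1 (ht 2), hparts 0 2 (ht 1), hparts 1 2 (ht 0)]
    ring

theorem IsWeakCurl.ae_eq {U : Set E} (hU : IsOpen U) {w c c' : E → E} (h : IsWeakCurl U w c)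
    (h' : IsWeakCurl U w c') : c =ᵐ[volume.restrict U] c' := by
  have hk : ∀ k : Fin 3, (fun x => c x k) =ᵐ[volume.restrict U] fun x => c' x k := by
    intro k
    have hloc : ∀ {u : E → E}, LocallyIntegrableOn u U → LocallyIntegrableOn (fun x => u x k) U :=
      fun hu => locallyIntegrableOn_clm hu (EuclideanSpace.proj k)
    refine ae_eq_of_forall_test hU (hloc h.2.1) (hloc h'.2.1) fun η hη => ?_
    have ht : IsTest U fun x => η x • (EuclideanSpace.single k (1 : ℝ) : E) := hη.smul_const _
    have h1 := (h.2.2 _ ht).symm.trans (h'.2.2 _ ht)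
    have h2 : ∀ u : E → E, (fun x => ⟪u x, η x • (EuclideanSpace.single k (1 : ℝ) : E)⟫_ℝ) =
        fun x => η x • u x k := by
      intro u; ext x
      rw [inner_smul_right, EuclideanSpace.inner_single_right]; simp
    rwa [h2, h2, hη.setIntegral_smul, hη.setIntegral_smul] at h1
  filter_upwards [hk 0, hk 1, hk 2] with x h0 h1 h2
  ext k; fin_cases k <;> assumption

theorem lintegral_enorm_mul_le {α F G : Type*} [MeasurableSpace α] [NormedAddCommGroup F]
    [NormedAddCommGroup G] {μ : Measure α} {f : α → F} {g : α → G} (hf : AEStronglyMeasurable f μ)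
    (hg : AEStronglyMeasurable g μ) :
    ∫⁻ x, ‖f x‖ₑ * ‖g x‖ₑ ∂μ ≤ eLpNorm f 2 μ * eLpNorm g 2 μ := by
  have h := ENNReal.lintegral_mul_le_Lp_mul_Lq μ Real.HolderConjugate.two_two hf.enorm hg.enorm
  rw [eLpNorm_eq_lintegral_rpow_enorm_toReal (by norm_num) (by norm_num),
    eLpNorm_eq_lintegral_rpow_enorm_toReal (by norm_num) (by norm_num)]
  simpa using h

theorem integrable_inner_of_memLp {μ : Measure E} {f g : E → E} (hf : MemLp f 2 μ)
    (hg : MemLp g 2 μ) : Integrable (fun x => ⟪f x, g x⟫_ℝ) μ := by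
  refine ⟨hf.1.inner hg.1, ?_⟩
  refine lt_of_le_of_lt (lintegral_mono fun x => ?_)
    ((lintegral_enorm_mul_le hf.1 hg.1).trans_lt (ENNReal.mul_lt_top hf.2 hg.2))
  rw [← ofReal_norm, ← ofReal_norm, ← ofReal_norm, ← ENNReal.ofReal_mul (norm_nonneg _)]
  exact ENNReal.ofReal_le_ofReal (norm_inner_le_norm _ _)

theorem tendsto_integral_inner {μ : Measure E} {ζ w : E → E} {φ : ℕ → E → E} (hζ : MemLp ζ 2 μ)
    (hw : MemLp w 2 μ) (hφ : ∀ n, AEStronglyMeasurable (φ n) μ)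
    (h : Tendsto (fun n => eLpNorm (fun x => φ n x - w x) 2 μ) atTop (𝓝 0)) :
    Tendsto (fun n => ∫ x, ⟪ζ x, φ n x⟫_ℝ ∂μ) atTop (𝓝 (∫ x, ⟪ζ x, w x⟫_ℝ ∂μ)) := by
  have hfin : ∀ᶠ n in atTop, MemLp (φ n) 2 μ := by
    filter_upwards [h.eventually_lt_const (zero_lt_one' ℝ≥0∞)] with n hn
    have h1 : MemLp (fun x => φ n x - w x) 2 μ := ⟨(hφ n).sub hw.1, hn.trans ENNReal.one_lt_top⟩
    convert h1.add hw using 1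
    ext1 x
    simp
  refine tendsto_integral_of_L1 _ (integrable_inner_of_memLp hζ hw).1
    (hfin.mono fun n hn => integrable_inner_of_memLp hζ hn) ?_
  have h2 : Tendsto (fun n => eLpNorm ζ 2 μ * eLpNorm (fun x => φ n x - w x) 2 μ) atTop (𝓝 0) := by
    simpa using ENNReal.Tendsto.const_mul h (Or.inr hζ.2.ne)
  refine tendsto_of_tendsto_of_tendsto_of_le_of_le tendsto_const_nhds h2 (fun _ => zero_le)
    fun n => le_trans (lintegral_mono fun x => ?_) (lintegral_enorm_mul_le hζ.1 ((hφ n).sub hw.1))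
  rw [← inner_sub_right, ← ofReal_norm, ← ofReal_norm, ← ofReal_norm,
    ← ENNReal.ofReal_mul (norm_nonneg _)]
  exact ENNReal.ofReal_le_ofReal (norm_inner_le_norm _ _)

/-- The product rule for `β · φ` with `φ` smooth, tested with `η`: in each component, `η φ` is a
test function. -/
theorem integral_pd_mul_inner_smooth {U : Set E} {β B : E → E} {i : Fin 3}
    (hβ : IsWeakDeriv U (Pi.single i 1) β B) {φ : E → E} (hφ : ContDiff ℝ ∞ φ) {η : E → ℝ}
    (hη : IsTest U η) :
    ∫ x, ⟪pd i η x • β x, φ x⟫_ℝ = -(∫ x, ⟪η x • B x, φ x⟫_ℝ) - ∫ x, ⟪η x • β x, pd i φ x⟫_ℝ := by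
  have hφk : ∀ k, ContDiff ℝ ∞ fun x => φ x k := fun k =>
    (EuclideanSpace.proj k : E →L[ℝ] ℝ).contDiff.comp hφ
  have htest : ∀ {ψ : E → ℝ} {χ : E → ℝ}, IsTest U ψ → ContDiff ℝ ∞ χ →
      IsTest U fun x => ψ x * χ x := by
    intro ψ χ h1 h2
    refine ⟨h1.1.mul h2, h1.2.1.mul_right, ?_⟩
    exact (closure_mono (Function.support_mul_subset_left _ _)).trans h1.2.2
  have hpd : ∀ k x, pd i (fun x => η x * φ x k) x = pd i η x * φ x k + η x * pd i φ x k := by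
    intro k x
    have h1 := fderiv_mul (hη.1.differentiable (by simp) x) ((hφk k).differentiable (by simp) x)
    have h2 : fderiv ℝ (fun x => η x * φ x k) x =
      η x • fderiv ℝ (fun x => φ x k) x + φ x k • fderiv ℝ η x := h1
    rw [← pd_component hφ, pd, h2]
    simp [pd]; ring
  have hk : ∀ k : Fin 3, ∫ x, pd i η x * φ x k * β x k =
      -(∫ x, η x * φ x k * B x k) - ∫ x, η x * pd i φ x k * β x k := by
    intro k
    have h1 := (isWeakDeriv_single_iff.1 (hβ.component k)).2.2 _ (htest hη (hφk k))
    simp only [hpd, smul_eq_mul, add_mul] at h1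
    have hpk : ContDiff ℝ ∞ fun x => pd i φ x k :=
      (EuclideanSpace.proj k : E →L[ℝ] ℝ).contDiff.comp (contDiff_pd hφ i)
    rw [integral_add ((htest (hη.pd i) (hφk k)).integrable_mul (hβ.component k).1)
      ((htest hη hpk).integrable_mul (hβ.component k).1)] at h1
    linarith
  have hin : ∀ (s : ℝ) (u v : E), ⟪s • u, v⟫_ℝ = ∑ k, s * v k * u k := by
    intro s u v
    rw [real_inner_smul_left, PiLp.inner_apply, Finset.mul_sum]
    refine Finset.sum_congr rfl fun k _ => ?_
    simp; ring
  simp only [hin]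
  have hpk : ∀ k, ContDiff ℝ ∞ fun x => pd i φ x k := fun k =>
    (EuclideanSpace.proj k : E →L[ℝ] ℝ).contDiff.comp (contDiff_pd hφ i)
  rw [integral_finsetSum _ fun k _ =>
      (htest (hη.pd i) (hφk k)).integrable_mul (hβ.component k).1,
    integral_finsetSum _ fun k _ => (htest hη (hφk k)).integrable_mul (hβ.component k).2.1,
    integral_finsetSum _ fun k _ => (htest hη (hpk k)).integrable_mul (hβ.component k).1,
    Finset.sum_congr rfl fun k _ => hk k, Finset.sum_sub_distrib, Finset.sum_neg_distrib]

/-- The product rule for `β · w` with `β` and its weak derivatives bounded and `w` in `H¹`, by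
smooth approximation of `w`. -/
theorem MemH1.isWeakDeriv_inner {U : Set E} (hU : IsOpen U) (hUc : Convex ℝ U) (hUn : U.Nonempty)
    [IsFiniteMeasure (volume.restrict U)] {w : E → E} {g : Fin 3 → E → E} (h : MemH1 U w g)
    {β : E → E} {B : Fin 3 → E → E} (hβ : ∀ i, IsWeakDeriv U (Pi.single i 1) β (B i)) {b : ℝ}
    (hb : ∀ x ∈ U, ‖β x‖ ≤ b) (hB : ∀ i, ∀ᵐ x ∂(volume.restrict U), ‖B i x‖ ≤ b) (i : Fin 3) :
    IsWeakDeriv U (Pi.single i 1) (fun x => ⟪β x, w x⟫_ℝ)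
      (fun x => ⟪B i x, w x⟫_ℝ + ⟪β x, g i x⟫_ℝ) := by
  have hb' : ∀ᵐ x ∂(volume.restrict U), ‖β x‖ ≤ b :=
    (ae_restrict_iff' hU.measurableSet).2 (Eventually.of_forall hb)
  have hβ2 : MemLp β 2 (volume.restrict U) :=
    MemLp.of_bound (hβ 0).1.aestronglyMeasurable b hb'
  have hB2 : MemLp (B i) 2 (volume.restrict U) :=
    MemLp.of_bound (hβ i).2.1.aestronglyMeasurable b (hB i)
  have hI : ∀ {u v : E → E}, MemLp u 2 (volume.restrict U) → MemLp v 2 (volume.restrict U) →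
      LocallyIntegrableOn (fun x => ⟪u x, v x⟫_ℝ) U := fun hu hv =>
    IntegrableOn.locallyIntegrableOn (integrable_inner_of_memLp hu hv)
  refine isWeakDeriv_single_iff.2 ⟨hI hβ2 h.memLp, (hI hB2 h.memLp).add (hI hβ2 (h.memLp_deriv i)),
    fun η hη => ?_⟩
  obtain ⟨φ, hφ, h0, h1⟩ := h.exists_smooth_approx hU hUc hUn
  have hmul : ∀ {ψ : E → ℝ} {u : E → E}, IsTest U ψ → MemLp u 2 (volume.restrict U) →
      MemLp (fun x => ψ x • u x) 2 (volume.restrict U) := by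
    intro ψ u hψ hu
    obtain ⟨C, hC⟩ := hψ.2.1.exists_bound_of_continuous hψ.1.continuous
    refine MemLp.of_le_mul (c := C) hu (hψ.1.continuous.aestronglyMeasurable.smul hu.1)
      (Eventually.of_forall fun x => ?_)
    rw [norm_smul]
    exact mul_le_mul_of_nonneg_right (hC x) (norm_nonneg _)
  have hset : ∀ {ψ : E → ℝ}, IsTest U ψ → ∀ u v : E → E,
      ∫ x in U, ⟪ψ x • u x, v x⟫_ℝ = ∫ x, ⟪ψ x • u x, v x⟫_ℝ := fun hψ u v =>
    setIntegral_eq_integral_of_forall_compl_eq_zero fun x hx => by simp [hψ.eq_zero hx]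
  have l1 := tendsto_integral_inner (hmul (hη.pd i) hβ2) h.memLp
    (fun n => (hφ n).continuous.aestronglyMeasurable) h0
  have l2 := tendsto_integral_inner (hmul hη hB2) h.memLp
    (fun n => (hφ n).continuous.aestronglyMeasurable) h0
  have l3 := tendsto_integral_inner (hmul hη hβ2) (h.memLp_deriv i)
    (fun n => (contDiff_pd (hφ n) i).continuous.aestronglyMeasurable) (h1 i)
  simp only [hset (hη.pd i), hset hη] at l1 l2 l3
  have key := tendsto_nhds_unique l1 ((l2.neg.sub l3).congr fun n =>
    (integral_pd_mul_inner_smooth (hβ i) (hφ n) hη).symm)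
  simp only [real_inner_smul_left] at key
  simp only [smul_eq_mul, mul_add]
  rw [key, integral_add (hη.integrable_mul (hI hB2 h.memLp))
    (hη.integrable_mul (hI hβ2 (h.memLp_deriv i)))]
  ring

/-! ### Bounds for the advection field and the Lie derivative -/

/-- Bounds for a vector field on a tetrahedron: the values, up to the boundary, and the weak first
derivatives are at most `b` in norm. -/
structure FieldBound (T : Finset E) (β : E → E) (B : Fin 3 → E → E) (b : ℝ) : Prop where
  le : ∀ x ∈ simplex T, ‖β x‖ ≤ b
  deriv : ∀ i, IsWeakDeriv (cell T) (Pi.single i 1) β (B i)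
  deriv_le : ∀ i, ∀ᵐ x ∂(volume.restrict (cell T)), ‖B i x‖ ≤ b

/-- A continuous field is bounded on the closed tetrahedron, hence also on its facets, by its
`W^{1,∞}` norm on the open one. -/
theorem IsRegularTet.exists_fieldBound {σ : ℝ} {T : Finset E} (hT : IsRegularTet σ T) {β : E → E}
    (hβ : MemW 1 ⊤ (cell T) β) (hβc : ContinuousOn β (simplex T)) :
    ∃ B, FieldBound T β B (wInfNorm (cell T) β).toReal := by
  have hU := isOpen_cell T
  set b := (wInfNorm (cell T) β).toReal with hb
  have hsum : ∀ a ∈ multiIdx 0 ∪ multiIdx 1, ∑ i, a i ≤ 1 := by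
    intro a ha
    rw [multiIdx_zero, multiIdx_one] at ha
    rcases Finset.mem_union.1 ha with h | h
    · rw [Finset.mem_singleton.1 h]; simp
    · obtain ⟨i, -, rfl⟩ := Finset.mem_image.1 h
      simp
  have hfin : wInfNorm (cell T) β < ⊤ := by
    rw [wInfNorm, Finset.sup_lt_iff (by simp)]
    intro a ha
    obtain ⟨g, hg, hg'⟩ := hβ a (hsum a ha)
    rw [derivNorm_eq hU hg]
    exact hg'.2
  have hae : ∀ a ∈ multiIdx 0 ∪ multiIdx 1, ∀ g, IsWeakDeriv (cell T) a β g →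
      ∀ᵐ x ∂(volume.restrict (cell T)), ‖g x‖ ≤ b := by
    intro a ha g hg
    have h1 : eLpNorm g ⊤ (volume.restrict (cell T)) ≤ wInfNorm (cell T) β := by
      rw [← derivNorm_eq hU hg]
      exact Finset.le_sup (f := fun a => derivNorm ⊤ (cell T) a β) ha
    rw [eLpNorm_exponent_top] at h1
    filter_upwards [enorm_ae_le_eLpNormEssSup g (volume.restrict (cell T))] with x hx
    have h2 := ENNReal.toReal_mono hfin.ne (hx.trans h1)
    rwa [toReal_enorm] at h2
  have h0 : (0 : Fin 3 → ℕ) ∈ multiIdx 0 ∪ multiIdx 1 := by rw [multiIdx_zero]; simp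
  have h1 : ∀ i : Fin 3, (Pi.single i 1 : Fin 3 → ℕ) ∈ multiIdx 0 ∪ multiIdx 1 := fun i => by
    rw [multiIdx_one]; simp
  choose B hB hB' using fun i : Fin 3 => hβ (Pi.single i 1) (hsum _ (h1 i))
  refine ⟨B, ?_, hB, fun i => hae _ (h1 i) _ (hB i)⟩
  have hβ0 := hae 0 h0 β (isWeakDeriv_zero (hB 0).1)
  -- a continuous function that is bounded almost everywhere is bounded
  have hcell : ∀ x ∈ cell T, ‖β x‖ ≤ b := by
    by_contra hcon
    push Not at hcon
    obtain ⟨x, hx, hxb⟩ := hcon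
    have hcc : ContinuousOn (fun x => ‖β x‖) (cell T) := (hβc.mono interior_subset).norm
    have hopen : IsOpen (cell T ∩ (fun x => ‖β x‖) ⁻¹' Set.Ioi b) :=
      hcc.isOpen_inter_preimage hU isOpen_Ioi
    have hpos := hopen.measure_pos (volume : Measure E) ⟨x, hx, hxb⟩
    have hz : volume (cell T ∩ (fun x => ‖β x‖) ⁻¹' Set.Ioi b) = 0 := by
      have h2 := (ae_restrict_iff' hU.measurableSet).1 hβ0
      refine measure_mono_null ?_ (mem_ae_iff.1 h2)
      rintro y ⟨hy, hyb⟩ hcon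
      exact absurd (hcon hy) (not_le.2 hyb)
    exact hpos.ne' hz
  intro x hx
  have hx' : x ∈ closure (cell T) := by rw [hT.closure_cell]; exact hx
  have hcw : ContinuousWithinAt (fun x => ‖β x‖) (cell T) x :=
    ((hβc x hx).mono interior_subset).norm
  exact hcw.closure_le hx' continuousWithinAt_const hcell

theorem norm_le_sum_components (v : E) : ‖v‖ ≤ ∑ i, |v i| := by
  have hv : v = ∑ i, v i • (EuclideanSpace.single i (1 : ℝ) : E) := by
    ext j; simp [Finset.sum_apply, Pi.single_apply]
  conv_lhs => rw [hv]
  refine (norm_sum_le _ _).trans (Finset.sum_le_sum fun i _ => ?_)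
  simp [norm_smul]

theorem abs_component_le (v : E) (i : Fin 3) : |v i| ≤ ‖v‖ := PiLp.norm_apply_le v i

theorem norm_cross_le (a b : E) : ‖cross a b‖ ≤ 6 * (‖a‖ * ‖b‖) := by
  have h : ∀ i j k l : Fin 3, |a i * b j - a k * b l| ≤ 2 * (‖a‖ * ‖b‖) := by
    intro i j k l
    have h1 : ∀ i j : Fin 3, |a i * b j| ≤ ‖a‖ * ‖b‖ := fun i j => by
      rw [abs_mul]
      exact mul_le_mul (abs_component_le a i) (abs_component_le b j) (abs_nonneg _) (norm_nonneg _)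
    have := abs_sub (a i * b j) (a k * b l)
    linarith [h1 i j, h1 k l]
  refine (norm_le_sum_components _).trans ?_
  simp only [Fin.sum_univ_three, cross, cross_apply, Matrix.cons_val]
  linarith [h 1 2 2 1, h 2 0 0 2, h 0 1 1 0]

theorem norm_curlOf_le (g : Fin 3 → E → E) (x : E) : ‖curlOf g x‖ ≤ 2 * ∑ i, ‖g i x‖ := by
  refine (norm_le_sum_components _).trans ?_
  simp only [Fin.sum_univ_three, curlOf, Matrix.cons_val]
  have h : ∀ i j k l : Fin 3, |g i x j - g k x l| ≤ ‖g i x‖ + ‖g k x‖ := fun i j k l =>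
    (abs_sub _ _).trans (add_le_add (abs_component_le _ _) (abs_component_le _ _))
  linarith [h 1 2 2 1, h 2 0 0 2, h 0 1 1 0]

/-- The gradient of `β · w`, from the partial derivatives of `β` and `w`. -/
noncomputable def gradInner (β w : E → E) (B g : Fin 3 → E → E) (x : E) : E :=
  WithLp.toLp 2 fun i => ⟪B i x, w x⟫_ℝ + ⟪β x, g i x⟫_ℝ

theorem FieldBound.isWeakGrad {σ : ℝ} {T : Finset E} (hT : IsRegularTet σ T) {β : E → E}
    {B : Fin 3 → E → E} {b : ℝ} (hβ : FieldBound T β B b) {w : E → E} {g : Fin 3 → E → E}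
    (h : MemH1 (cell T) w g) :
    IsWeakGrad (cell T) (fun x => ⟪β x, w x⟫_ℝ) (gradInner β w B g) :=
  h.isWeakDeriv_inner (isOpen_cell T) (convex_cell T) hT.cell_nonempty hβ.deriv
    (fun x hx => hβ.le x (interior_subset hx)) hβ.deriv_le

theorem FieldBound.exists_isLie {σ : ℝ} {T : Finset E} (hT : IsRegularTet σ T) {β : E → E}
    {B : Fin 3 → E → E} {b : ℝ} (hβ : FieldBound T β B b) {w : E → E} {g : Fin 3 → E → E}
    (h : MemH1 (cell T) w g) : ∃ A, IsLie (cell T) β w A :=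
  ⟨_, _, _, h.isWeakCurl, hβ.isWeakGrad hT h, fun _ => rfl⟩

/-- The weak curl and the weak gradient in `L_β w` are unique, so they are given by the partial
derivatives. -/
theorem FieldBound.norm_isLie_le {σ : ℝ} {T : Finset E} (hT : IsRegularTet σ T) {β : E → E}
    {B : Fin 3 → E → E} {b : ℝ} (hβ : FieldBound T β B b) {w : E → E} {g : Fin 3 → E → E}
    (h : MemH1 (cell T) w g) {A : E → E} (hA : IsLie (cell T) β w A) :
    ∀ᵐ x ∂(volume.restrict (cell T)), ‖A x‖ ≤ 13 * b * (‖w x‖ + ∑ i, ‖g i x‖) := by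
  obtain ⟨c, d, hc, hd, hAe⟩ := hA
  have hU := isOpen_cell T
  have hd' := fun i => (hd i).ae_eq hU (hβ.isWeakGrad hT h i)
  filter_upwards [hc.ae_eq hU h.isWeakCurl, hd' 0, hd' 1, hd' 2, hβ.deriv_le 0, hβ.deriv_le 1,
    hβ.deriv_le 2, ae_restrict_mem hU.measurableSet] with x h1 h20 h21 h22 h30 h31 h32 hx
  have hbx := hβ.le x (interior_subset hx)
  have hb0 : 0 ≤ b := (norm_nonneg _).trans hbx
  have hB : ∀ i, ‖B i x‖ ≤ b := fun i => by fin_cases i <;> assumption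
  have hdx : d x = gradInner β w B g x := by
    ext i; fin_cases i <;> assumption
  have hS : 0 ≤ ∑ i, ‖g i x‖ := Finset.sum_nonneg fun i _ => norm_nonneg _
  have hcross : ‖cross (β x) (c x)‖ ≤ 12 * (b * ∑ i, ‖g i x‖) := by
    rw [h1]
    refine (norm_cross_le _ _).trans ?_
    calc 6 * (‖β x‖ * ‖curlOf g x‖) ≤ 6 * (b * (2 * ∑ i, ‖g i x‖)) := by
          gcongr; exact norm_curlOf_le g x
      _ = _ := by ring
  have hgrad : ‖d x‖ ≤ 3 * (b * ‖w x‖) + b * ∑ i, ‖g i x‖ := by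
    rw [hdx]
    refine (norm_le_sum_components _).trans ?_
    have : ∀ i, |gradInner β w B g x i| ≤ b * ‖w x‖ + b * ‖g i x‖ := fun i =>
      (abs_add_le _ _).trans (add_le_add
        ((abs_real_inner_le_norm _ _).trans (mul_le_mul_of_nonneg_right (hB i) (norm_nonneg _)))
        ((abs_real_inner_le_norm _ _).trans (mul_le_mul_of_nonneg_right hbx (norm_nonneg _))))
    refine (Finset.sum_le_sum fun i _ => this i).trans_eq ?_
    rw [Finset.sum_add_distrib, Finset.mul_sum]
    simp
  rw [hAe]
  calc ‖-cross (β x) (c x) + d x‖ ≤ ‖cross (β x) (c x)‖ + ‖d x‖ := by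
        rw [← norm_neg (cross (β x) (c x))]; exact norm_add_le _ _
    _ ≤ 12 * (b * ∑ i, ‖g i x‖) + (3 * (b * ‖w x‖) + b * ∑ i, ‖g i x‖) := add_le_add hcross hgrad
    _ ≤ 13 * b * (‖w x‖ + ∑ i, ‖g i x‖) := by nlinarith [mul_nonneg hb0 (norm_nonneg (w x))]

/-- The magnetic advection is bounded from `H¹` to `L²`. -/
theorem FieldBound.eLpNorm_isLie_sq_le {σ : ℝ} {T : Finset E} (hT : IsRegularTet σ T) {β : E → E}
    {B : Fin 3 → E → E} {b : ℝ} (hβ : FieldBound T β B b) {w : E → E} {g : Fin 3 → E → E}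
    (h : MemH1 (cell T) w g) {A : E → E} (hA : IsLie (cell T) β w A) :
    eLpNorm A 2 (volume.restrict (cell T)) ^ 2 ≤
      ENNReal.ofReal (1014 * b ^ 2) * hNorm 1 (cell T) w ^ 2 := by
  have hU := isOpen_cell T
  obtain ⟨y, hy⟩ := hT.cell_nonempty
  have hb0 : 0 ≤ b := (norm_nonneg _).trans (hβ.le y (interior_subset hy))
  have hmw : AEMeasurable (fun x => ‖w x‖ₑ ^ 2) (volume.restrict (cell T)) :=
    h.memLp.1.enorm.pow_const 2
  have hmg : ∀ i, AEMeasurable (fun x => ‖g i x‖ₑ ^ 2) (volume.restrict (cell T)) := fun i =>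
    (h.memLp_deriv i).1.enorm.pow_const 2
  rw [hNorm_one_sq hU h.deriv]
  simp only [eLpNorm_two_sq]
  rw [← lintegral_finsetSum' _ fun i _ => hmg i, ← lintegral_add_left' hmw,
    ← lintegral_const_mul' _ _ ENNReal.ofReal_ne_top]
  refine lintegral_mono_ae ?_
  filter_upwards [hβ.norm_isLie_le hT h hA] with x hx
  have h1 : ‖A x‖ₑ ≤ ENNReal.ofReal (13 * b) * (‖w x‖ₑ + ∑ i, ‖g i x‖ₑ) := by
    simp only [← ofReal_norm]
    rw [← ENNReal.ofReal_sum_of_nonneg fun i _ => norm_nonneg _,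
      ← ENNReal.ofReal_add (norm_nonneg _) (Finset.sum_nonneg fun i _ => norm_nonneg _),
      ← ENNReal.ofReal_mul (by positivity)]
    exact ENNReal.ofReal_le_ofReal hx
  calc ‖A x‖ₑ ^ 2 ≤ ENNReal.ofReal (13 * b) ^ 2 * (‖w x‖ₑ + ∑ i, ‖g i x‖ₑ) ^ 2 := by
        rw [← mul_pow]; exact pow_le_pow_left' h1 2
    _ ≤ ENNReal.ofReal (13 * b) ^ 2 * (6 * (‖w x‖ₑ ^ 2 + ∑ i, ‖g i x‖ₑ ^ 2)) := by
        gcongr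
        calc _ ≤ 2 * ‖w x‖ₑ ^ 2 + 2 * (∑ i, ‖g i x‖ₑ) ^ 2 := ennreal_add_sq_le _ _
          _ ≤ 2 * ‖w x‖ₑ ^ 2 + 2 * (3 * ∑ i, ‖g i x‖ₑ ^ 2) := by
            gcongr
            simpa using ennreal_sum_sq_le Finset.univ fun i => ‖g i x‖ₑ
          _ ≤ 6 * ‖w x‖ₑ ^ 2 + 6 * ∑ i, ‖g i x‖ₑ ^ 2 := by
            rw [← mul_assoc]
            gcongr <;> norm_num
          _ = _ := by rw [mul_add]
    _ = _ := by
        -- `1014 = 6 * 13 ^ 2`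
        rw [← mul_assoc, ← ENNReal.ofReal_pow (by positivity), ← ENNReal.ofReal_ofNat 6,
          ← ENNReal.ofReal_mul (by positivity)]
        congr 2
        ring

/-! ### The lifting -/

section Lifting

variable {Ω : Set E} {M : Mesh Ω} {r : ℕ} (V : FESpace M r)

theorem FESpace.isPolyField_of_mem_loc {T : Finset E} (hT : T ∈ M.cells) {u : E → E}
    (hu : u ∈ V.loc T) : IsPolyField r u := by
  obtain ⟨U, hU, rfl⟩ := hu
  exact V.poly U hU T hT

theorem FESpace.finiteDimensional_loc {T : Finset E} (hT : T ∈ M.cells) :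
    FiniteDimensional ℝ (V.loc T) := by
  have hle : V.loc T ≤ LinearMap.range (polyFieldMap r) := fun u hu =>
    (V.isPolyField_of_mem_loc hT hu).mem_range
  exact Submodule.finiteDimensional_of_le hle

theorem memLp_of_continuous {μ : Measure E} [IsFiniteMeasure μ] {K : Set E} (hK : IsCompact K)
    (hμ : ∀ᵐ x ∂μ, x ∈ K) {u : E → E} (hu : Continuous u) : MemLp u 2 μ := by
  obtain ⟨C, hC⟩ := hK.exists_bound_of_continuousOn hu.continuousOn
  exact MemLp.of_bound hu.aestronglyMeasurable C (hμ.mono fun x hx => hC x hx)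

theorem memLp_cell_of_continuous (T : Finset E) {u : E → E} (hu : Continuous u) :
    MemLp u 2 (volume.restrict (cell T)) :=
  memLp_of_continuous (isCompact_simplex T)
    ((ae_restrict_mem (isOpen_cell T).measurableSet).mono fun _ hx => interior_subset hx) hu

theorem ae_surf_mem (F : Finset E) : ∀ᵐ x ∂(surf F), x ∈ simplex F :=
  ae_restrict_mem (isCompact_simplex F).isClosed.measurableSet

/-- Stability of the lifting: test with the lifting itself, and apply the discrete trace
inequality. -/
theorem FESpace.IsLifting.eLpNorm_sq_le {σ : ℝ} {T : Finset E} (hT : IsRegularTet σ T)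
    (hTM : T ∈ M.cells) {α : Finset E → Finset E → E → ℝ} {c : ℝ}
    (hα : ∀ F ∈ facetsOf T, ∀ x ∈ simplex F, |α T F x| ≤ c) {g : Finset E → E → E}
    (hg : ∀ F ∈ facetsOf T, MemLp (g F) 2 (surf F)) {R : E → E} (hR : V.IsLifting α T g R) :
    eLpNorm R 2 (volume.restrict (cell T)) ^ 2 ≤
      4 * (ENNReal.ofReal c ^ 2 * (polyTraceConst r σ (diamT T) *
        ∑ F ∈ facetsOf T, eLpNorm (g F) 2 (surf F) ^ 2)) := by
  have hpoly := V.isPolyField_of_mem_loc hTM hR.1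
  set N := eLpNorm R 2 (volume.restrict (cell T)) with hN
  have hNfin : N ≠ ⊤ := (memLp_cell_of_continuous T hpoly.continuous).2.ne
  set κ := polyTraceConst r σ (diamT T) with hκ
  have h1 : N ^ 2 ≤ ∑ F ∈ facetsOf T, ENNReal.ofReal c *
      (eLpNorm (g F) 2 (surf F) * eLpNorm R 2 (surf F)) := by
    have h2 : ENNReal.ofReal (∫ x in cell T, ⟪R x, R x⟫_ℝ) = N ^ 2 := by
      rw [hN, eLpNorm_two_sq, ofReal_integral_eq_lintegral_ofReal
        (integrable_inner_of_memLp (memLp_cell_of_continuous T hpoly.continuous)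
          (memLp_cell_of_continuous T hpoly.continuous))
        (Eventually.of_forall fun x => real_inner_self_nonneg)]
      refine lintegral_congr fun x => ?_
      rw [real_inner_self_eq_norm_sq, ENNReal.ofReal_pow (norm_nonneg _), ofReal_norm]
    rw [← h2, hR.2 R hR.1]
    have habs : ∀ s : ℝ, ENNReal.ofReal s ≤ ‖s‖ₑ := fun s => by
      rw [← ofReal_norm]; exact ENNReal.ofReal_le_ofReal (le_abs_self _)
    refine (habs _).trans ((enorm_sum_le _ _).trans (Finset.sum_le_sum fun F hF => ?_))
    calc ‖∫ x, α T F x * ⟪g F x, R x⟫_ℝ ∂(surf F)‖ₑ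
        ≤ ∫⁻ x, ‖α T F x * ⟪g F x, R x⟫_ℝ‖ₑ ∂(surf F) := enorm_integral_le_lintegral_enorm _
      _ ≤ ∫⁻ x, ENNReal.ofReal c * (‖g F x‖ₑ * ‖R x‖ₑ) ∂(surf F) := by
          refine lintegral_mono_ae ((ae_surf_mem F).mono fun x hx => ?_)
          rw [enorm_mul]
          refine mul_le_mul' ?_ ?_
          · rw [← ofReal_norm]; exact ENNReal.ofReal_le_ofReal (hα F hF x hx)
          · rw [← ofReal_norm, ← ofReal_norm, ← ofReal_norm, ← ENNReal.ofReal_mul (norm_nonneg _)]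
            exact ENNReal.ofReal_le_ofReal (norm_inner_le_norm _ _)
      _ ≤ _ := by
          rw [lintegral_const_mul' _ _ ENNReal.ofReal_ne_top]
          gcongr
          exact lintegral_enorm_mul_le (hg F hF).1 hpoly.continuous.aestronglyMeasurable
  have h3 : (N ^ 2) ^ 2 ≤ 4 * (ENNReal.ofReal c ^ 2 * (κ *
      ∑ F ∈ facetsOf T, eLpNorm (g F) 2 (surf F) ^ 2)) * N ^ 2 := by
    have hcard : (facetsOf T).card = 4 := by
      rw [facetsOf, Finset.card_powersetCard, hT.card_eq]; rfl
    calc (N ^ 2) ^ 2 ≤ _ := pow_le_pow_left' h1 2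
      _ ≤ 4 * ∑ F ∈ facetsOf T, (ENNReal.ofReal c *
          (eLpNorm (g F) 2 (surf F) * eLpNorm R 2 (surf F))) ^ 2 := by
        have := ennreal_sum_sq_le (facetsOf T) fun F => ENNReal.ofReal c *
          (eLpNorm (g F) 2 (surf F) * eLpNorm R 2 (surf F))
        rwa [hcard] at this
      _ ≤ 4 * ∑ F ∈ facetsOf T, (ENNReal.ofReal c ^ 2 *
          (eLpNorm (g F) 2 (surf F) ^ 2 * (κ * N ^ 2))) := by
        gcongr with F hF
        rw [mul_pow, mul_pow]
        gcongr
        exact hT.eLpNorm_surf_polyField_sq_le hF hpoly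
      _ = _ := by
        rw [← Finset.mul_sum, ← Finset.sum_mul]; ring
  -- cancel the factor `N ^ 2`
  rcases eq_or_ne N 0 with h0 | h0
  · rw [h0]; simp
  · rw [sq (N ^ 2)] at h3
    exact (ENNReal.mul_le_mul_iff_left (pow_ne_zero 2 h0) (ENNReal.pow_ne_top hNfin)).1 h3

/-- The lifting exists: on polynomial fields the `L²` inner product of the cell is non-degenerate,
and the local space is finite-dimensional. -/
theorem FESpace.exists_isLifting {σ : ℝ} {T : Finset E} (hT : IsRegularTet σ T)
    (hTM : T ∈ M.cells) {α : Finset E → Finset E → E → ℝ} {c : ℝ}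
    (hαm : ∀ F ∈ facetsOf T, AEStronglyMeasurable (α T F) (surf F))
    (hα : ∀ F ∈ facetsOf T, ∀ x ∈ simplex F, |α T F x| ≤ c) {g : Finset E → E → E}
    (hg : ∀ F ∈ facetsOf T, MemLp (g F) 2 (surf F)) : ∃ R, V.IsLifting α T g R := by
  have hfd := V.finiteDimensional_loc hTM
  have hcont : ∀ w : V.loc T, Continuous (w : E → E) := fun w =>
    (V.isPolyField_of_mem_loc hTM w.2).continuous
  have hcell : ∀ w : V.loc T, MemLp (w : E → E) 2 (volume.restrict (cell T)) := fun w =>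
    memLp_cell_of_continuous T (hcont w)
  have hint : ∀ u w : V.loc T, Integrable (fun x => ⟪(u : E → E) x, (w : E → E) x⟫_ℝ)
      (volume.restrict (cell T)) := fun u w => integrable_inner_of_memLp (hcell u) (hcell w)
  have hsurf : ∀ F ∈ facetsOf T, ∀ w : V.loc T,
      Integrable (fun x => α T F x * ⟪g F x, (w : E → E) x⟫_ℝ) (surf F) := by
    intro F hF w
    have := hT.isFiniteMeasure_surf hF
    have h1 := integrable_inner_of_memLp (hg F hF)
      (memLp_of_continuous (isCompact_simplex F) (ae_surf_mem F) (hcont w))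
    exact h1.bdd_mul (hαm F hF) ((ae_surf_mem F).mono fun x hx => by
      simpa using hα F hF x hx)
  -- the `L²` inner product on the local space, and the functional to be represented
  let Bf : V.loc T →ₗ[ℝ] V.loc T →ₗ[ℝ] ℝ := LinearMap.mk₂ ℝ
    (fun u w => ∫ x in cell T, ⟪(u : E → E) x, (w : E → E) x⟫_ℝ)
    (fun u u' w => by
      rw [← integral_add (hint u w) (hint u' w)]
      exact integral_congr_ae (Eventually.of_forall fun x => by simp [inner_add_left]))
    (fun s u w => by
      rw [smul_eq_mul, ← integral_const_mul]
      exact integral_congr_ae (Eventually.of_forall fun x => by simp [real_inner_smul_left]))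
    (fun u w w' => by
      rw [← integral_add (hint u w) (hint u w')]
      exact integral_congr_ae (Eventually.of_forall fun x => by simp [inner_add_right]))
    (fun s u w => by
      rw [smul_eq_mul, ← integral_const_mul]
      exact integral_congr_ae (Eventually.of_forall fun x => by simp [real_inner_smul_right]))
  let ℓ : V.loc T →ₗ[ℝ] ℝ :=
    { toFun := fun w => ∑ F ∈ facetsOf T, ∫ x, α T F x * ⟪g F x, (w : E → E) x⟫_ℝ ∂(surf F)
      map_add' := fun w w' => by
        rw [← Finset.sum_add_distrib]
        refine Finset.sum_congr rfl fun F hF => ?_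
        rw [← integral_add (hsurf F hF w) (hsurf F hF w')]
        exact integral_congr_ae (Eventually.of_forall fun x => by simp [inner_add_right, mul_add])
      map_smul' := fun s w => by
        rw [RingHom.id_apply, smul_eq_mul, Finset.mul_sum]
        refine Finset.sum_congr rfl fun F hF => ?_
        rw [← integral_const_mul]
        exact integral_congr_ae (Eventually.of_forall fun x => by
          simp [real_inner_smul_right]; ring) }
  have hinj : Function.Injective Bf := by
    rw [injective_iff_map_eq_zero]
    intro u hu
    have h1 : ∫ x in cell T, ⟪(u : E → E) x, (u : E → E) x⟫_ℝ = 0 := by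
      have := congrArg (fun f => f u) hu
      simpa [Bf] using this
    have hzero : ∀ x ∈ cell T, (u : E → E) x = 0 := by
      have h2 := (integral_eq_zero_iff_of_nonneg (fun x => real_inner_self_nonneg) (hint u u)).1 h1
      have h3 : (u : E → E) =ᵐ[volume.restrict (cell T)] 0 := by
        filter_upwards [h2] with x hx using inner_self_eq_zero.1 hx
      exact Measure.eqOn_open_of_ae_eq h3 (isOpen_cell T) (hcont u).continuousOn continuousOn_const
    exact Subtype.ext ((V.isPolyField_of_mem_loc hTM u.2).eq_zero (isOpen_cell T)
      hT.cell_nonempty hzero)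
  have hsurj : Function.Surjective Bf :=
    (LinearMap.injective_iff_surjective_of_finrank_eq_finrank
      (by rw [Subspace.dual_finrank_eq])).1 hinj
  obtain ⟨R, hR⟩ := hsurj ℓ
  exact ⟨R, R.2, fun w hw => congrArg (fun f => f ⟨w, hw⟩) hR⟩

end Lifting

/-! ### Fields with the approximation property -/

theorem hSemi_lt_top {s : ℕ} {U : Set E} (hU : IsOpen U) {v : E → E} (hv : MemW s 2 U v) :
    hSemi s U v < ⊤ := by
  refine lt_top_iff_ne_top.2 fun h => ?_
  have h1 : hSemi s U v ^ 2 < ⊤ := by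
    rw [hSemi_sq, ENNReal.sum_lt_top]
    intro a ha
    obtain ⟨g, hg, hg'⟩ := hv a (by
      rw [multiIdx, Finset.mem_piAntidiag] at ha; exact ha.1.le)
    rw [derivNorm_eq hU hg]
    exact ENNReal.pow_lt_top hg'.2
  simp [h] at h1

theorem MemW.mono {s : ℕ} {p : ℝ≥0∞} {U U' : Set E} {v : E → E} (hv : MemW s p U' v)
    (h : U ⊆ U') : MemW s p U v := fun a ha => by
  obtain ⟨g, hg, hg'⟩ := hv a ha
  exact ⟨g, hg.mono h, hg'.mono_measure (Measure.restrict_mono h le_rfl)⟩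

/-- The approximation property of order `k` for the error `w` on the tetrahedron `T`, in the norms
of `L²` and `H¹`; `S` stands for the semi-norm `|v|_{k+1,T}` of the approximated field. -/
structure ErrorBound (k : ℕ) (c : ℝ) (T : Finset E) (w : E → E) (S : ℝ≥0∞) : Prop where
  nonneg : 0 ≤ c
  lt_top : S < ⊤
  zero : hNorm 0 (cell T) w ≤ ENNReal.ofReal (c * diamT T ^ (k + 1)) * S
  one : hNorm 1 (cell T) w ≤ ENNReal.ofReal (c * diamT T ^ k) * S

theorem ErrorBound.exists_memH1 {k : ℕ} {c : ℝ} {T : Finset E} {w : E → E} {S : ℝ≥0∞}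
    (h : ErrorBound k c T w S) : ∃ g, MemH1 (cell T) w g :=
  exists_memH1_of_hNorm_lt_top (isOpen_cell T)
    (h.one.trans_lt (ENNReal.mul_lt_top ENNReal.ofReal_lt_top h.lt_top))

theorem ErrorBound.hNorm_one_sq_le {k : ℕ} {c : ℝ} {T : Finset E} {w : E → E} {S : ℝ≥0∞}
    (h : ErrorBound k c T w S) (hd : 0 ≤ diamT T) :
    hNorm 1 (cell T) w ^ 2 ≤ ENNReal.ofReal (c ^ 2 * diamT T ^ (2 * k)) * S ^ 2 := by
  have hc := h.nonneg
  refine (pow_le_pow_left' h.one 2).trans_eq ?_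
  rw [mul_pow, ← ENNReal.ofReal_pow (by positivity)]
  congr 2
  ring

/-- The constant of the trace estimate for the error: twice that of `traceConst`, for the two terms
of `scaledSq`. -/
noncomputable def errorTraceConst (σ c : ℝ) : ℝ := 36 * facetConst.toReal * |σ| ^ 3 * c ^ 2

theorem errorTraceConst_nonneg (σ c : ℝ) : 0 ≤ errorTraceConst σ c := by
  have : 0 ≤ facetConst.toReal := ENNReal.toReal_nonneg
  rw [errorTraceConst]; positivity

/-- The trace inequality for the error: the power `h_T^(2k+2)` of the scaled `H¹` norm loses one
factor `h_T` on the boundary. -/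
theorem ErrorBound.trace_sq_le {σ : ℝ} {k : ℕ} {c : ℝ} {T F : Finset E} {w tr : E → E} {S : ℝ≥0∞}
    (h : ErrorBound k c T w S) (hT : IsRegularTet σ T) (hF : F ∈ facetsOf T)
    (htr : IsTrace T w tr) :
    eLpNorm tr 2 (surf F) ^ 2 ≤
      ENNReal.ofReal (errorTraceConst σ c * diamT T ^ (2 * k + 1)) * S ^ 2 := by
  have hc := h.nonneg
  have hd := hT.diamT_pos
  have hU := isOpen_cell T
  obtain ⟨g, hg⟩ := h.exists_memH1
  refine (htr.eLpNorm_sq_le hT hF hg).trans ?_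
  have h0 : eLpNorm w 2 (volume.restrict (cell T)) ^ 2 ≤
      ENNReal.ofReal (c ^ 2 * diamT T ^ (2 * k + 2)) * S ^ 2 := by
    rw [← hNorm_zero_sq hU (hg.deriv 0).1]
    refine (pow_le_pow_left' h.zero 2).trans_eq ?_
    rw [mul_pow, ← ENNReal.ofReal_pow (by positivity)]
    congr 2
    ring
  have h1 : ∑ i, eLpNorm (g i) 2 (volume.restrict (cell T)) ^ 2 ≤
      ENNReal.ofReal (c ^ 2 * diamT T ^ (2 * k)) * S ^ 2 := by
    refine le_trans ?_ (h.hNorm_one_sq_le hd.le)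
    rw [hNorm_one_sq hU hg.deriv]
    exact le_add_self
  have h2 : scaledSq T w g ≤ ENNReal.ofReal (2 * c ^ 2 * diamT T ^ (2 * k + 2)) * S ^ 2 := by
    calc scaledSq T w g ≤ ENNReal.ofReal (c ^ 2 * diamT T ^ (2 * k + 2)) * S ^ 2 +
          ENNReal.ofReal (diamT T) ^ 2 * (ENNReal.ofReal (c ^ 2 * diamT T ^ (2 * k)) * S ^ 2) := by
          rw [scaledSq]; gcongr
      _ = _ := by
          rw [← mul_assoc, ← add_mul, ← ENNReal.ofReal_pow hd.le,
            ← ENNReal.ofReal_mul (by positivity),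
            ← ENNReal.ofReal_add (by positivity) (by positivity)]
          congr 2
          ring
  have h3 : traceConst σ (diamT T) =
      ENNReal.ofReal (18 * facetConst.toReal * (|σ| ^ 3 / diamT T)) := by
    rw [traceConst, ENNReal.ofReal_mul (by positivity), ENNReal.ofReal_mul (by norm_num),
      ENNReal.ofReal_toReal facetConst_ne_top, abs_of_pos hT.sigma_pos, ENNReal.ofReal_ofNat]
  rw [h3]
  refine (mul_le_mul_right h2 _).trans_eq ?_
  rw [← mul_assoc, ← ENNReal.ofReal_mul (by positivity)]
  congr 2
  rw [errorTraceConst]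
  field_simp
  ring

/-- Only an inequality, since the formula for the normal gives `0` for a degenerate tetrahedron. -/
theorem norm_normal_le (T F : Finset E) : ‖normal T F‖ ≤ 1 := by
  rw [normal, norm_smul, norm_inv, norm_norm]
  exact inv_mul_le_one

theorem FieldBound.abs_inner_normal_le {T' F : Finset E} {β : E → E} {B : Fin 3 → E → E} {b : ℝ}
    (hβ : FieldBound T' β B b) (T : Finset E) (hF : F ∈ facetsOf T') {x : E} (hx : x ∈ simplex F) :
    |⟪β x, normal T F⟫_ℝ| ≤ b := by
  have h1 := hβ.le x (simplex_facet_subset hF hx)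
  calc |⟪β x, normal T F⟫_ℝ| ≤ ‖β x‖ * ‖normal T F‖ := abs_real_inner_le_norm _ _
    _ ≤ b * 1 := mul_le_mul h1 (norm_normal_le T F) (norm_nonneg _) ((norm_nonneg _).trans h1)
    _ = b := mul_one b

/-! ### Sums over facets and their sides -/

section Assembly

variable {Ω : Set E} {M : Mesh Ω}

theorem sum_facets_sides (f : Finset E → Finset E → ℝ≥0∞) :
    ∑ F ∈ M.facets, ∑ T ∈ M.sides F, f F T = ∑ T ∈ M.cells, ∑ F ∈ facetsOf T, f F T := by
  refine Finset.sum_comm' fun F T => ?_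
  simp only [Mesh.facets, Finset.mem_biUnion, mem_sides]
  constructor
  · rintro ⟨⟨T', hT', hF⟩, hT, hFT⟩
    exact ⟨Finset.mem_powersetCard.2 ⟨hFT, (Finset.mem_powersetCard.1 hF).2⟩, hT⟩
  · rintro ⟨hF, hT⟩
    exact ⟨⟨T, hT, hF⟩, hT, (Finset.mem_powersetCard.1 hF).1⟩

theorem card_facetsOf {T : Finset E} (hT : T ∈ M.cells) : (facetsOf T).card = 4 := by
  rw [facetsOf, Finset.card_powersetCard, M.card_eq T hT]; rfl

/-- Reassignment of the contributions of the neighbours: in the sum on the left, each element occurs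
at most twice for each of its four facets. -/
theorem sum_neighbours_le (X : Finset E → ℝ≥0∞) :
    ∑ T ∈ M.cells, ∑ F ∈ facetsOf T, ∑ T' ∈ M.sides F, X T' ≤ 8 * ∑ T ∈ M.cells, X T := by
  rw [← sum_facets_sides fun F _ => ∑ T' ∈ M.sides F, X T']
  calc ∑ F ∈ M.facets, ∑ _T ∈ M.sides F, ∑ T' ∈ M.sides F, X T'
      ≤ ∑ F ∈ M.facets, 2 * ∑ T' ∈ M.sides F, X T' := by
        refine Finset.sum_le_sum fun F hF => ?_
        rw [Finset.sum_const, nsmul_eq_mul]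
        gcongr
        simp only [Mesh.facets, Finset.mem_biUnion] at hF
        obtain ⟨T, -, hFT⟩ := hF
        exact_mod_cast card_sides_le_two (Finset.mem_powersetCard.1 hFT).2
    _ = 2 * ∑ T ∈ M.cells, ∑ _F ∈ facetsOf T, X T := by
        rw [← Finset.mul_sum, sum_facets_sides fun _ T => X T]
    _ = 2 * ∑ T ∈ M.cells, 4 * X T := by
        congr 1
        refine Finset.sum_congr rfl fun T hT => ?_
        rw [Finset.sum_const, card_facetsOf hT, nsmul_eq_mul]; rfl
    _ = 8 * ∑ T ∈ M.cells, X T := by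
        rw [← Finset.mul_sum, ← mul_assoc]; norm_num

/-- The values of a weight are bounded, also on the boundary of the domain. -/
theorem Mesh.IsWeight.abs_le {β : E → E} {Cα : ℝ} {α : Finset E → Finset E → E → ℝ}
    (hα : M.IsWeight β Cα α) {T F : Finset E} (hT : T ∈ M.cells) (hF : F ∈ facetsOf T) {x : E}
    (hx : x ∈ simplex F) : |α T F x| ≤ 1 + |Cα| := by
  by_cases h : M.sides F = {T}
  · have h0 : 0 ≤ |Cα| := abs_nonneg _
    rcases lt_or_ge ⟪β x, normal T F⟫_ℝ 0 with h1 | h1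
    · rw [hα.inflow T hT F hF h x hx h1, abs_one]; linarith
    · rw [hα.outflow T hT F hF h x hx h1, abs_zero]; linarith
  · obtain ⟨T', hT', hne⟩ : ∃ T' ∈ M.sides F, T' ≠ T := by
      by_contra hcon
      push Not at hcon
      exact h (Finset.eq_singleton_iff_unique_mem.2 ⟨mem_sides_of_mem_facetsOf hT hF, hcon⟩)
    have h1 := (hα.interior T hT T' (mem_sides.1 hT').1 hne.symm F hF
      (mem_facetsOf_of_mem_sides hF hT') x hx).2
    linarith [le_abs_self Cα]

/-- The factor is the number of sides of a facet. -/
theorem enorm_jump_sq_le {tr : Finset E → E → E} {T F : Finset E} (hT : T ∈ M.cells)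
    (hF : F ∈ facetsOf T) (x : E) :
    ‖M.jump tr T F x‖ₑ ^ 2 ≤ 2 * ∑ T' ∈ M.sides F, ‖tr T' x‖ₑ ^ 2 := by
  classical
  have h1 : ‖M.jump tr T F x‖ₑ ≤ ∑ T' ∈ M.sides F, ‖tr T' x‖ₑ := by
    rw [← Finset.add_sum_erase _ _ (mem_sides_of_mem_facetsOf hT hF), Mesh.jump]
    refine (enorm_sub_le).trans (add_le_add le_rfl ?_)
    convert enorm_sum_le ((M.sides F).erase T) fun T' => tr T' x
  refine (pow_le_pow_left' h1 2).trans ((ennreal_sum_sq_le _ _).trans ?_)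
  gcongr
  exact_mod_cast card_sides_le_two (Finset.mem_powersetCard.1 hF).2

theorem aestronglyMeasurable_inner_normal {β : E → E} (hβ : ContinuousOn β (closure Ω))
    {T F : Finset E} (hT : T ∈ M.cells) (hF : F ∈ facetsOf T) :
    AEStronglyMeasurable (fun x => ⟪β x, normal T F⟫_ℝ) (surf F) := by
  have h1 : ContinuousOn (fun x => ⟪β x, normal T F⟫_ℝ) (simplex F) :=
    (hβ.mono ((simplex_facet_subset hF).trans (simplex_subset hT))).inner continuousOn_const
  exact h1.aestronglyMeasurable (isCompact_simplex F).isClosed.measurableSet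

theorem memLp_normal_jump {β : E → E} (hβ : ContinuousOn β (closure Ω)) {tr : Finset E → E → E}
    (htr : ∀ T ∈ M.cells, ∀ F ∈ facetsOf T, MemLp (tr T) 2 (surf F)) {T F : Finset E}
    (hT : T ∈ M.cells) (hF : F ∈ facetsOf T) {B : Fin 3 → E → E} {b : ℝ}
    (hb : FieldBound T β B b) :
    MemLp (fun x => ⟪β x, normal T F⟫_ℝ • M.jump tr T F x) 2 (surf F) := by
  classical
  have hside : ∀ T' ∈ M.sides F, MemLp (tr T') 2 (surf F) := fun T' hT' =>
    htr T' (mem_sides.1 hT').1 F (mem_facetsOf_of_mem_sides hF hT')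
  have hj : MemLp (M.jump tr T F) 2 (surf F) := by
    refine (htr T hT F hF).sub ?_
    convert! memLp_finsetSum ((M.sides F).erase T) (f := fun T' => tr T') fun T' hT' =>
      hside T' (Finset.mem_of_mem_erase hT') using 1
  refine MemLp.of_le_mul (c := b) hj ((aestronglyMeasurable_inner_normal hβ hT hF).smul hj.1)
    ((ae_surf_mem F).mono fun x hx => ?_)
  rw [norm_smul]
  exact mul_le_mul_of_nonneg_right (hb.abs_inner_normal_le T hF hx) (norm_nonneg _)

/-- The flux of the jump on a facet, bounded by the traces from both sides; the advection field is
bounded on each side by its bound in the element there. -/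
theorem eLpNorm_normal_jump_sq_le {σ c : ℝ} {k : ℕ} (hM : M.ShapeRegular σ) {β : E → E}
    {B : Finset E → Fin 3 → E → E} {b : Finset E → ℝ}
    (hb : ∀ T ∈ M.cells, FieldBound T β (B T) (b T)) {w tr : Finset E → E → E}
    {S : Finset E → ℝ≥0∞} (hw : ∀ T ∈ M.cells, ErrorBound k c T (w T) (S T))
    (htr : ∀ T ∈ M.cells, IsTrace T (w T) (tr T)) {T F : Finset E}
    (hT : T ∈ M.cells) (hF : F ∈ facetsOf T) :
    eLpNorm (fun x => ⟪β x, normal T F⟫_ℝ • M.jump tr T F x) 2 (surf F) ^ 2 ≤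
      ∑ T' ∈ M.sides F, ENNReal.ofReal
        (2 * b T' ^ 2 * (errorTraceConst σ c * diamT T' ^ (2 * k + 1))) * S T' ^ 2 := by
  have hside : ∀ T' ∈ M.sides F, T' ∈ M.cells ∧ F ∈ facetsOf T' := fun T' hT' =>
    ⟨(mem_sides.1 hT').1, mem_facetsOf_of_mem_sides hF hT'⟩
  rw [eLpNorm_two_sq]
  calc ∫⁻ x, ‖⟪β x, normal T F⟫_ℝ • M.jump tr T F x‖ₑ ^ 2 ∂(surf F)
      ≤ ∫⁻ x, ∑ T' ∈ M.sides F, ENNReal.ofReal (2 * b T' ^ 2) * ‖tr T' x‖ₑ ^ 2 ∂(surf F) := by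
        refine lintegral_mono_ae ((ae_surf_mem F).mono fun x hx => ?_)
        rw [enorm_smul, mul_pow]
        refine (mul_le_mul_right (enorm_jump_sq_le hT hF x) _).trans ?_
        rw [← mul_assoc, Finset.mul_sum]
        refine Finset.sum_le_sum fun T' hT' => ?_
        obtain ⟨hc', hF'⟩ := hside T' hT'
        have h1 := (hb T' hc').abs_inner_normal_le T hF' hx
        gcongr
        rw [mul_comm, ENNReal.ofReal_mul (by norm_num), ENNReal.ofReal_ofNat,
          ENNReal.ofReal_pow ((abs_nonneg _).trans h1), ← ofReal_norm]
        gcongr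
        exact h1
    _ = ∑ T' ∈ M.sides F, ENNReal.ofReal (2 * b T' ^ 2) * eLpNorm (tr T') 2 (surf F) ^ 2 := by
        have hmeas : ∀ T' ∈ M.sides F, AEMeasurable (fun x => ‖tr T' x‖ₑ ^ 2) (surf F) :=
          fun T' hT' => ((htr T' (hside T' hT').1).1 F (hside T' hT').2).1.enorm.pow_const 2
        rw [lintegral_finsetSum' _ fun T' hT' => (hmeas T' hT').const_mul _]
        refine Finset.sum_congr rfl fun T' hT' => ?_
        rw [lintegral_const_mul' _ _ ENNReal.ofReal_ne_top, eLpNorm_two_sq]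
    _ ≤ _ := by
        refine Finset.sum_le_sum fun T' hT' => ?_
        obtain ⟨hc', hF'⟩ := hside T' hT'
        rw [ENNReal.ofReal_mul (p := 2 * b T' ^ 2) (by positivity), mul_assoc]
        exact mul_le_mul_right
          ((hw T' hc').trace_sq_le (hM.isRegularTet hc') hF' (htr T' hc')) _

/-- The first inequality: the upwind facet norms of the error. -/
theorem sum_facets_le {σ c : ℝ} {k : ℕ} (hM : M.ShapeRegular σ) {β : E → E}
    {B : Finset E → Fin 3 → E → E} {b : Finset E → ℝ}
    (hb : ∀ T ∈ M.cells, FieldBound T β (B T) (b T)) (hb0 : ∀ T, 0 ≤ b T)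
    {w tr : Finset E → E → E}
    {S : Finset E → ℝ≥0∞} (hw : ∀ T ∈ M.cells, ErrorBound k c T (w T) (S T))
    (htr : ∀ T ∈ M.cells, IsTrace T (w T) (tr T)) :
    ∑ F ∈ M.facets, ∑ T ∈ M.sides F,
        ∫⁻ x, ENNReal.ofReal |⟪β x, normal T F⟫_ℝ| * ‖tr T x‖ₑ ^ 2 ∂(surf F) ≤
      ∑ T ∈ M.cells, ENNReal.ofReal (4 * errorTraceConst σ c * b T * diamT T ^ (2 * k + 1)) *
        S T ^ 2 := by
  rw [sum_facets_sides fun F T =>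
    ∫⁻ x, ENNReal.ofReal |⟪β x, normal T F⟫_ℝ| * ‖tr T x‖ₑ ^ 2 ∂(surf F)]
  refine Finset.sum_le_sum fun T hT => ?_
  have hE := errorTraceConst_nonneg σ c
  have hd := (hM.isRegularTet hT).diamT_pos
  have h1 : ∀ F ∈ facetsOf T,
      ∫⁻ x, ENNReal.ofReal |⟪β x, normal T F⟫_ℝ| * ‖tr T x‖ₑ ^ 2 ∂(surf F) ≤
        ENNReal.ofReal (b T) *
          (ENNReal.ofReal (errorTraceConst σ c * diamT T ^ (2 * k + 1)) * S T ^ 2) := by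
    intro F hF
    refine le_trans ?_ (mul_le_mul_right
      ((hw T hT).trace_sq_le (hM.isRegularTet hT) hF (htr T hT)) _)
    rw [eLpNorm_two_sq, ← lintegral_const_mul' _ _ ENNReal.ofReal_ne_top]
    refine lintegral_mono_ae ((ae_surf_mem F).mono fun x hx => ?_)
    gcongr
    exact (hb T hT).abs_inner_normal_le T hF hx
  refine (Finset.sum_le_card_nsmul _ _ _ h1).trans_eq ?_
  rw [card_facetsOf hT, nsmul_eq_mul, ← mul_assoc, ← mul_assoc, Nat.cast_ofNat,
    ← ENNReal.ofReal_ofNat 4, ← ENNReal.ofReal_mul (by norm_num),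
    ← ENNReal.ofReal_mul (mul_nonneg (by norm_num) (hb0 T))]
  congr 2
  ring

/-- The constant of the estimate for the lifting; the factor `8` comes from the four facets of an
element and the two sides of each facet. -/
noncomputable def liftingConst (r : ℕ) (σ c cα Cδ : ℝ) : ℝ :=
  8 * cα ^ 2 * facetConst.toReal * |σ| ^ 4 * polyConst r * errorTraceConst σ c * |Cδ|

theorem liftingConst_nonneg (r : ℕ) (σ c cα Cδ : ℝ) : 0 ≤ liftingConst r σ c cα Cδ := by
  have h1 : 0 ≤ facetConst.toReal := ENNReal.toReal_nonneg
  have h2 := (polyConst_pos r).le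
  have h3 := errorTraceConst_nonneg σ c
  rw [liftingConst]; positivity

/-- The lifting of the jumps on one element, weighted with the stabilization parameter, in terms of
the neighbours. -/
theorem lifting_sq_le {r : ℕ} (V : FESpace M r) {σ c cα Cδ : ℝ} {k : ℕ} (hM : M.ShapeRegular σ)
    {β : E → E} (hβ : ContinuousOn β (closure Ω)) {B : Finset E → Fin 3 → E → E} {b : Finset E → ℝ}
    (hb : ∀ T ∈ M.cells, FieldBound T β (B T) (b T)) {w tr : Finset E → E → E}
    {S : Finset E → ℝ≥0∞} (hw : ∀ T ∈ M.cells, ErrorBound k c T (w T) (S T))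
    (htr : ∀ T ∈ M.cells, IsTrace T (w T) (tr T)) {α : Finset E → Finset E → E → ℝ}
    (hα : ∀ T ∈ M.cells, ∀ F ∈ facetsOf T, ∀ x ∈ simplex F, |α T F x| ≤ cα) (hcα : 0 ≤ cα)
    {δ : Finset E → ℝ} (hδ : ∀ T ∈ M.cells, 0 < δ T) (hδC : ∀ T ∈ M.cells, ∀ T' ∈ M.cells,
      (simplex T ∩ simplex T').Nonempty → δ T' ≤ Cδ * δ T)
    {T : Finset E} (hT : T ∈ M.cells) {R : E → E}
    (hR : V.IsLifting α T (fun F x => ⟪β x, normal T F⟫_ℝ • M.jump tr T F x) R) :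
    ENNReal.ofReal (δ T) * eLpNorm R 2 (volume.restrict (cell T)) ^ 2 ≤
      ∑ F ∈ facetsOf T, ∑ T' ∈ M.sides F, ENNReal.ofReal
        (liftingConst r σ c cα Cδ * b T' ^ 2 * δ T' * diamT T' ^ (2 * k)) * S T' ^ 2 := by
  have hreg := hM.isRegularTet hT
  have hd := hreg.diamT_pos
  have hσ := hreg.sigma_pos
  have hfc : 0 ≤ facetConst.toReal := ENNReal.toReal_nonneg
  have hpc := (polyConst_pos r).le
  have hE := errorTraceConst_nonneg σ c
  have hδT := hδ T hT
  have h1 := FESpace.IsLifting.eLpNorm_sq_le V hreg hT (hα T hT)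
    (fun F hF => memLp_normal_jump hβ (fun T hT => (htr T hT).1) hT hF (hb T hT)) hR
  have hκ : polyTraceConst r σ (diamT T) =
      ENNReal.ofReal (facetConst.toReal * (σ ^ 3 / diamT T) * polyConst r) := by
    rw [polyTraceConst, ENNReal.ofReal_mul (by positivity), ENNReal.ofReal_mul hfc,
      ENNReal.ofReal_toReal facetConst_ne_top]
  have hco : ENNReal.ofReal (δ T) * (4 * (ENNReal.ofReal cα ^ 2 * polyTraceConst r σ (diamT T))) =
      ENNReal.ofReal (δ T * (4 * (cα ^ 2 * (facetConst.toReal * (σ ^ 3 / diamT T) *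
        polyConst r)))) := by
    rw [ENNReal.ofReal_mul hδT.le, ENNReal.ofReal_mul (p := 4) (by norm_num),
      ENNReal.ofReal_mul (sq_nonneg cα), ENNReal.ofReal_pow hcα, ENNReal.ofReal_ofNat, hκ]
  calc ENNReal.ofReal (δ T) * eLpNorm R 2 (volume.restrict (cell T)) ^ 2
      ≤ ENNReal.ofReal (δ T) * (4 * (ENNReal.ofReal cα ^ 2 * polyTraceConst r σ (diamT T))) *
        ∑ F ∈ facetsOf T, eLpNorm (fun x => ⟪β x, normal T F⟫_ℝ • M.jump tr T F x) 2
          (surf F) ^ 2 := by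
        refine (mul_le_mul_right h1 _).trans_eq ?_
        ring
    _ ≤ _ := by
        rw [hco, Finset.mul_sum]
        refine Finset.sum_le_sum fun F hF => ?_
        refine (mul_le_mul_right (eLpNorm_normal_jump_sq_le hM hb hw htr hT hF) _).trans ?_
        rw [Finset.mul_sum]
        refine Finset.sum_le_sum fun T' hT' => ?_
        have hT'c := (mem_sides.1 hT').1
        have hd' := (hM.isRegularTet hT'c).diamT_pos
        rw [← mul_assoc, ← ENNReal.ofReal_mul (by positivity)]
        refine mul_le_mul_left (ENNReal.ofReal_le_ofReal ?_) _
        -- the two elements have comparable diameters and parameters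
        have hdiam : diamT T' ≤ σ * diamT T :=
          diamT_le_of_common_facet (hM.isRegularTet hT'c) (mem_facetsOf_of_mem_sides hF hT')
            (Finset.mem_powersetCard.1 hF).1
        have hδ' : δ T ≤ |Cδ| * δ T' := by
          have hne : (simplex T' ∩ simplex T).Nonempty := by
            obtain ⟨p, hp⟩ : F.Nonempty := by
              rw [← Finset.card_pos, (Finset.mem_powersetCard.1 hF).2]; norm_num
            exact ⟨p, subset_convexHull ℝ _ ((mem_sides.1 hT').2 hp),
              subset_convexHull ℝ _ ((Finset.mem_powersetCard.1 hF).1 hp)⟩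
          exact (hδC T' hT'c T hT hne).trans
            (mul_le_mul_of_nonneg_right (le_abs_self Cδ) (hδ T' hT'c).le)
        have hq : δ T * (diamT T' / diamT T) ≤ |Cδ| * δ T' * σ := by
          refine mul_le_mul hδ' ((div_le_iff₀ hd).2 hdiam) (by positivity) ?_
          exact mul_nonneg (abs_nonneg _) (hδ T' hT'c).le
        calc _ = (8 * cα ^ 2 * facetConst.toReal * σ ^ 3 * polyConst r * errorTraceConst σ c *
              b T' ^ 2 * diamT T' ^ (2 * k)) * (δ T * (diamT T' / diamT T)) := by
              rw [pow_succ (diamT T')]; field_simp; ring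
          _ ≤ (8 * cα ^ 2 * facetConst.toReal * σ ^ 3 * polyConst r * errorTraceConst σ c *
              b T' ^ 2 * diamT T' ^ (2 * k)) * (|Cδ| * δ T' * σ) := by gcongr
          _ = _ := by rw [liftingConst, abs_of_pos hσ]; ring

/-- The second inequality: the discrete magnetic advection of the error. -/
theorem sum_discreteLie_le {r : ℕ} (V : FESpace M r) {σ c cα Cδ : ℝ} {k : ℕ}
    (hM : M.ShapeRegular σ) {β : E → E} (hβ : ContinuousOn β (closure Ω))
    {B : Finset E → Fin 3 → E → E} {b : Finset E → ℝ}
    (hb : ∀ T ∈ M.cells, FieldBound T β (B T) (b T)) {w tr z : Finset E → E → E}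
    {S : Finset E → ℝ≥0∞} (hw : ∀ T ∈ M.cells, ErrorBound k c T (w T) (S T))
    (htr : ∀ T ∈ M.cells, IsTrace T (w T) (tr T)) {α : Finset E → Finset E → E → ℝ}
    (hα : ∀ T ∈ M.cells, ∀ F ∈ facetsOf T, ∀ x ∈ simplex F, |α T F x| ≤ cα) (hcα : 0 ≤ cα)
    {δ : Finset E → ℝ} (hδ : ∀ T ∈ M.cells, 0 < δ T) (hδC : ∀ T ∈ M.cells, ∀ T' ∈ M.cells,
      (simplex T ∩ simplex T').Nonempty → δ T' ≤ Cδ * δ T)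
    (hz : ∀ T ∈ M.cells, V.IsDiscreteLie β α w tr T (z T)) :
    ∑ T ∈ M.cells, ENNReal.ofReal (δ T) * eLpNorm (z T) 2 (volume.restrict (cell T)) ^ 2 ≤
      ∑ T ∈ M.cells, ENNReal.ofReal ((2028 * c ^ 2 + 16 * liftingConst r σ c cα Cδ) * b T ^ 2 *
        δ T * diamT T ^ (2 * k)) * S T ^ 2 := by
  -- `2028 = 2 * 1014` and `16 = 2 * 8`, where the factor `2` comes from the square of the
  -- difference and `8` from the sum over the neighbours
  set L := liftingConst r σ c cα Cδ with hL
  have hL0 : 0 ≤ L := liftingConst_nonneg _ _ _ _ _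
  set X : Finset E → ℝ≥0∞ := fun T => ENNReal.ofReal (L * b T ^ 2 * δ T * diamT T ^ (2 * k)) *
    S T ^ 2 with hX
  have h1 : ∀ T ∈ M.cells,
      ENNReal.ofReal (δ T) * eLpNorm (z T) 2 (volume.restrict (cell T)) ^ 2 ≤
        ENNReal.ofReal (2028 * c ^ 2 * b T ^ 2 * δ T * diamT T ^ (2 * k)) * S T ^ 2 +
          2 * ∑ F ∈ facetsOf T, ∑ T' ∈ M.sides F, X T' := by
    intro T hT
    obtain ⟨A, R, hA, hR, hzAR⟩ := hz T hT
    have hreg := hM.isRegularTet hT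
    have hd := hreg.diamT_pos
    have hδT := hδ T hT
    have hRm : Measurable fun x => ‖R x‖ₑ ^ 2 :=
      (V.isPolyField_of_mem_loc hT hR.1).continuous.measurable.enorm.pow_const 2
    obtain ⟨g, hg⟩ := (hw T hT).exists_memH1
    have hAle : eLpNorm A 2 (volume.restrict (cell T)) ^ 2 ≤
        ENNReal.ofReal (1014 * b T ^ 2 * (c ^ 2 * diamT T ^ (2 * k))) * S T ^ 2 := by
      rw [ENNReal.ofReal_mul (by positivity), mul_assoc]
      refine ((hb T hT).eLpNorm_isLie_sq_le hreg hg hA).trans (mul_le_mul_right ?_ _)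
      exact (hw T hT).hNorm_one_sq_le hd.le
    have hzle : eLpNorm (z T) 2 (volume.restrict (cell T)) ^ 2 ≤
        2 * eLpNorm A 2 (volume.restrict (cell T)) ^ 2 +
          2 * eLpNorm R 2 (volume.restrict (cell T)) ^ 2 := by
      simp only [eLpNorm_two_sq]
      rw [← lintegral_const_mul' _ _ (by norm_num), ← lintegral_const_mul _ hRm,
        ← lintegral_add_right _ (hRm.const_mul 2)]
      refine lintegral_mono fun x => ?_
      rw [hzAR]
      exact (pow_le_pow_left' enorm_sub_le 2).trans (ennreal_add_sq_le _ _)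
    have hRle := lifting_sq_le V hM hβ hb hw htr hα hcα hδ hδC hT hR
    calc _ ≤ ENNReal.ofReal (δ T) * (2 * (ENNReal.ofReal (1014 * b T ^ 2 * (c ^ 2 *
          diamT T ^ (2 * k))) * S T ^ 2) +
          2 * eLpNorm R 2 (volume.restrict (cell T)) ^ 2) := by
          gcongr
          exact hzle.trans (by gcongr)
      _ = ENNReal.ofReal (δ T) * 2 * ENNReal.ofReal (1014 * b T ^ 2 * (c ^ 2 *
          diamT T ^ (2 * k))) * S T ^ 2 + 2 * (ENNReal.ofReal (δ T) *
            eLpNorm R 2 (volume.restrict (cell T)) ^ 2) := by ring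
      _ ≤ _ := by
          refine add_le_add (le_of_eq ?_) (mul_le_mul_right hRle 2)
          rw [← ENNReal.ofReal_ofNat 2, ← ENNReal.ofReal_mul hδT.le,
            ← ENNReal.ofReal_mul (by positivity)]
          congr 2
          ring
  refine (Finset.sum_le_sum h1).trans ?_
  rw [Finset.sum_add_distrib, ← Finset.mul_sum]
  refine (add_le_add le_rfl (mul_le_mul_right (sum_neighbours_le X) 2)).trans_eq ?_
  rw [← mul_assoc, Finset.mul_sum, ← Finset.sum_add_distrib]
  refine Finset.sum_congr rfl fun T hT => ?_
  have hd := (hM.isRegularTet hT).diamT_pos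
  have hδT := hδ T hT
  rw [hX, ← mul_assoc, ← add_mul, show (2 * 8 : ℝ≥0∞) = ENNReal.ofReal 16 by
      norm_num [ENNReal.ofReal_ofNat], ← ENNReal.ofReal_mul (by norm_num),
    ← ENNReal.ofReal_add (by positivity) (by positivity)]
  congr 2
  ring

end Assembly

end MagneticSUPG

open MagneticSUPG in
theorem lemma5p2
    (Ω : Set E) (hΩo : IsOpen Ω) (hΩb : Bornology.IsBounded Ω) (hΩ : interior (closure Ω) = Ω)
    (k : ℕ) (hk : 1 ≤ k) (r : ℕ) (σ CI Cα Cδ : ℝ) :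
    -- the constants are `C_T = Φ (‖β‖_{1,∞,T})`
    ∃ Φ : ℝ → ℝ, Monotone Φ ∧ (∀ t, 0 < Φ t) ∧
      ∀ (β : E → E), MemW 1 ∞ Ω β → ContinuousOn β (closure Ω) →
      ∀ (M : Mesh Ω), M.ShapeRegular σ →
      ∀ (α : Finset E → Finset E → E → ℝ), M.IsWeight β Cα α →
      ∀ (V : FESpace M r) (ih : (E → E) → Finset E → E → E), V.IsInterpolation k CI ih →
      ∀ (v : E → E), MemW (k + 1) 2 Ω v →
      -- the traces of `v - iₕ v` and the fields `L̃_{β,h} (v - iₕ v)` exist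
      (∃ tr z : Finset E → E → E, ∀ T ∈ M.cells,
        IsTrace T (fun x => v x - ih v T x) (tr T) ∧
        V.IsDiscreteLie β α (fun T x => v x - ih v T x) tr T (z T)) ∧
      -- and they satisfy the two bounds
      ∀ tr : Finset E → E → E,
        (∀ T ∈ M.cells, IsTrace T (fun x => v x - ih v T x) (tr T)) →
        (∑ F ∈ M.facets, ∑ T ∈ M.sides F,
            ∫⁻ x, ENNReal.ofReal |⟪β x, normal T F⟫_ℝ| * ‖tr T x‖ₑ ^ 2 ∂(surf F)
          ≤ ∑ T ∈ M.cells,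
            ENNReal.ofReal (Φ (wInfNorm (cell T) β).toReal * diamT T ^ (2 * k + 1)) *
              hSemi (k + 1) (cell T) v ^ 2) ∧
        ∀ δ : Finset E → ℝ, (∀ T ∈ M.cells, 0 < δ T) →
          (∀ T ∈ M.cells, ∀ T' ∈ M.cells, (simplex T ∩ simplex T').Nonempty →
            δ T' ≤ Cδ * δ T) →
          ∀ z : Finset E → E → E,
            (∀ T ∈ M.cells, V.IsDiscreteLie β α (fun T x => v x - ih v T x) tr T (z T)) →
            ∑ T ∈ M.cells, ENNReal.ofReal (δ T) * eLpNorm (z T) 2 (volume.restrict (cell T)) ^ 2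
              ≤ ∑ T ∈ M.cells,
                ENNReal.ofReal (Φ (wInfNorm (cell T) β).toReal * δ T * diamT T ^ (2 * k)) *
                  hSemi (k + 1) (cell T) v ^ 2 := by
  set K₁ := 4 * errorTraceConst σ |CI| with hK₁
  set K₂ := 2028 * |CI| ^ 2 + 16 * liftingConst r σ |CI| (1 + |Cα|) Cδ with hK₂
  have hK₁0 : 0 ≤ K₁ := mul_nonneg (by norm_num) (errorTraceConst_nonneg _ _)
  have hK₂0 : 0 ≤ K₂ := add_nonneg (by positivity)
    (mul_nonneg (by norm_num) (liftingConst_nonneg _ _ _ _ _))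
  -- the bounds are linear and quadratic in the norm of `β`, and `(1 + t) ^ 2` dominates both
  refine ⟨fun t => (1 + K₁ + K₂) * (1 + max t 0) ^ 2, ?_, fun t => by positivity, ?_⟩
  · intro s t hst
    simp only
    gcongr
  intro β hβ hβc M hM α hα V ih hih v hv
  have hsub : ∀ T ∈ M.cells, cell T ⊆ Ω := fun T hT => cell_subset hΩ hT
  set b : Finset E → ℝ := fun T => (wInfNorm (cell T) β).toReal with hbdef
  have hb0 : ∀ T, 0 ≤ b T := fun T => ENNReal.toReal_nonneg
  have hB : ∀ T, ∃ B, T ∈ M.cells → FieldBound T β B (b T) := by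
    intro T
    by_cases hT : T ∈ M.cells
    · obtain ⟨B, hB⟩ := (hM.isRegularTet hT).exists_fieldBound (hβ.mono (hsub T hT))
        (hβc.mono (simplex_subset hT))
      exact ⟨B, fun _ => hB⟩
    · exact ⟨0, fun h => absurd h hT⟩
  choose B hB using hB
  set w : Finset E → E → E := fun T x => v x - ih v T x with hwdef
  set S : Finset E → ℝ≥0∞ := fun T => hSemi (k + 1) (cell T) v with hS
  have hw : ∀ T ∈ M.cells, ErrorBound k |CI| T (w T) (S T) := by
    intro T hT
    have hd := (hM.isRegularTet hT).diamT_pos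
    have hle : ∀ n, ENNReal.ofReal (CI * diamT T ^ n) * S T ≤
        ENNReal.ofReal (|CI| * diamT T ^ n) * S T := fun n => by
      gcongr; exact le_abs_self CI
    exact ⟨abs_nonneg _, hSemi_lt_top (isOpen_cell T) (hv.mono (hsub T hT)),
      ((hih v hv).2 T hT 0 (by omega)).trans (hle (k + 1)),
      ((hih v hv).2 T hT 1 (by omega)).trans (hle k)⟩
  have hα' : ∀ T ∈ M.cells, ∀ F ∈ facetsOf T, ∀ x ∈ simplex F, |α T F x| ≤ 1 + |Cα| :=
    fun T hT F hF x hx => hα.abs_le hT hF hx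
  have hΦ : ∀ T, b T ≤ (1 + max (b T) 0) ^ 2 ∧ b T ^ 2 ≤ (1 + max (b T) 0) ^ 2 := by
    intro T
    rw [max_eq_left (hb0 T)]
    constructor <;> nlinarith [hb0 T, sq_nonneg (b T)]
  refine ⟨?_, fun tr htr => ⟨?_, fun δ hδ hδC z hz => ?_⟩⟩
  · have htr : ∀ T, ∃ t, T ∈ M.cells → IsTrace T (w T) t := by
      intro T
      by_cases hT : T ∈ M.cells
      · obtain ⟨g, hg⟩ := (hw T hT).exists_memH1
        obtain ⟨t, ht⟩ := (hM.isRegularTet hT).exists_isTrace hg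
        exact ⟨t, fun _ => ht⟩
      · exact ⟨0, fun h => absurd h hT⟩
    choose tr htr using htr
    have hz : ∀ T, ∃ z, T ∈ M.cells → V.IsDiscreteLie β α w tr T z := by
      intro T
      by_cases hT : T ∈ M.cells
      · obtain ⟨g, hg⟩ := (hw T hT).exists_memH1
        obtain ⟨A, hA⟩ := (hB T hT).exists_isLie (hM.isRegularTet hT) hg
        obtain ⟨R, hR⟩ := V.exists_isLifting (hM.isRegularTet hT) hT (hα.measurable T hT)
          (hα' T hT) (g := fun F x => ⟪β x, normal T F⟫_ℝ • M.jump tr T F x)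
          fun F hF => memLp_normal_jump hβc (fun T hT => (htr T hT).1) hT hF (hB T hT)
        exact ⟨fun x => A x - R x, fun _ => ⟨A, R, hA, hR, fun _ => rfl⟩⟩
      · exact ⟨0, fun h => absurd h hT⟩
    choose z hz using hz
    exact ⟨tr, z, fun T hT => ⟨htr T hT, hz T hT⟩⟩
  · refine (sum_facets_le hM hB hb0 hw htr).trans (Finset.sum_le_sum fun T hT => ?_)
    have hd := (hM.isRegularTet hT).diamT_pos
    refine mul_le_mul_left (ENNReal.ofReal_le_ofReal ?_) _
    refine mul_le_mul_of_nonneg_right ?_ (by positivity)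
    exact mul_le_mul (by linarith) (hΦ T).1 (hb0 T) (by positivity)
  · refine (sum_discreteLie_le V hM hβc hB hw htr hα' (by positivity) hδ hδC hz).trans
      (Finset.sum_le_sum fun T hT => ?_)
    have hd := (hM.isRegularTet hT).diamT_pos
    have hδT := hδ T hT
    refine mul_le_mul_left (ENNReal.ofReal_le_ofReal ?_) _
    refine mul_le_mul_of_nonneg_right (mul_le_mul_of_nonneg_right ?_ hδT.le) (by positivity)
    exact mul_le_mul (by linarith) (hΦ T).2 (sq_nonneg _) (by positivity)
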